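/- Let $h,g$ be analytic in the unit disk $\mathbb{D}$ with $|h'|+|g'|\neq 0$ there, and suppose that $h'g'=p^2$ for an analytic function $p$ on $\mathbb{D}$ (when $h'\not\equiv 0$ this says that the dilatation $g'/h'$ is the square of a meromorphic function). Let $f=h+\bar g$ and let $\tilde f=(\operatorname{Re} f,\ \operatorname{Im} f,\ 2\operatorname{Im}\!\int p\,dz):\mathbb{D}\to\mathbb{R}^3$ be the Weierstrass–Enneper lift, with image $\Sigma=\tilde f(\mathbb{D})$. Put $\sigma=\log(|h'|+|g'|)$, $\mathcal{S}\tilde f=2(\partial_{zz}\sigma-(\partial_z\sigma)^2)$ and $K(\tilde f(z))=-e^{-2\sigma(z)}\Delta\sigma(z)$. Suppose that for some $0\le\rho\le 1$ $$|\mathcal{S}\tilde f(z)|+e^{2\sigma(z)}|K(\tilde f(z))|\le\frac{2\rho}{(1-|z|^2)^2},\qquad z\in\mathbb{D},$$ and that $\tilde f$, extended to $\partial\mathbb{D}$ by limits in $\overline{\mathbb{R}^3}=\mathbb{R}^3\cup\{\infty\}$, is injective on $\partial\mathbb{D}$. For $\zeta\in\mathbb{D}$ let $T_\zeta$ be the affine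 tangent plane of $\Sigma$ at $\tilde f(\zeta)$, and let a best Möbius approximation $\mathcal{M}\tilde f(\cdot,\zeta)$ be a Möbius transformation of $\overline{\mathbb{R}^3}$ that maps $\mathbb{C}\cup\{\infty\}$ onto $T_\zeta\cup\{\infty\}$, satisfies $\mathcal{M}\tilde f(\zeta,\zeta)=\tilde f(\zeta)$, and is such that for every smooth curve $\psi$ in $\mathbb{D}$ with $\psi(0)=\zeta$ the curve $\mathcal{M}\tilde f(\psi(t),\zeta)$ and the orthogonal projection of $\tilde f(\psi(t))$ to $T_\zeta$ have second order contact at $t=0$. Let $C_\zeta$ be the Euclidean circle in $\mathbb{R}^3$ orthogonal to $\mathbb{D}$ through $\zeta$ and $1/\bar\zeta$ (for $\zeta=0$, the vertical line through $0$, together with $\infty$). Then best Möbius approximations exist at every $\zeta\in\mathbb{D}$, and, for any choice of them, the sets $C_{\tilde w}=\mathcal{M}\tilde f(C_\zeta,\zeta)$, $\tilde w=\tilde f(\zeta)$, form a circle bundle over $\Sigma$: each $C_{\tilde w}$ is a Euclidean circle or line, at most one of them is a line, and (i) $C_{\tilde w}$ is orthogonal to $\Sigma$ at $\tilde w$, and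 $C_{\tilde w}\cap\overline{\Sigma}=\{\tilde w\}$ (closure and intersection in $\overline{\mathbb{R}^3}$, lines containing $\infty$); (ii) circles with distinct parameters $\zeta$ are disjoint in $\overline{\mathbb{R}^3}$ (in particular $\tilde f$ is injective on $\mathbb{D}$); (iii) the circles cover exactly $\mathbb{R}^3\setminus\partial\Sigma$ in $\mathbb{R}^3$, where $\partial\Sigma=\overline{\Sigma}\setminus\Sigma$, with the closure taken in $\mathbb{R}^3$. -/

import Mathlib

open Filter Topology Set

noncomputable section

namespace HarmonicLift

/-- Euclidean space `ℝ³`. Its one-point compactification `OnePoint E3` is the extended space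
`ℝ³ ∪ {∞}` (a topological 3-sphere), on which Möbius transformations act. -/
abbrev E3 : Type := EuclideanSpace ℝ (Fin 3)

/-- The open unit disk. -/
abbrev disk : Set ℂ := Metric.ball (0 : ℂ) 1

/-- The inclusion of the complex plane in `ℝ³` as the horizontal plane through the origin. -/
def toSpace (z : ℂ) : E3 := !₂[z.re, z.im, 0]

/-- The upward vertical unit vector. -/
def vert : E3 := !₂[0, 0, 1]

/-! ### Weierstrass–Enneper lifts of harmonic mappings -/

/-- `F` is, on the unit disk, a Weierstrass–Enneper lift to `ℝ³` of the harmonic mapping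
`f = h + conj g`, where `h`, `g` are analytic and `|h'| + |g'| ≠ 0`. The first two coordinates of
`F` are those of `f`; the third one is `2 Im P`, where `P` is a primitive of an analytic square
root of `h' g'`. (If `h'` is not identically zero, such a square root exists exactly when the
dilatation `g' / h'` is the square of a meromorphic function `q`, and it is then `± h' q`.) -/
structure IsLift (h g : ℂ → ℂ) (F : ℂ → E3) : Prop where
  analytic_h : DifferentiableOn ℂ h disk
  analytic_g : DifferentiableOn ℂ g disk
  ne_zero : ∀ z ∈ disk, ‖deriv h z‖ + ‖deriv g z‖ ≠ 0
  exists_third : ∃ P : ℂ → ℂ, DifferentiableOn ℂ P disk ∧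
    (∀ z ∈ disk, deriv P z ^ 2 = deriv h z * deriv g z) ∧
    ∀ z ∈ disk, F z = !₂[(h z + starRingEnd ℂ (g z)).re, (h z + starRingEnd ℂ (g z)).im,
      2 * (P z).im]

/-- `σ = log (|h'| + |g'|)`: the conformal metric of the lift is `e^{2σ} |dz|²`. -/
def sigma (h g : ℂ → ℂ) (z : ℂ) : ℝ := Real.log (‖deriv h z‖ + ‖deriv g z‖)

/-- The Wirtinger derivative `∂_z = (∂_x - i ∂_y) / 2`. -/
def dz (u : ℂ → ℂ) (z : ℂ) : ℂ :=
  (fderiv ℝ u z 1 - Complex.I * fderiv ℝ u z Complex.I) / 2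

/-- The Schwarzian derivative `2 (∂_zz σ - (∂_z σ)²)` of the lift. -/
def schwarzian (h g : ℂ → ℂ) (z : ℂ) : ℂ :=
  2 * (dz (dz fun w => (sigma h g w : ℂ)) z - dz (fun w => (sigma h g w : ℂ)) z ^ 2)

/-- The Gaussian curvature `- e^{-2σ} Δσ` of the surface at the image of `z`. -/
def curvature (h g : ℂ → ℂ) (z : ℂ) : ℝ :=
  -(Real.exp (-2 * sigma h g z) * Laplacian.laplacian (sigma h g) z)

/-- The condition `|S(z)| + e^{2σ(z)} |K(z)| ≤ 2ρ / (1 - |z|²)²` on the unit disk. -/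
def AhlforsWeillCondition (ρ : ℝ) (h g : ℂ → ℂ) : Prop :=
  ∀ z ∈ disk, ‖schwarzian h g z‖ + Real.exp (2 * sigma h g z) * |curvature h g z| ≤
    2 * ρ / (1 - ‖z‖ ^ 2) ^ 2

/-- The extension of `F` from the unit disk to the closed disk by limits in `ℝ³ ∪ {∞}`. -/
def sphericalExtension (F : ℂ → E3) : ℂ → OnePoint E3 :=
  extendFrom disk fun z => (F z : OnePoint E3)

/-! ### Möbius transformations of `ℝ³ ∪ {∞}` -/

open Classical in
/-- Inversion of `ℝ³ ∪ {∞}` in the sphere with center `c` and radius `R`. -/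
def sphereInversion (c : E3) (R : ℝ) (p : OnePoint E3) : OnePoint E3 :=
  p.elim (c : OnePoint E3) fun x =>
    if x = c then OnePoint.infty else ((EuclideanGeometry.inversion c R x : E3) : OnePoint E3)

/-- Reflection of `ℝ³ ∪ {∞}` in the plane through `a` orthogonal to `n`. -/
def planeReflection (a n : E3) : OnePoint E3 → OnePoint E3 :=
  OnePoint.map fun x => a + (Submodule.span ℝ {n})ᗮ.reflection (x - a)

/-- Möbius transformations: finite compositions of inversions in spheres and reflections in
planes. -/
inductive IsMobius : (OnePoint E3 → OnePoint E3) → Prop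
  | id : IsMobius id
  | inversion_comp (c : E3) (R : ℝ) (hR : 0 < R) (T : OnePoint E3 → OnePoint E3) :
      IsMobius T → IsMobius (sphereInversion c R ∘ T)
  | reflection_comp (a n : E3) (hn : n ≠ 0) (T : OnePoint E3 → OnePoint E3) :
      IsMobius T → IsMobius (planeReflection a n ∘ T)

/-! ### Circles -/

/-- The Euclidean circle with center `c` and radius `r` in the plane through `c` spanned by the
orthonormal vectors `u`, `v`. -/
def circleSet (c u v : E3) (r : ℝ) : Set (OnePoint E3) :=
  range fun θ : ℝ => ((c + r • (Real.cos θ • u + Real.sin θ • v) : E3) : OnePoint E3)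

/-- The Euclidean line through `p` with direction `v`, including the point at infinity. -/
def lineSet (p v : E3) : Set (OnePoint E3) :=
  insert OnePoint.infty (range fun t : ℝ => ((p + t • v : E3) : OnePoint E3))

/-- `C` is a Euclidean circle or line which passes through `p` and whose tangent line at `p` is
orthogonal to the linear subspace `V` (with tangent vector `v`). -/
def IsOrthogonalCircleAt (C : Set (OnePoint E3)) (p : E3) (V : Submodule ℝ E3) : Prop :=
  (∃ (c u v : E3) (r : ℝ), 0 < r ∧ ‖u‖ = 1 ∧ ‖v‖ = 1 ∧ inner ℝ u v = 0 ∧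
    p = c + r • u ∧ v ∈ Vᗮ ∧ C = circleSet c u v r) ∨
  ∃ v : E3, v ≠ 0 ∧ v ∈ Vᗮ ∧ C = lineSet p v

/-- The reflected point `1 / conj ζ`. -/
def reflected (ζ : ℂ) : ℂ := 1 / starRingEnd ℂ ζ

/-- The circle of the model bundle with base point `ζ` in the unit disk: it is orthogonal to the
disk and passes through `ζ` and `1 / conj ζ`, so that these points are the ends of a diameter; for
`ζ = 0` it is the vertical line through the origin. -/
def modelCircle (ζ : ℂ) : Set (OnePoint E3) :=
  if ζ = 0 then lineSet 0 vert
  else circleSet (toSpace ((ζ + reflected ζ) / 2)) (toSpace (ζ / (‖ζ‖ : ℂ))) vert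
    (‖reflected ζ - ζ‖ / 2)

/-! ### Best Möbius approximations -/

/-- The linear tangent plane at the image of `ζ` of the surface parametrized by `F`. -/
def tangentPlane (F : ℂ → E3) (ζ : ℂ) : Submodule ℝ E3 :=
  LinearMap.range (fderiv ℝ F ζ : ℂ →ₗ[ℝ] E3)

/-- `M` is a best Möbius approximation to `F` at `ζ`: a Möbius transformation that maps the
(extended) complex plane onto the (extended) affine tangent plane at `F ζ`, sends `ζ` to `F ζ`,
and is such that for every smooth curve `ψ` with `ψ 0 = ζ` the curve `M ∘ ψ` and the orthogonal
projection of `F ∘ ψ` to the tangent plane have contact of second order at parameter `0`.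
Only the values of `ψ` near `0` matter; `m` denotes `M` on the plane near `ζ`, where it is
finite. -/
def IsBestMobius (F : ℂ → E3) (ζ : ℂ) (M : OnePoint E3 → OnePoint E3) : Prop :=
  IsMobius M ∧
  M '' insert OnePoint.infty (range fun z : ℂ => (toSpace z : OnePoint E3)) =
    insert OnePoint.infty ((fun v : E3 => ((F ζ + v : E3) : OnePoint E3)) ''
      (tangentPlane F ζ : Set E3)) ∧
  M (toSpace ζ) = F ζ ∧
  ∃ m : ℂ → E3, (∀ᶠ z in 𝓝 ζ, M (toSpace z) = m z) ∧
    ∀ ψ : ℝ → ℂ, ContDiff ℝ (⊤ : ℕ∞) ψ → ψ 0 = ζ →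
      (fun t => (F ζ + (tangentPlane F ζ).starProjection (F (ψ t) - F ζ)) - m (ψ t))
        =o[𝓝 0] fun t : ℝ => t ^ 2

/-! ### Circle bundles -/

/-- The surface parametrized by `F` on the unit disk. -/
def surface (F : ℂ → E3) : Set E3 := F '' disk

/-- The sets `C ζ`, `ζ` in the unit disk, form a circle bundle over the surface `Σ` parametrized by
`F`, with `C ζ` having base point `F ζ`. Circles, closures and intersections are taken in
`ℝ³ ∪ {∞}`, lines pass through `∞`, and the boundary of `Σ` in `ℝ³` is `closure Σ \ Σ`. -/
structure IsCircleBundle (F : ℂ → E3) (C : ℂ → Set (OnePoint E3)) : Prop where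
  line_unique : ∀ ζ₁ ∈ disk, ∀ ζ₂ ∈ disk,
    OnePoint.infty ∈ C ζ₁ → OnePoint.infty ∈ C ζ₂ → ζ₁ = ζ₂
  orthogonal : ∀ ζ ∈ disk, IsOrthogonalCircleAt (C ζ) (F ζ) (tangentPlane F ζ)
  inter_closure : ∀ ζ ∈ disk,
    C ζ ∩ closure ((fun p : E3 => (p : OnePoint E3)) '' surface F) = {(F ζ : OnePoint E3)}
  disjoint : ∀ ζ₁ ∈ disk, ∀ ζ₂ ∈ disk, ζ₁ ≠ ζ₂ → Disjoint (C ζ₁) (C ζ₂)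
  cover : (fun p : E3 => (p : OnePoint E3)) ⁻¹' (⋃ ζ ∈ disk, C ζ) =
    (closure (surface F) \ surface F)ᶜ

end HarmonicLift

end

/-! The lift is the real part of a holomorphic null curve `Φ` in complex 3-space, with `|Re Φ'| =
e^σ`. To a point `p` of extended space belongs a profile on the disk, the square root of `|F - p|² /
((1 - |z|²) e^σ)`, where `|F - p|²` is read as `1` for `p = ∞`. Along a unit speed hyperbolic
geodesic it equals `|V|^(-1/2)`, with `V` the velocity of the image curve after an inversion that
sends `p` to `∞`. Its second derivative is governed by Ahlfors' Schwarzian of a space curve, a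
Möbius invariant. The geodesic parametrization contributes `-2` to it, and the hypothesis on
Schwarzian and curvature is what makes the total nonpositive (`ahlfors_nonpos`). Hence every profile
is convex along every geodesic (`convexity_eq`, `convexOn_prof`).

The circle at `ζ` consists of `F ζ` and the points whose profile is critical at `ζ`. Both
descriptions lead to `(p - w) · Φ'(ζ) = Λ |p - w|²` with `w = F ζ` and `Λ = conj ζ / (1 - |ζ|²) -
∂_z σ(ζ)`. On the profile side this is the vanishing of a logarithmic derivative (`logSlope_zero`).
On the Möbius side, a Möbius map is a similarity, possibly after one inversion; second order contact
fixes its pole in terms of `∂_z σ`, and transporting the model circle, whose parameter is `conj ζ /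
(1 - |ζ|²)`, subtracts `∂_z σ` (`IsBestMobius.image_modelCircle`).

By convexity, critical points of a profile are minima. A point off the surface on two circles would
have a profile with two minima, constant on the geodesic between them. Equality in the convexity
estimate makes the inverted curve a line of constant speed, so `p` is the boundary value at both
ends of the geodesic, against injectivity (`not_prof_eqOn`). If a boundary value `p` lay on a
circle, its profile would grow linearly on the geodesic towards it; then the inverted curve has
finite length and cannot reach `∞` (`notMem_of_tendsto`). Finally, one nondegenerate profile grows
linearly in all directions (`exists_growth`). This yields the boundary values and, by comparison, a
minimum of the profile of each point off the closure, hence a circle through it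
(`exists_mem_surfaceCircle`). -/

noncomputable section
namespace HarmonicLift
open scoped ContDiff

/-! ### Complex vectors -/

/-- Complex vectors with three components. -/
abbrev C3 : Type := EuclideanSpace ℂ (Fin 3)

/-- The real part of a complex vector. -/
def reV : C3 →L[ℝ] E3 :=
  LinearMap.toContinuousLinearMap
    { toFun := fun X => !₂[(X 0).re, (X 1).re, (X 2).re]
      map_add' := fun X Y => by ext i; fin_cases i <;> simp
      map_smul' := fun c X => by ext i; fin_cases i <;> simp }

/-- The complex bilinear extension of the Euclidean inner product. -/
def bil (X Y : C3) : ℂ := X 0 * Y 0 + X 1 * Y 1 + X 2 * Y 2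

/-- The complex bilinear pairing of a real vector with a complex one. -/
def pair (q : E3) (X : C3) : ℂ := q 0 * X 0 + q 1 * X 1 + q 2 * X 2

/-- The horizontal part of a vector as a complex number. -/
def hor (y : E3) : ℂ := ⟨y 0, y 1⟩

lemma reV_apply (X : C3) : reV X = !₂[(X 0).re, (X 1).re, (X 2).re] := rfl

lemma inner_C3 (X Y : C3) : inner ℂ X Y =
    starRingEnd ℂ (X 0) * Y 0 + starRingEnd ℂ (X 1) * Y 1 + starRingEnd ℂ (X 2) * Y 2 := by
  simp [PiLp.inner_apply, Fin.sum_univ_three, mul_comm]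

lemma inner_E3 (x y : E3) : inner ℝ x y = x 0 * y 0 + x 1 * y 1 + x 2 * y 2 := by
  simp [PiLp.inner_apply, Fin.sum_univ_three, mul_comm]

lemma norm_sq_E3 (x : E3) : ‖x‖ ^ 2 = x 0 ^ 2 + x 1 ^ 2 + x 2 ^ 2 := by
  rw [← real_inner_self_eq_norm_sq, inner_E3]; ring

lemma norm_sq_C3 (X : C3) : ‖X‖ ^ 2 = Complex.normSq (X 0) + Complex.normSq (X 1) +
    Complex.normSq (X 2) := by
  simp [EuclideanSpace.norm_sq_eq, Fin.sum_univ_three, Complex.normSq_eq_norm_sq]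

/-- Expand `Re X = (X + conj X) / 2`. For null vectors the bilinear term drops out, so the real
geometry of the surface is half of the Hermitian geometry of the null curve. -/
lemma inner_reV_reV (X Y : C3) :
    inner ℝ (reV X) (reV Y) = (inner ℂ X Y + bil X Y).re / 2 := by
  simp only [inner_E3, reV_apply, inner_C3, bil]
  simp
  ring

lemma inner_reV (q : E3) (X : C3) : inner ℝ q (reV X) = (pair q X).re := by
  simp [inner_E3, reV_apply, pair]

lemma norm_sq_reV (X : C3) : ‖reV X‖ ^ 2 = (‖X‖ ^ 2 + (bil X X).re) / 2 := by
  rw [← real_inner_self_eq_norm_sq, inner_reV_reV]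
  simp [inner_self_eq_norm_sq_to_K, ← Complex.ofReal_pow]

lemma pair_smul (q : E3) (c : ℂ) (X : C3) : pair q (c • X) = c * pair q X := by
  simp [pair]; ring

lemma bil_smul_smul (c d : ℂ) (X Y : C3) : bil (c • X) (d • Y) = c * d * bil X Y := by
  simp [bil]; ring

lemma bil_comm (X Y : C3) : bil X Y = bil Y X := by simp [bil, mul_comm]

lemma bil_add_left (X Y Z : C3) : bil (X + Y) Z = bil X Z + bil Y Z := by simp [bil]; ring

lemma bil_add_right (X Y Z : C3) : bil X (Y + Z) = bil X Y + bil X Z := by simp [bil]; ring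

lemma bil_smul_left (c : ℂ) (X Y : C3) : bil (c • X) Y = c * bil X Y := by simp [bil]; ring

lemma bil_smul_right (c : ℂ) (X Y : C3) : bil X (c • Y) = c * bil X Y := by simp [bil]; ring

/-- Complex numbers with the same real parts of all rotations are equal. -/
lemma eq_of_forall_re_mul {a b : ℂ} (h : ∀ δ : ℂ, (a * δ).re = (b * δ).re) : a = b := by
  apply Complex.ext
  · simpa using h 1
  · simpa using h Complex.I

lemma norm_bil_self_le (X : C3) : ‖bil X X‖ ≤ ‖X‖ ^ 2 := by
  rw [norm_sq_C3]
  simp only [bil, Complex.normSq_eq_norm_sq]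
  calc _ ≤ ‖X 0 * X 0‖ + ‖X 1 * X 1‖ + ‖X 2 * X 2‖ := norm_add₃_le
    _ = _ := by simp only [norm_mul]; ring

lemma norm_sq_reV_of_null {X : C3} (h : bil X X = 0) : ‖reV X‖ ^ 2 = ‖X‖ ^ 2 / 2 := by
  simp [norm_sq_reV, h]

lemma norm_reV_smul {X : C3} (h : bil X X = 0) (c : ℂ) : ‖reV (c • X)‖ = ‖c‖ * ‖reV X‖ := by
  have h1 : bil (c • X) (c • X) = 0 := by rw [bil_smul_smul, h, mul_zero]
  rw [← sq_eq_sq₀ (norm_nonneg _) (by positivity), mul_pow, norm_sq_reV_of_null h,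
    norm_sq_reV_of_null h1, norm_smul]
  ring

lemma reV_ne_zero {X : C3} (h : bil X X = 0) (h0 : X ≠ 0) : reV X ≠ 0 := by
  intro h1
  have := norm_sq_reV_of_null h
  have h2 : 0 < ‖X‖ := norm_pos_iff.2 h0
  rw [h1, norm_zero] at this
  have h3 : 0 < ‖X‖ ^ 2 / 2 := by positivity
  linarith

lemma hor_toSpace (z : ℂ) : hor (toSpace z) = z := by
  apply Complex.ext <;> simp [hor, toSpace]

lemma toSpace_hor_add (y : E3) : y = toSpace (hor y) + y 2 • vert := by
  ext i; fin_cases i <;> simp [hor, toSpace, vert]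

lemma inner_toSpace (y : E3) (z : ℂ) :
    inner ℝ y (toSpace z) = (starRingEnd ℂ (hor y) * z).re := by
  simp [inner_E3, toSpace, hor]

lemma norm_sq_hor (y : E3) : ‖y‖ ^ 2 = ‖hor y‖ ^ 2 + y 2 ^ 2 := by
  rw [norm_sq_E3, ← Complex.normSq_eq_norm_sq, Complex.normSq_apply]; simp [hor]; ring

lemma norm_toSpace (z : ℂ) : ‖toSpace z‖ = ‖z‖ := by
  rw [← sq_eq_sq₀ (norm_nonneg _) (norm_nonneg _), norm_sq_hor, hor_toSpace]; simp [toSpace]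

/-- The plane as a real linear subspace of space. -/
def toSpaceL : ℂ →L[ℝ] E3 :=
  LinearMap.toContinuousLinearMap
    { toFun := toSpace
      map_add' := fun X Y => by ext i; fin_cases i <;> simp [toSpace]
      map_smul' := fun c X => by ext i; fin_cases i <;> simp [toSpace] }

lemma toSpaceL_apply (z : ℂ) : toSpaceL z = toSpace z := rfl

lemma toSpace_add (z w : ℂ) : toSpace (z + w) = toSpace z + toSpace w := toSpaceL.map_add z w

lemma toSpace_sub (z w : ℂ) : toSpace (z - w) = toSpace z - toSpace w := toSpaceL.map_sub z w

lemma toSpace_smul (c : ℝ) (w : ℂ) : toSpace (c * w) = c • toSpace w := by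
  rw [← toSpaceL_apply, ← toSpaceL_apply, ← toSpaceL.map_smul, Complex.real_smul]

lemma hor_add (x y : E3) : hor (x + y) = hor x + hor y := by
  apply Complex.ext <;> simp [hor]

lemma hor_sub (x y : E3) : hor (x - y) = hor x - hor y := by
  apply Complex.ext <;> simp [hor]

lemma hor_smul (c : ℝ) (x : E3) : hor (c • x) = c * hor x := by
  apply Complex.ext <;> simp [hor]

lemma norm_vert : ‖vert‖ = 1 := by
  rw [← sq_eq_sq₀ (norm_nonneg _) (by norm_num), norm_sq_E3]; simp [vert]

/-- A null vector `X` spans the image of the horizontal plane under a similarity. -/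
lemma exists_frame {X : C3} (h : bil X X = 0) (h0 : X ≠ 0) :
    ∃ R : E3 ≃ₗᵢ[ℝ] E3, ∀ δ : ℂ, reV (δ • X) = ‖reV X‖ • R (toSpace δ) := by
  have hl : 0 < ‖reV X‖ := norm_pos_iff.2 (reV_ne_zero h h0)
  set l := ‖reV X‖ with hldef
  let S : Submodule ℝ E3 := LinearMap.range (toSpaceL : ℂ →ₗ[ℝ] E3)
  let e : ℂ ≃ₗ[ℝ] S := LinearEquiv.ofInjective (toSpaceL : ℂ →ₗ[ℝ] E3) (fun a b hab => by
    have : hor (toSpace a) = hor (toSpace b) := congrArg hor hab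
    simpa [hor_toSpace] using this)
  let f : ℂ →ₗ[ℝ] E3 :=
    { toFun := fun δ => l⁻¹ • reV (δ • X)
      map_add' := fun a b => by rw [add_smul, map_add, smul_add]
      map_smul' := fun c b => by
        rw [smul_assoc, map_smul, smul_comm]; rfl }
  have he : ∀ x : S, ‖e.symm x‖ = ‖x‖ := by
    intro x
    obtain ⟨z, rfl⟩ := e.surjective x
    rw [e.symm_apply_apply]
    exact (norm_toSpace z).symm
  -- Nullity makes `δ ↦ reV (δ • X)` conformal, so dividing by `l` gives an isometry of the plane
  -- into space, which extends to all of space.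
  let L : S →ₗᵢ[ℝ] E3 :=
    { toLinearMap := f ∘ₗ e.symm.toLinearMap
      norm_map' := fun x => by
        change ‖l⁻¹ • reV (e.symm x • X)‖ = _
        rw [norm_smul, norm_reV_smul h, ← hldef, ← he x, norm_inv, Real.norm_of_nonneg hl.le]
        field_simp }
  refine ⟨L.extend.toLinearIsometryEquiv rfl, fun δ => ?_⟩
  have h2 : L.extend.toLinearIsometryEquiv rfl (toSpace δ) = L (e δ) := by
    rw [← LinearIsometry.extend_apply L (e δ)]; rfl
  rw [h2]
  change _ = l • (l⁻¹ • reV (e.symm (e δ) • X))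
  rw [e.symm_apply_apply, smul_smul, mul_inv_cancel₀ hl.ne', one_smul]

lemma pair_frame {X : C3} {R : E3 ≃ₗᵢ[ℝ] E3} {l : ℝ}
    (hR : ∀ δ : ℂ, reV (δ • X) = l • R (toSpace δ)) (y : E3) :
    pair (R y) X = l * starRingEnd ℂ (hor y) := by
  apply eq_of_forall_re_mul
  intro δ
  rw [mul_comm, ← pair_smul, ← inner_reV, hR, inner_smul_right, R.inner_map_map, inner_toSpace,
    mul_assoc, Complex.re_ofReal_mul]


/-! ### Similarities and inversions -/

/-- The similarity `x ↦ b + l R x` of extended space. -/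
def simil (b : E3) (l : ℝ) (R : E3 ≃ₗᵢ[ℝ] E3) : OnePoint E3 → OnePoint E3 :=
  OnePoint.map fun x => b + l • R x

/-- Inversion of space in the unit sphere around the origin, with the value `0` at `0`. -/
def inv0 (y : E3) : E3 := (‖y‖ ^ 2)⁻¹ • y

open Classical in
/-- The Möbius transformation `x ↦ b + l R ι(x - c)`, where `ι` is the inversion in the unit
sphere. -/
def invSimil (b c : E3) (l : ℝ) (R : E3 ≃ₗᵢ[ℝ] E3) (p : OnePoint E3) : OnePoint E3 :=
  p.elim (b : OnePoint E3) fun x =>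
    if x = c then OnePoint.infty else ((b + l • R (inv0 (x - c)) : E3) : OnePoint E3)

lemma norm_inv0 (y : E3) : ‖inv0 y‖ = ‖y‖⁻¹ := by
  rcases eq_or_ne y 0 with rfl | h
  · simp [inv0]
  · have : ‖y‖ ≠ 0 := norm_ne_zero_iff.2 h
    rw [inv0, norm_smul, norm_inv, norm_pow, norm_norm]
    field_simp

lemma inv0_inv0 (y : E3) : inv0 (inv0 y) = y := by
  rcases eq_or_ne y 0 with rfl | h
  · simp [inv0]
  · have : ‖y‖ ≠ 0 := norm_ne_zero_iff.2 h
    rw [inv0, norm_inv0, inv0, smul_smul, inv_pow, inv_inv, mul_inv_cancel₀ (by positivity),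
      one_smul]

lemma inv0_smul_map (R : E3 ≃ₗᵢ[ℝ] E3) (l : ℝ) (y : E3) :
    inv0 (l • R y) = l⁻¹ • R (inv0 y) := by
  rcases eq_or_ne l 0 with rfl | h
  · simp [inv0]
  · rw [inv0, inv0, norm_smul, R.norm_map, smul_smul, map_smul, smul_smul, mul_pow, Real.norm_eq_abs,
      sq_abs]
    congr 1
    field_simp

lemma inv0_zero : inv0 0 = 0 := by simp [inv0]

lemma inv0_eq_zero {y : E3} : inv0 y = 0 ↔ y = 0 := by
  rw [← norm_eq_zero, norm_inv0, inv_eq_zero, norm_eq_zero]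

lemma inv0_neg (y : E3) : inv0 (-y) = -inv0 y := by simp [inv0]

lemma norm_add_sq_E3 (x y : E3) : ‖x + y‖ ^ 2 = ‖x‖ ^ 2 + 2 * inner ℝ x y + ‖y‖ ^ 2 :=
  norm_add_sq_real x y

lemma reflection_perp_apply (d v : E3) :
    (Submodule.span ℝ {d})ᗮ.reflection v = v - (2 * (inner ℝ d v / ‖d‖ ^ 2)) • d := by
  rw [Submodule.reflection_orthogonal_apply, Submodule.reflection_singleton_apply, mul_smul]
  simp [ofNat_smul_eq_nsmul, two_smul]

/-- Two inversions with a translation between them are a similarity after one inversion. -/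
lemma inv0_inv0_add {x d : E3} (hd : d ≠ 0) (hx : x ≠ 0) (h : x + inv0 d ≠ 0) :
    inv0 (inv0 x + d) =
      inv0 d + (‖d‖ ^ 2)⁻¹ • (Submodule.span ℝ {d})ᗮ.reflection (inv0 (x + inv0 d)) := by
  rw [reflection_perp_apply]
  have hD : ‖d‖ ^ 2 ≠ 0 := by positivity
  have hq : ‖x‖ ^ 2 ≠ 0 := by positivity
  have h1 : ‖inv0 x + d‖ ^ 2 = (1 + 2 * inner ℝ x d + ‖d‖ ^ 2 * ‖x‖ ^ 2) / ‖x‖ ^ 2 := by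
    rw [norm_add_sq_E3, norm_inv0, inv0, inner_smul_left]
    simp only [conj_trivial]
    field_simp
  have h2 : ‖x + inv0 d‖ ^ 2 = (1 + 2 * inner ℝ x d + ‖d‖ ^ 2 * ‖x‖ ^ 2) / ‖d‖ ^ 2 := by
    rw [norm_add_sq_E3, norm_inv0, inv0, inner_smul_right]
    field_simp
    ring
  have hW : 1 + 2 * inner ℝ x d + ‖d‖ ^ 2 * ‖x‖ ^ 2 ≠ 0 := by
    intro h0
    rw [h0, zero_div] at h2
    exact h (by simpa using h2)
  have h3 : inner ℝ d (inv0 (x + inv0 d)) =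
      (‖x + inv0 d‖ ^ 2)⁻¹ * (inner ℝ x d + 1) := by
    rw [inv0, inner_smul_right, inner_add_right, inv0, inner_smul_right,
      real_inner_self_eq_norm_sq, real_inner_comm]
    field_simp
  rw [h3]
  unfold inv0 at h1 h2 ⊢
  rw [h1, h2]
  ext i
  simp only [PiLp.smul_apply, PiLp.add_apply, PiLp.sub_apply, smul_eq_mul]
  generalize inner ℝ x d = t at *
  generalize ‖d‖ ^ 2 = D at *
  generalize ‖x‖ ^ 2 = q at *
  field_simp
  ring

lemma sphereInversion_infty (c : E3) (r : ℝ) : sphereInversion c r OnePoint.infty = c := rfl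

open Classical in
lemma sphereInversion_coe (c : E3) (r : ℝ) (x : E3) : sphereInversion c r x =
    if x = c then OnePoint.infty else ((c + r ^ 2 • inv0 (x - c) : E3) : OnePoint E3) := by
  simp only [sphereInversion, OnePoint.elim_some]
  split_ifs with h
  · rfl
  · rw [EuclideanGeometry.inversion, vsub_eq_sub, vadd_eq_add, inv0, dist_eq_norm, add_comm,
      smul_smul, div_pow]
    rfl

lemma planeReflection_coe (a n x : E3) : planeReflection a n x =
    ((a + (Submodule.span ℝ {n})ᗮ.reflection (x - a) : E3) : OnePoint E3) := rfl

/-- Möbius transformations are similarities, possibly after an inversion. -/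
lemma IsMobius.eq_simil_or_invSimil {M : OnePoint E3 → OnePoint E3} (hM : IsMobius M) :
    (∃ b l R, 0 < l ∧ M = simil b l R) ∨ ∃ b c l R, 0 < l ∧ M = invSimil b c l R := by
  induction hM with
  | id =>
    refine Or.inl ⟨0, 1, LinearIsometryEquiv.refl ℝ E3, one_pos, ?_⟩
    funext p
    induction p using OnePoint.rec with
    | infty => rfl
    | coe x => simp [simil]
  | inversion_comp c r hr T _ ih =>
    rcases ih with ⟨b, l, R, hl, rfl⟩ | ⟨b, c', l, R, hl, rfl⟩
    -- The new pole is the preimage of the center `c` under the similarity.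
    · refine Or.inr ⟨c, R.symm (l⁻¹ • (c - b)), r ^ 2 / l, R, by positivity, ?_⟩
      funext p
      induction p using OnePoint.rec with
      | infty => rfl
      | coe x =>
        have key : b + l • R x - c = l • R (x - R.symm (l⁻¹ • (c - b))) := by
          rw [map_sub, R.apply_symm_apply, smul_sub, smul_smul, mul_inv_cancel₀ hl.ne', one_smul]
          abel
        have h1 : b + l • R x = c ↔ x = R.symm (l⁻¹ • (c - b)) := by
          rw [← sub_eq_zero, key, smul_eq_zero_iff_right hl.ne', map_eq_zero_iff _ R.injective,
            sub_eq_zero]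
        simp only [Function.comp_apply, simil, OnePoint.map_some, invSimil, OnePoint.elim_some,
          sphereInversion_coe, h1]
        split_ifs
        · rfl
        · rw [key, inv0_smul_map, smul_smul, div_eq_mul_inv]
    -- Since `b` is the image of `∞`, inverting about `b` returns `∞` to itself and the two
    -- inversions cancel to a similarity. Otherwise the pole moves to the preimage `c' - inv0 d` of
    -- `c`.
    · by_cases hb : b = c
      · subst hb
        refine Or.inl ⟨b - (r ^ 2 / l) • R c', r ^ 2 / l, R, by positivity, ?_⟩
        funext p
        induction p using OnePoint.rec with
        | infty => simp [simil, invSimil, sphereInversion_coe]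
        | coe x =>
          simp only [Function.comp_apply, simil, OnePoint.map_some, invSimil, OnePoint.elim_some]
          split_ifs with h
          · rw [sphereInversion_infty, h]; simp
          · have h0 : ¬ b + l • R (inv0 (x - c')) = b := by
              simp [hl.ne', inv0_eq_zero, sub_eq_zero, h]
            rw [sphereInversion_coe, if_neg h0, add_sub_cancel_left, inv0_smul_map, inv0_inv0,
              smul_smul, map_sub, smul_sub, div_eq_mul_inv]
            congr 1
            abel
      · set d := R.symm (l⁻¹ • (b - c)) with hd
        have hbc : b - c = l • R d := by
          rw [hd, R.apply_symm_apply, smul_smul, mul_inv_cancel₀ hl.ne', one_smul]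
        have hd0 : d ≠ 0 := by
          intro h; rw [h] at hbc; simp [sub_eq_zero] at hbc; exact hb hbc
        have hdn : ‖d‖ ^ 2 ≠ 0 := by positivity
        refine Or.inr ⟨c + (r ^ 2 / l) • R (inv0 d), c' - inv0 d, r ^ 2 / (l * ‖d‖ ^ 2),
          ((Submodule.span ℝ {d})ᗮ.reflection).trans R, by positivity, ?_⟩
        funext p
        induction p using OnePoint.rec with
        | infty =>
          simp only [Function.comp_apply, invSimil, OnePoint.elim_infty]
          rw [sphereInversion_coe, if_neg hb, hbc, inv0_smul_map, smul_smul, div_eq_mul_inv]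
        | coe x =>
          simp only [Function.comp_apply, invSimil, OnePoint.elim_some]
          have hs : x - (c' - inv0 d) = (x - c') + inv0 d := by abel
          -- The old pole passes through `∞` to `c`. The formula gives the same value because the
          -- reflection sends `d` to `-d`.
          by_cases h : x = c'
          · rw [if_pos h, sphereInversion_infty, if_neg, hs, h, sub_self, zero_add, inv0_inv0]
            · simp only [LinearIsometryEquiv.trans_apply, reflection_perp_apply,
                real_inner_self_eq_norm_sq, div_self hdn, mul_one]
              rw [← map_smul, ← map_smul, add_assoc, ← map_add, inv0]
              congr 1
              have : (r ^ 2 / l) • (‖d‖ ^ 2)⁻¹ • d + (r ^ 2 / (l * ‖d‖ ^ 2)) • (d - (2 : ℝ) • d)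
                  = 0 := by
                ext i; simp; field_simp; ring
              rw [this, map_zero, add_zero]
            · rw [← sub_eq_zero, hs, h, sub_self, zero_add]
              simpa [inv0_eq_zero] using hd0
          · rw [if_neg h, sphereInversion_coe]
            have key : b + l • R (inv0 (x - c')) - c = l • R (inv0 (x - c') + d) := by
              rw [map_add, smul_add, ← hbc]; abel
            have h1 : b + l • R (inv0 (x - c')) = c ↔ x = c' - inv0 d := by
              rw [← sub_eq_zero, key, smul_eq_zero_iff_right hl.ne', map_eq_zero_iff _ R.injective,
                add_eq_zero_iff_eq_neg, ← sub_eq_zero (b := c' - inv0 d), hs,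
                add_eq_zero_iff_eq_neg]
              constructor
              · intro h; rw [← inv0_inv0 (x - c'), h, inv0_neg]
              · intro h; rw [h, inv0_neg, inv0_inv0]
            by_cases h2 : x = c' - inv0 d
            · rw [if_pos (h1.2 h2), if_pos h2]
            · rw [if_neg (h1.not.2 h2), if_neg h2, key, inv0_smul_map, hs,
                inv0_inv0_add hd0 (sub_ne_zero.2 h)]
              · congr 1
                simp only [LinearIsometryEquiv.trans_apply, map_add, map_smul, smul_add, smul_smul,
                  add_assoc]
                congr 3
                field_simp
              · rwa [← hs, sub_ne_zero]
  | reflection_comp a n hn T _ ih =>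
    have key : ∀ y z : E3, a + (Submodule.span ℝ {n})ᗮ.reflection (y + z - a) =
        (a + (Submodule.span ℝ {n})ᗮ.reflection (y - a)) +
          (Submodule.span ℝ {n})ᗮ.reflection z := by
      intro y z
      rw [add_sub_right_comm, map_add, add_assoc]
    rcases ih with ⟨b, l, R, hl, rfl⟩ | ⟨b, c', l, R, hl, rfl⟩
    · refine Or.inl ⟨a + (Submodule.span ℝ {n})ᗮ.reflection (b - a), l,
        R.trans ((Submodule.span ℝ {n})ᗮ.reflection), hl, ?_⟩
      funext p
      induction p using OnePoint.rec with
      | infty => rfl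
      | coe x =>
        simp only [Function.comp_apply, simil, OnePoint.map_some, planeReflection_coe, key, map_smul]
        rfl
    · refine Or.inr ⟨a + (Submodule.span ℝ {n})ᗮ.reflection (b - a), c', l,
        R.trans ((Submodule.span ℝ {n})ᗮ.reflection), hl, ?_⟩
      funext p
      induction p using OnePoint.rec with
      | infty => rfl
      | coe x =>
        simp only [Function.comp_apply, invSimil, OnePoint.elim_some]
        split_ifs
        · rfl
        · rw [planeReflection_coe, key, map_smul]; rfl

/-! ### Generating similarities and their composites with an inversion -/

lemma IsMobius.comp {S T : OnePoint E3 → OnePoint E3} (hS : IsMobius S) (hT : IsMobius T) :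
    IsMobius (S ∘ T) := by
  induction hS with
  | id => exact hT
  | inversion_comp c r hr S _ ih => exact IsMobius.inversion_comp c r hr _ ih
  | reflection_comp a n hn S _ ih => exact IsMobius.reflection_comp a n hn _ ih

/-- By Cartan–Dieudonné, `R` is a product of reflections. A factor belonging to the zero vector is
the identity and is dropped. -/
lemma isMobius_linear (R : E3 ≃ₗᵢ[ℝ] E3) : IsMobius (OnePoint.map R) := by
  obtain ⟨L, -, rfl⟩ := R.reflections_generate_dim
  induction L with
  | nil =>
    have : OnePoint.map (⇑(1 : E3 ≃ₗᵢ[ℝ] E3)) = id := OnePoint.map_id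
    simpa [this] using IsMobius.id
  | cons v L ih =>
    by_cases hv : v = 0
    · subst hv
      have : (Submodule.span ℝ {(0 : E3)})ᗮ.reflection = 1 := by
        ext1 x
        rw [reflection_perp_apply]
        simp
      rw [List.map_cons, List.prod_cons, this, one_mul]
      exact ih
    · have := IsMobius.reflection_comp 0 v hv _ ih
      convert this using 1
      funext p
      induction p using OnePoint.rec with
      | infty => rfl
      | coe x => simp [planeReflection_coe]

lemma isMobius_translation (v : E3) : IsMobius (OnePoint.map fun x => v + x) := by
  by_cases hv : v = 0
  · subst hv
    convert IsMobius.id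
    simp only [zero_add]
    exact OnePoint.map_id
  -- Reflections in two parallel planes at distance `‖v‖ / 2` compose to the translation by `v`.
  · have := IsMobius.reflection_comp ((1 / 2 : ℝ) • v) v hv _
      (IsMobius.reflection_comp 0 v hv _ IsMobius.id)
    convert this using 1
    funext p
    induction p using OnePoint.rec with
    | infty => rfl
    | coe x =>
      have hn : ‖v‖ ^ 2 ≠ 0 := by positivity
      simp only [Function.comp_apply, id, OnePoint.map_some, planeReflection_coe]
      rw [zero_add, sub_zero, map_sub, Submodule.reflection_reflection, map_smul,
        reflection_perp_apply v v, real_inner_self_eq_norm_sq, div_self hn]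
      congr 1
      module

lemma isMobius_scaling {l : ℝ} (hl : 0 < l) : IsMobius (OnePoint.map fun x : E3 => l • x) := by
  -- Concentric inversions of radii `1` and `√l` compose to the dilation by `l`.
  have := IsMobius.inversion_comp 0 (√l) (Real.sqrt_pos.2 hl) _
      (IsMobius.inversion_comp 0 1 one_pos _ IsMobius.id)
  convert this using 1
  funext p
  induction p using OnePoint.rec with
  | infty => simp [sphereInversion_infty, sphereInversion_coe]
  | coe x =>
    simp only [Function.comp_apply, id, OnePoint.map_some, sphereInversion_coe]
    split_ifs with h
    · simp [h, sphereInversion_infty]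
    · rw [sphereInversion_coe, if_neg (by simpa [inv0_eq_zero] using h)]
      simp [inv0_inv0, Real.sq_sqrt hl.le]

lemma isMobius_simil (b : E3) {l : ℝ} (hl : 0 < l) (R : E3 ≃ₗᵢ[ℝ] E3) :
    IsMobius (simil b l R) := by
  convert ((isMobius_translation b).comp (isMobius_scaling hl)).comp (isMobius_linear R) using 1
  funext p
  induction p using OnePoint.rec with
  | infty => rfl
  | coe x => rfl

lemma isMobius_invSimil (b c : E3) {l : ℝ} (hl : 0 < l) (R : E3 ≃ₗᵢ[ℝ] E3) :
    IsMobius (invSimil b c l R) := by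
  convert (isMobius_simil b hl R).comp ((IsMobius.inversion_comp 0 1 one_pos _ IsMobius.id).comp
    (isMobius_translation (-c))) using 1
  funext p
  induction p using OnePoint.rec with
  | infty => simp [invSimil, simil, sphereInversion_infty]
  | coe x =>
    simp only [Function.comp_apply, id, OnePoint.map_some, sphereInversion_coe, invSimil,
      OnePoint.elim_some, neg_add_eq_zero, eq_comm (a := c)]
    split_ifs with h
    · rfl
    · simp [simil, neg_add_eq_sub]

/-- Each generator is an involution, so it supplies its own preimages. -/
lemma IsMobius.surjective {M : OnePoint E3 → OnePoint E3} (hM : IsMobius M) :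
    Function.Surjective M := by
  induction hM with
  | id => exact Function.surjective_id
  | inversion_comp c r hr T _ ih =>
    refine Function.Surjective.comp (fun p => ⟨sphereInversion c r p, ?_⟩) ih
    induction p using OnePoint.rec with
    | infty => simp [sphereInversion_infty, sphereInversion_coe]
    | coe x =>
      rw [sphereInversion_coe]
      split_ifs with h
      · rw [sphereInversion_infty, h]
      · have hr2 : r ^ 2 ≠ 0 := by positivity
        have h1 := inv0_smul_map (LinearIsometryEquiv.refl ℝ E3) (r ^ 2) (inv0 (x - c))
        simp only [LinearIsometryEquiv.coe_refl, id_eq] at h1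
        rw [sphereInversion_coe, if_neg, add_sub_cancel_left, h1, inv0_inv0, smul_smul,
          mul_inv_cancel₀ hr2, one_smul, add_sub_cancel]
        simpa [hr.ne', inv0_eq_zero, sub_eq_zero] using h
  | reflection_comp a n hn T _ ih =>
    refine Function.Surjective.comp (fun p => ⟨planeReflection a n p, ?_⟩) ih
    induction p using OnePoint.rec with
    | infty => rfl
    | coe x => simp [planeReflection_coe]


/-! ### Circles tangent to a normal direction -/

/-- The circle or line through `w`, orthogonal there to the plane of real parts of complex multiples
of the null vector `X`, with the curvature parameter `Λ`; it contains infinity if `Λ = 0`. -/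
def contactCircle (w : E3) (X : C3) (Λ : ℂ) : Set (OnePoint E3) :=
  {p | p.elim (Λ = 0) fun x => pair (x - w) X = Λ * (‖x - w‖ ^ 2 : ℝ)}

lemma infty_mem_contactCircle {w : E3} {X : C3} {Λ : ℂ} :
    OnePoint.infty ∈ contactCircle w X Λ ↔ Λ = 0 := Iff.rfl

lemma coe_mem_contactCircle {w : E3} {X : C3} {Λ : ℂ} {x : E3} :
    (x : OnePoint E3) ∈ contactCircle w X Λ ↔ pair (x - w) X = Λ * (‖x - w‖ ^ 2 : ℝ) := Iff.rfl

/-- The null vector of the horizontal plane. -/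
def baseNull : C3 := !₂[1, -Complex.I, 0]

lemma reV_smul_baseNull (δ : ℂ) : reV (δ • baseNull) = toSpace δ := by
  ext i; fin_cases i <;> simp [reV_apply, baseNull, toSpace]

lemma pair_baseNull (y : E3) : pair y baseNull = starRingEnd ℂ (hor y) := by
  apply Complex.ext <;> simp [pair, baseNull, hor]

lemma hor_neg (x : E3) : hor (-x) = -hor x := by
  apply Complex.ext <;> simp [hor]

/-- Both sides of the defining equation scale by `l ^ 2`, since `X` is enlarged along with the
difference vector. The parameter is therefore unchanged. -/
lemma simil_mem_contactCircle {b w : E3} {l : ℝ} (hl : 0 < l) {R : E3 ≃ₗᵢ[ℝ] E3} {X : C3}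
    {ζ Λ : ℂ} (hX : ∀ δ : ℂ, reV (δ • X) = l • R (toSpace δ)) (hw : w = b + l • R (toSpace ζ))
    (p : OnePoint E3) :
    simil b l R p ∈ contactCircle w X Λ ↔ p ∈ contactCircle (toSpace ζ) baseNull Λ := by
  induction p using OnePoint.rec with
  | infty => rfl
  | coe x =>
    have h : b + l • R x - w = R (l • (x - toSpace ζ)) := by
      rw [hw, map_smul, map_sub, smul_sub]; abel
    simp only [simil, OnePoint.map_some, coe_mem_contactCircle]
    rw [h, pair_frame hX, R.norm_map, pair_baseNull, norm_smul, hor_smul, Real.norm_of_nonneg hl.le]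
    have hl' : (l : ℂ) ≠ 0 := by exact_mod_cast hl.ne'
    push_cast
    rw [map_mul, Complex.conj_ofReal]
    constructor
    · intro h
      apply mul_left_cancel₀ (mul_ne_zero hl' hl')
      linear_combination h
    · intro h
      linear_combination ((l : ℂ) * l) * h

lemma norm_sq_cast (y : E3) : ((‖y‖ ^ 2 : ℝ) : ℂ) = hor y * starRingEnd ℂ (hor y) + (y 2 : ℂ) ^ 2 := by
  rw [norm_sq_hor, Complex.mul_conj, Complex.normSq_eq_norm_sq]; push_cast; rfl

lemma norm_sq_inv0_sub (v d : E3) (hv : v ≠ 0) (hd : d ≠ 0) :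
    ‖inv0 v - inv0 d‖ ^ 2 = ‖v - d‖ ^ 2 / (‖v‖ ^ 2 * ‖d‖ ^ 2) := by
  have h1 : ‖v‖ ^ 2 ≠ 0 := by positivity
  have h2 : ‖d‖ ^ 2 ≠ 0 := by positivity
  rw [norm_sub_sq_real, norm_sub_sq_real, norm_inv0, norm_inv0, inv0, inv0, inner_smul_left,
    inner_smul_right]
  simp only [conj_trivial]
  field_simp
  ring

/-- The frame is the differential at `d` of the planar inversion `z ↦ 1 / conj z`. It reverses
orientation, hence `hor y` appears without the conjugation found in `pair_frame`. -/
lemma pair_inv_frame {X : C3} {R : E3 ≃ₗᵢ[ℝ] E3} {l : ℝ} {d : ℂ}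
    (hX : ∀ δ : ℂ, reV (δ • X) = l • R (toSpace (-starRingEnd ℂ (δ / d ^ 2)))) (y : E3) :
    pair (R y) X = -(l * hor y / d ^ 2) := by
  apply eq_of_forall_re_mul
  intro δ
  rw [mul_comm, ← pair_smul, ← inner_reV, hX, inner_smul_right, R.inner_map_map, inner_toSpace,
    mul_neg, ← map_mul, Complex.neg_re, Complex.conj_re]
  have : -(l * hor y / d ^ 2) * δ = (l : ℂ) * (-(hor y * (δ / d ^ 2))) := by ring
  rw [this, Complex.re_ofReal_mul, Complex.neg_re]

/-- With `y = x - ζ`, expanding `‖y + d‖ ^ 2` around `‖y‖ ^ 2` turns the equation with `Λ` into the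
one with `Λ + 1 / d`: an inversion with pole `ζ - d` shifts the parameter by `1 / d`. The point `∞`
and the pole need separate checks. -/
lemma invSimil_mem_contactCircle {b w : E3} {l : ℝ} (hl : 0 < l) {R : E3 ≃ₗᵢ[ℝ] E3} {X : C3}
    {ζ d Λ : ℂ} (hd : d ≠ 0)
    (hX : ∀ δ : ℂ, reV (δ • X) = l • R (toSpace (-starRingEnd ℂ (δ / d ^ 2))))
    (hw : w = b + l • R (inv0 (toSpace d))) (p : OnePoint E3) :
    invSimil b (toSpace (ζ - d)) l R p ∈ contactCircle w X (Λ + 1 / d) ↔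
      p ∈ contactCircle (toSpace ζ) baseNull Λ := by
  have hl' : (l : ℂ) ≠ 0 := by exact_mod_cast hl.ne'
  have hdt : toSpace d ≠ 0 := by rw [← norm_ne_zero_iff, norm_toSpace]; simpa using hd
  have hdd : starRingEnd ℂ d ≠ 0 := by simpa using hd
  have hdn : ((‖toSpace d‖ ^ 2 : ℝ) : ℂ) = d * starRingEnd ℂ d := by
    rw [norm_sq_cast, hor_toSpace]; simp [toSpace]
  induction p using OnePoint.rec with
  | infty =>
    simp only [invSimil, OnePoint.elim_infty, coe_mem_contactCircle, infty_mem_contactCircle]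
    have h : b - w = R (l • (-inv0 (toSpace d))) := by
      rw [hw, map_smul, map_neg, smul_neg]; abel
    rw [h, pair_inv_frame hX, R.norm_map, hor_smul, norm_smul, norm_neg, norm_inv0, mul_pow,
      inv_pow, hor_neg, inv0, hor_smul, hor_toSpace]
    push_cast at hdn ⊢
    rw [hdn, Real.norm_of_nonneg hl.le]
    constructor
    · intro h
      field_simp at h
      apply mul_left_cancel₀ hd
      linear_combination -h
    · intro h
      rw [h]
      field_simp
      ring
  | coe x =>
    simp only [invSimil, OnePoint.elim_some]
    by_cases hx : x = toSpace (ζ - d)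
    · rw [if_pos hx, infty_mem_contactCircle, coe_mem_contactCircle, hx, toSpace_sub, sub_sub_cancel_left,
        norm_neg, hdn, pair_baseNull, ← neg_one_smul ℝ, hor_smul, hor_toSpace]
      push_cast
      rw [map_mul, map_neg, map_one]
      constructor
      · intro h
        have : Λ * d = -1 := by field_simp at h; linear_combination h
        linear_combination (-starRingEnd ℂ d) * this
      · intro h
        have : Λ * d = -1 := by
          apply mul_right_cancel₀ hdd
          linear_combination -h
        field_simp
        linear_combination this
    · rw [if_neg hx, coe_mem_contactCircle, coe_mem_contactCircle]
      set y := x - toSpace ζ with hy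
      have hv : x - toSpace (ζ - d) = y + toSpace d := by rw [hy, toSpace_sub]; abel
      have hv0 : y + toSpace d ≠ 0 := by rwa [← hv, sub_ne_zero]
      have h : b + l • R (inv0 (x - toSpace (ζ - d))) - w =
          R (l • (inv0 (y + toSpace d) - inv0 (toSpace d))) := by
        rw [hw, hv, map_smul, map_sub, smul_sub]; abel
      have hN : ((‖y + toSpace d‖ ^ 2 : ℝ) : ℂ) ≠ 0 := by
        have : ‖y + toSpace d‖ ^ 2 ≠ 0 := by positivity
        exact_mod_cast this
      have hN2 : ((‖y + toSpace d‖ ^ 2 : ℝ) : ℂ) = ((‖y‖ ^ 2 : ℝ) : ℂ) + hor y * starRingEnd ℂ d +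
          starRingEnd ℂ (hor y) * d + d * starRingEnd ℂ d := by
        rw [norm_sq_cast, norm_sq_cast, hor_add, hor_toSpace, map_add]
        simp [toSpace]
        ring
      rw [h, pair_inv_frame hX, R.norm_map, hor_smul, norm_smul, mul_pow,
        norm_sq_inv0_sub _ _ hv0 hdt, add_sub_cancel_right, hor_sub, pair_baseNull, inv0, inv0,
        hor_smul, hor_smul, hor_add, hor_toSpace, Real.norm_of_nonneg hl.le]
      rw [Complex.ofReal_mul, Complex.ofReal_div, Complex.ofReal_mul, hdn, Complex.ofReal_inv,
        Complex.ofReal_inv, hdn]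
      generalize ((‖y + toSpace d‖ ^ 2 : ℝ) : ℂ) = N at *
      generalize ((‖y‖ ^ 2 : ℝ) : ℂ) = n at *
      generalize hor y = η at *
      generalize starRingEnd ℂ η = η' at *
      generalize starRingEnd ℂ d = d' at *
      constructor
      · intro h
        push_cast at h
        field_simp at h
        rw [hN2] at h
        apply mul_left_cancel₀ hd
        linear_combination h
      · intro h
        push_cast
        field_simp
        rw [hN2]
        linear_combination d * h

/-! ### Contact circles are circles or lines -/

lemma exists_cos_sin {x y : ℝ} (h : x ^ 2 + y ^ 2 = 1) : ∃ θ : ℝ, Real.cos θ = x ∧ Real.sin θ = y := by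
  have h1 : ‖(⟨x, y⟩ : ℂ)‖ = 1 := by
    rw [← sq_eq_sq₀ (norm_nonneg _) (by norm_num), ← Complex.normSq_eq_norm_sq, Complex.normSq_apply]
    simp; linarith
  refine ⟨Complex.arg ⟨x, y⟩, ?_, ?_⟩
  · have := Complex.norm_mul_cos_arg (⟨x, y⟩ : ℂ)
    rwa [h1, one_mul] at this
  · have := Complex.norm_mul_sin_arg (⟨x, y⟩ : ℂ)
    rwa [h1, one_mul] at this

lemma circleSet_neg (c u v : E3) (r : ℝ) : circleSet c (-u) v r = circleSet c u v r := by
  have key : ∀ u : E3, circleSet c (-u) v r ⊆ circleSet c u v r := by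
    rintro u _ ⟨θ, rfl⟩
    refine ⟨Real.pi - θ, ?_⟩
    simp [Real.cos_pi_sub, Real.sin_pi_sub]
  refine Subset.antisymm (key u) ?_
  have := key (-u)
  rwa [neg_neg] at this

/-- Polar description of the solutions of the equation of a model circle. -/
lemma conj_hor_eq_iff {κ : ℂ} (hκ : κ ≠ 0) (y : E3) :
    starRingEnd ℂ (hor y) = κ * (‖y‖ ^ 2 : ℝ) ↔ ∃ θ : ℝ, y =
      toSpace (1 / κ / 2) + (1 / (2 * ‖κ‖)) • (Real.cos θ • (-toSpace (‖κ‖ / κ)) +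
        Real.sin θ • vert) := by
  have hk : 0 < ‖κ‖ := norm_pos_iff.2 hκ
  have hkc : (‖κ‖ : ℂ) ≠ 0 := by exact_mod_cast hk.ne'
  have hc : starRingEnd ℂ κ ≠ 0 := by simpa using hκ
  have hkk : κ * starRingEnd ℂ κ = (‖κ‖ : ℂ) ^ 2 := Complex.mul_conj' κ
  constructor
  · intro h
    set t := ‖κ‖ * ‖y‖ ^ 2 with ht
    -- The equation fixes the direction of the horizontal part. What remains is the planar circle
    -- `‖κ‖ (t² + y₂²) = t` of radius `1 / (2 ‖κ‖)`.
    have hh : hor y = t * (‖κ‖ / κ) := by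
      rw [← Complex.conj_conj (hor y), h, map_mul, Complex.conj_ofReal, ht]
      push_cast
      field_simp
      linear_combination ((‖y‖ : ℂ) ^ 2) * hkk
    have hn : ‖hor y‖ = t := by
      rw [hh, norm_mul, norm_div, Complex.norm_real, Complex.norm_real, norm_norm, div_self hk.ne',
        mul_one, Real.norm_of_nonneg (by positivity)]
    have hsq := norm_sq_hor y
    rw [hn] at hsq
    have h1 : (1 - 2 * ‖κ‖ * t) ^ 2 + (2 * ‖κ‖ * y 2) ^ 2 = 1 := by
      have : ‖κ‖ * (t ^ 2 + y 2 ^ 2) = t := by rw [← hsq]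
      linear_combination 4 * ‖κ‖ * this
    obtain ⟨θ, h2, h3⟩ := exists_cos_sin h1
    refine ⟨θ, ?_⟩
    rw [h2, h3]
    conv_lhs => rw [toSpace_hor_add y, hh]
    rw [smul_add, smul_smul (1 / (2 * ‖κ‖)), smul_smul (1 / (2 * ‖κ‖)), ← add_assoc]
    congr 1
    · rw [smul_neg, ← toSpace_smul, ← sub_eq_add_neg, ← toSpace_sub]
      congr 1
      push_cast
      field_simp
      ring
    · congr 1
      field_simp
  · rintro ⟨θ, rfl⟩
    rw [norm_sq_cast]
    have hh : hor (toSpace (1 / κ / 2) + (1 / (2 * ‖κ‖)) • (Real.cos θ • (-toSpace (‖κ‖ / κ)) +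
        Real.sin θ • vert)) = (1 - Real.cos θ) / (2 * κ) := by
      rw [hor_add, hor_smul, hor_add, hor_smul, hor_smul, ← neg_one_smul ℝ, hor_smul, hor_toSpace,
        hor_toSpace]
      have : hor vert = 0 := by apply Complex.ext <;> simp [hor, vert]
      rw [this]
      push_cast
      field_simp
      ring
    have h2 : (toSpace (1 / κ / 2) + (1 / (2 * ‖κ‖)) • (Real.cos θ • (-toSpace (‖κ‖ / κ)) +
        Real.sin θ • vert)) 2 = Real.sin θ / (2 * ‖κ‖) := by
      simp [toSpace, vert]; field_simp
    rw [hh, h2]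
    push_cast
    have hs : (Complex.sin θ) ^ 2 + Complex.cos θ ^ 2 = 1 := Complex.sin_sq_add_cos_sq θ
    rw [map_div₀, map_sub, map_mul, ← Complex.ofReal_cos, Complex.conj_ofReal, map_one,
      Complex.conj_ofNat, Complex.ofReal_cos, div_pow, mul_pow, ← hkk]
    field_simp
    linear_combination -hs

lemma contactCircle_eq_circleSet {w : E3} {X : C3} {Λ : ℂ} {R : E3 ≃ₗᵢ[ℝ] E3} {l : ℝ} (hl : 0 < l)
    (hR : ∀ δ : ℂ, reV (δ • X) = l • R (toSpace δ)) (hΛ : Λ ≠ 0) :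
    contactCircle w X Λ = circleSet (w + R (toSpace (l / Λ / 2))) (-R (toSpace (‖Λ‖ / Λ))) (R vert)
      (l / (2 * ‖Λ‖)) := by
  have hl' : (l : ℂ) ≠ 0 := by exact_mod_cast hl.ne'
  have hk : Λ / l ≠ 0 := div_ne_zero hΛ hl'
  have hn : 0 < ‖Λ‖ := norm_pos_iff.2 hΛ
  have hnk : ‖Λ / l‖ = ‖Λ‖ / l := by
    rw [norm_div, Complex.norm_real, Real.norm_of_nonneg hl.le]
  ext p
  induction p using OnePoint.rec with
  | infty => simp [infty_mem_contactCircle, hΛ, circleSet]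
  | coe x =>
    obtain ⟨y, rfl⟩ : ∃ y, x = w + R y := ⟨R.symm (x - w), by simp⟩
    have h1 : pair (R y) X = Λ * (‖R y‖ ^ 2 : ℝ) ↔
        starRingEnd ℂ (hor y) = (Λ / l) * (‖y‖ ^ 2 : ℝ) := by
      rw [pair_frame hR, R.norm_map]
      constructor
      · intro h; field_simp; linear_combination h
      · intro h; rw [h]; field_simp
    rw [coe_mem_contactCircle, add_sub_cancel_left, h1, conj_hor_eq_iff hk]
    simp only [circleSet, mem_range, OnePoint.coe_eq_coe]
    refine exists_congr fun θ => ?_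
    rw [add_assoc, add_right_inj, ← map_neg R, ← map_smul, ← map_smul, ← map_add, ← map_smul,
      ← map_add, R.injective.eq_iff, hnk, eq_comm]
    have e1 : 1 / (Λ / l) / 2 = (l : ℂ) / Λ / 2 := by field_simp
    have e2 : ((‖Λ‖ / l : ℝ) : ℂ) / (Λ / l) = ‖Λ‖ / Λ := by push_cast; field_simp
    have e3 : 1 / (2 * (‖Λ‖ / l)) = l / (2 * ‖Λ‖) := by field_simp
    rw [e1, e2, e3]

lemma contactCircle_zero {w : E3} {X : C3} {R : E3 ≃ₗᵢ[ℝ] E3} {l : ℝ} (hl : 0 < l)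
    (hR : ∀ δ : ℂ, reV (δ • X) = l • R (toSpace δ)) :
    contactCircle w X 0 = lineSet w (R vert) := by
  have hl' : (l : ℂ) ≠ 0 := by exact_mod_cast hl.ne'
  ext p
  induction p using OnePoint.rec with
  | infty => simp [infty_mem_contactCircle, lineSet]
  | coe x =>
    obtain ⟨y, rfl⟩ : ∃ y, x = w + R y := ⟨R.symm (x - w), by simp⟩
    simp only [coe_mem_contactCircle, add_sub_cancel_left, pair_frame hR, zero_mul, mul_eq_zero, hl',
      false_or, map_eq_zero, lineSet, mem_insert_iff, OnePoint.coe_ne_infty, mem_range,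
      OnePoint.coe_eq_coe, add_right_inj]
    constructor
    · intro h
      refine ⟨y 2, ?_⟩
      rw [← map_smul, R.injective.eq_iff]
      conv_rhs => rw [toSpace_hor_add y, h]
      rw [show toSpace 0 = 0 from toSpaceL.map_zero, zero_add]
    · rintro ⟨t, h⟩
      rw [← map_smul, R.injective.eq_iff] at h
      rw [← h]
      apply Complex.ext <;> simp [hor, vert]

/-- A contact circle of the horizontal plane with parameter `Λ ≠ 0` meets the plane again at `ζ + 1
/ Λ`. For the model circle that point is `1 / conj ζ`, and `1 / conj ζ - ζ = (1 - ‖ζ‖ ^ 2) / conj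
ζ`. -/
lemma modelCircle_eq {ζ : ℂ} (hζ : ζ ∈ disk) :
    modelCircle ζ = contactCircle (toSpace ζ) baseNull (starRingEnd ℂ ζ / (1 - ‖ζ‖ ^ 2)) := by
  have hR : ∀ δ : ℂ, reV (δ • baseNull) = (1 : ℝ) • (LinearIsometryEquiv.refl ℝ E3) (toSpace δ) := by
    intro δ; simp [reV_smul_baseNull]
  have h1 : ‖ζ‖ < 1 := by simpa using hζ
  have h2 : 0 < 1 - ‖ζ‖ ^ 2 := by nlinarith [norm_nonneg ζ]
  have h2c : (1 - (‖ζ‖ : ℂ) ^ 2) ≠ 0 := by exact_mod_cast h2.ne'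
  rw [modelCircle]
  split_ifs with h
  · subst h
    simp only [map_zero, zero_div]
    rw [contactCircle_zero one_pos hR]
    simp [show toSpace 0 = 0 from toSpaceL.map_zero]
  · have hn : 0 < ‖ζ‖ := norm_pos_iff.2 h
    have hnc : (‖ζ‖ : ℂ) ≠ 0 := by exact_mod_cast hn.ne'
    have hc : starRingEnd ℂ ζ ≠ 0 := by simpa using h
    have hzz : ζ * starRingEnd ℂ ζ = (‖ζ‖ : ℂ) ^ 2 := Complex.mul_conj' ζ
    have hnorm : ‖starRingEnd ℂ ζ / (1 - ‖ζ‖ ^ 2)‖ = ‖ζ‖ / (1 - ‖ζ‖ ^ 2) := by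
      rw [norm_div, RCLike.norm_conj]
      congr 1
      rw [show (1 - (‖ζ‖ : ℂ) ^ 2) = ((1 - ‖ζ‖ ^ 2 : ℝ) : ℂ) by push_cast; rfl, Complex.norm_real,
        Real.norm_of_nonneg h2.le]
    rw [contactCircle_eq_circleSet one_pos hR (div_ne_zero hc h2c), hnorm, circleSet_neg]
    simp only [LinearIsometryEquiv.coe_refl, id, ← toSpace_add]
    congr 1
    · congr 1
      rw [reflected]
      field_simp
      push_cast
      linear_combination -hzz
    · congr 1
      push_cast
      field_simp
      linear_combination hzz
    · have : reflected ζ - ζ = (1 - ‖ζ‖ ^ 2 : ℝ) / starRingEnd ℂ ζ := by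
        rw [reflected]
        push_cast
        field_simp
        linear_combination -hzz
      rw [this, norm_div, RCLike.norm_conj, Complex.norm_real, Real.norm_of_nonneg h2.le]
      field_simp

/-- Contact circles are orthogonal to the plane of their null vector. -/
lemma isOrthogonalCircleAt_contactCircle {w : E3} {X : C3} (Λ : ℂ) (h : bil X X = 0) (h0 : X ≠ 0)
    {V : Submodule ℝ E3} (hV : ∀ v, v ∈ V ↔ ∃ δ : ℂ, v = reV (δ • X)) :
    IsOrthogonalCircleAt (contactCircle w X Λ) w V := by
  obtain ⟨R, hR⟩ := exists_frame h h0
  have hl : 0 < ‖reV X‖ := norm_pos_iff.2 (reV_ne_zero h h0)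
  set l := ‖reV X‖
  have hperp : ∀ z : ℂ, inner ℝ (R (toSpace z)) (R vert) = 0 := by
    intro z; rw [R.inner_map_map, inner_E3]; simp [toSpace, vert]
  have hvert : R vert ∈ Vᗮ := by
    rw [Submodule.mem_orthogonal]
    intro u hu
    obtain ⟨δ, rfl⟩ := (hV u).1 hu
    rw [hR, inner_smul_left, hperp, mul_zero]
  by_cases hΛ : Λ = 0
  · subst hΛ
    refine Or.inr ⟨R vert, ?_, hvert, contactCircle_zero hl hR⟩
    rw [← norm_ne_zero_iff, R.norm_map, norm_vert]; norm_num
  · have hn : 0 < ‖Λ‖ := norm_pos_iff.2 hΛ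
    refine Or.inl ⟨_, _, _, _, by positivity, ?_, ?_, ?_, ?_, hvert,
      contactCircle_eq_circleSet hl hR hΛ⟩
    · rw [norm_neg, R.norm_map, norm_toSpace, norm_div, Complex.norm_real, norm_norm,
        div_self hn.ne']
    · rw [R.norm_map, norm_vert]
    · rw [inner_neg_left, hperp, neg_zero]
    · rw [smul_neg, ← map_smul, ← toSpace_smul, add_assoc, ← sub_eq_add_neg, ← map_sub,
        ← toSpace_sub]
      have : (l / Λ / 2 - ((l / (2 * ‖Λ‖) : ℝ) : ℂ) * (‖Λ‖ / Λ)) = 0 := by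
        have : (‖Λ‖ : ℂ) ≠ 0 := by exact_mod_cast hn.ne'
        push_cast
        field_simp
        ring
      rw [this, show toSpace 0 = 0 from toSpaceL.map_zero, map_zero, add_zero]


/-! ### Schwarzian quantities of complex curves -/

/-- For a curve with velocity `Y` and acceleration `Y₁`, the tangential part of `Y₁` is this
multiple of `Y`. -/
def tangCoeff (Y Y₁ : C3) : ℂ := inner ℂ Y Y₁ / (‖Y‖ ^ 2 : ℝ)

/-- The Schwarzian derivative in terms of the first three derivatives. -/
def schw (Y Y₁ Y₂ : C3) : ℂ := inner ℂ Y Y₂ / (‖Y‖ ^ 2 : ℝ) - 3 / 2 * tangCoeff Y Y₁ ^ 2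

/-- The curvature density in terms of the first two derivatives. -/
def curvDensity (Y Y₁ : C3) : ℝ := 2 * (‖Y₁‖ ^ 2 / ‖Y‖ ^ 2 - ‖tangCoeff Y Y₁‖ ^ 2)

lemma inner_self_C3 (X : C3) : inner ℂ X X = ((‖X‖ ^ 2 : ℝ) : ℂ) := by
  rw [inner_self_eq_norm_sq_to_K]; push_cast; rfl

lemma tangCoeff_trans {X X₁ : C3} {c c₁ : ℂ} (hX : X ≠ 0) (hc : c ≠ 0) :
    tangCoeff (c • X) (c ^ 2 • X₁ + c₁ • X) = c * tangCoeff X X₁ + c₁ / c := by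
  have hN : ((‖X‖ ^ 2 : ℝ) : ℂ) ≠ 0 := by
    have : ‖X‖ ^ 2 ≠ 0 := by positivity
    exact_mod_cast this
  have hcc : starRingEnd ℂ c ≠ 0 := by simpa using hc
  have hn : ((‖c‖ ^ 2 : ℝ) : ℂ) = c * starRingEnd ℂ c := by
    rw [Complex.mul_conj']; push_cast; rfl
  rw [tangCoeff, tangCoeff, inner_smul_left, inner_add_right, inner_smul_right, inner_smul_right,
    inner_self_C3, norm_smul, mul_pow, Complex.ofReal_mul, hn]
  field_simp

/-- The composition rule for Schwarzians in terms of jets: `c`, `c₁`, `c₂` play the derivatives of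
the reparametrization, whose own Schwarzian is the added term. -/
lemma schw_trans {X X₁ X₂ : C3} {c c₁ c₂ : ℂ} (hX : X ≠ 0) (hc : c ≠ 0) :
    schw (c • X) (c ^ 2 • X₁ + c₁ • X) (c ^ 3 • X₂ + (3 * c * c₁) • X₁ + c₂ • X) =
      c ^ 2 * schw X X₁ X₂ + (c₂ / c - 3 / 2 * (c₁ / c) ^ 2) := by
  have hN : ((‖X‖ ^ 2 : ℝ) : ℂ) ≠ 0 := by
    have : ‖X‖ ^ 2 ≠ 0 := by positivity
    exact_mod_cast this
  have hcc : starRingEnd ℂ c ≠ 0 := by simpa using hc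
  have hn : ((‖c‖ ^ 2 : ℝ) : ℂ) = c * starRingEnd ℂ c := by
    rw [Complex.mul_conj']; push_cast; rfl
  rw [schw, schw, tangCoeff_trans hX hc, tangCoeff, inner_smul_left, inner_add_right,
    inner_add_right, inner_smul_right, inner_smul_right, inner_smul_right,
    inner_self_C3, norm_smul, mul_pow, Complex.ofReal_mul, hn]
  field_simp
  ring

lemma normSq_sub_tang {Y Y₁ : C3} (hY : Y ≠ 0) :
    ‖Y₁ - tangCoeff Y Y₁ • Y‖ ^ 2 = ‖Y₁‖ ^ 2 - ‖Y‖ ^ 2 * ‖tangCoeff Y Y₁‖ ^ 2 := by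
  have hN : ((‖Y‖ ^ 2 : ℝ) : ℂ) ≠ 0 := by
    have : ‖Y‖ ^ 2 ≠ 0 := by positivity
    exact_mod_cast this
  have h1 : inner ℂ Y Y₁ = tangCoeff Y Y₁ * (‖Y‖ ^ 2 : ℝ) := by rw [tangCoeff]; field_simp
  have h2 : inner ℂ Y₁ (tangCoeff Y Y₁ • Y) = ((‖Y‖ ^ 2 * ‖tangCoeff Y Y₁‖ ^ 2 : ℝ) : ℂ) := by
    rw [inner_smul_right, ← inner_conj_symm, h1, map_mul, Complex.conj_ofReal, ← mul_assoc,
      Complex.mul_conj', Complex.ofReal_mul, Complex.ofReal_pow, Complex.ofReal_pow]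
    ring
  rw [norm_sub_sq (𝕜 := ℂ), h2, norm_smul, mul_pow, RCLike.re_eq_complex_re, Complex.ofReal_re]
  ring

/-- Only the part of the acceleration orthogonal to the velocity counts, and there the multiple `c₁
• X` disappears. -/
lemma curvDensity_trans {X X₁ : C3} {c c₁ : ℂ} (hX : X ≠ 0) (hc : c ≠ 0) :
    curvDensity (c • X) (c ^ 2 • X₁ + c₁ • X) = ‖c‖ ^ 2 * curvDensity X X₁ := by
  have hY : c • X ≠ 0 := smul_ne_zero hc hX
  have h1 : ∀ Y Y₁ : C3, Y ≠ 0 → curvDensity Y Y₁ =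
      2 * (‖Y₁ - tangCoeff Y Y₁ • Y‖ ^ 2 / ‖Y‖ ^ 2) := by
    intro Y Y₁ hY
    have : ‖Y‖ ^ 2 ≠ 0 := by positivity
    rw [normSq_sub_tang hY, curvDensity]
    field_simp
  have h2 : c ^ 2 • X₁ + c₁ • X - tangCoeff (c • X) (c ^ 2 • X₁ + c₁ • X) • c • X =
      c ^ 2 • (X₁ - tangCoeff X X₁ • X) := by
    rw [tangCoeff_trans hX hc, smul_smul, smul_sub, smul_smul]
    have : (c * tangCoeff X X₁ + c₁ / c) * c = c ^ 2 * tangCoeff X X₁ + c₁ := by field_simp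
    rw [this, add_smul]
    abel
  have h3 : ‖X‖ ^ 2 ≠ 0 := by positivity
  have h4 : ‖c‖ ^ 2 ≠ 0 := by positivity
  rw [h1 _ _ hY, h1 _ _ hX, h2, norm_smul, norm_smul, norm_pow, mul_pow, mul_pow]
  field_simp

/-- Ahlfors' Schwarzian of the real part of a null curve is controlled by the Schwarzian and the
curvature of the associated surface. -/
lemma ahlfors_nonpos {Y Y₁ Y₂ : C3} (hY : Y ≠ 0) (h0 : bil Y Y = 0) (h1 : bil Y Y₁ = 0)
    (h2 : bil Y₁ Y₁ + bil Y Y₂ = 0) (h : (schw Y Y₁ Y₂).re + curvDensity Y Y₁ ≤ 0) :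
    inner ℝ (reV Y) (reV Y₂) + 3 / 2 * ‖reV Y₁‖ ^ 2 -
      3 * (inner ℝ (reV Y) (reV Y₁)) ^ 2 / ‖reV Y‖ ^ 2 ≤ 0 := by
  have hNpos : 0 < ‖Y‖ ^ 2 := by positivity
  have hN : ((‖Y‖ ^ 2 : ℝ) : ℂ) ≠ 0 := by exact_mod_cast hNpos.ne'
  set a := tangCoeff Y Y₁ with ha
  have e1 : inner ℂ Y Y₁ = a * (‖Y‖ ^ 2 : ℝ) := by rw [ha, tangCoeff]; field_simp
  have e2 : inner ℂ Y Y₂ = (schw Y Y₁ Y₂ + 3 / 2 * a ^ 2) * (‖Y‖ ^ 2 : ℝ) := by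
    rw [schw, ← ha]; field_simp; ring
  have e3 : ‖Y₁‖ ^ 2 = ‖Y‖ ^ 2 * (curvDensity Y Y₁ / 2 + ‖a‖ ^ 2) := by
    rw [curvDensity, ← ha]; field_simp; ring
  have hb : (bil Y₁ Y₁).re ≤ ‖Y‖ ^ 2 * (curvDensity Y Y₁ / 2) := by
    -- Nullity allows `Y₁` to be replaced by its Hermitian normal part, whose squared length is the
    -- curvature term.
    have hΨ : bil (Y₁ + (-a) • Y) (Y₁ + (-a) • Y) = bil Y₁ Y₁ := by
      rw [bil_add_left, bil_add_right, bil_add_right, bil_smul_smul, bil_smul_left, bil_smul_right,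
        bil_comm Y₁ Y, h0, h1]
      ring
    calc (bil Y₁ Y₁).re ≤ ‖bil Y₁ Y₁‖ := Complex.re_le_norm _
      _ ≤ ‖Y₁ + (-a) • Y‖ ^ 2 := by rw [← hΨ]; exact norm_bil_self_le _
      _ = _ := by
        rw [neg_smul, ← sub_eq_add_neg, ha, normSq_sub_tang hY, ← ha, e3]; ring
  have f1 : inner ℝ (reV Y) (reV Y₂) =
      ((schw Y Y₁ Y₂).re + 3 / 2 * (a.re ^ 2 - a.im ^ 2)) * ‖Y‖ ^ 2 / 2 - (bil Y₁ Y₁).re / 2 := by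
    rw [inner_reV_reV, e2, eq_neg_of_add_eq_zero_right h2, Complex.add_re, Complex.re_mul_ofReal]
    have : (3 / 2 * a ^ 2).re = 3 / 2 * (a.re ^ 2 - a.im ^ 2) := by
      rw [show (3 / 2 * a ^ 2) = ((3 / 2 : ℝ) : ℂ) * a ^ 2 by push_cast; ring, Complex.re_ofReal_mul,
        pow_two, Complex.mul_re]
      ring
    rw [Complex.add_re, this, Complex.neg_re]
    ring
  have f2 : ‖reV Y₁‖ ^ 2 = (‖Y‖ ^ 2 * (curvDensity Y Y₁ / 2 + (a.re ^ 2 + a.im ^ 2)) +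
      (bil Y₁ Y₁).re) / 2 := by
    rw [norm_sq_reV, e3, ← Complex.normSq_eq_norm_sq, Complex.normSq_apply]
    ring
  have f3 : inner ℝ (reV Y) (reV Y₁) = a.re * ‖Y‖ ^ 2 / 2 := by
    rw [inner_reV_reV, e1, h1, add_zero, Complex.re_mul_ofReal]
  rw [f1, f2, f3, norm_sq_reV_of_null h0]
  have f4 : 3 * (a.re * ‖Y‖ ^ 2 / 2) ^ 2 / (‖Y‖ ^ 2 / 2) = 3 / 2 * a.re ^ 2 * ‖Y‖ ^ 2 := by
    field_simp
  rw [f4]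
  -- The terms in `a` cancel. The curvature enters with weight `3/8` directly and at most `1/8`
  -- through `bil Y₁ Y₁`, which makes `1/2`, the weight of the Schwarzian.
  nlinarith [mul_nonneg hNpos.le (neg_nonneg.2 h)]

/-! ### Hyperbolic geodesics -/

/-- The denominator of a unit speed geodesic of the disk. -/
def geoDen (ζ u : ℂ) (s : ℝ) : ℂ := Real.cosh s + starRingEnd ℂ ζ * u * Real.sinh s

/-- The derivative of the denominator of a geodesic. -/
def geoDen' (ζ u : ℂ) (s : ℝ) : ℂ := Real.sinh s + starRingEnd ℂ ζ * u * Real.cosh s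

/-- The geodesic of the hyperbolic disk which starts at `ζ` in the direction `u`. -/
def geo (ζ u : ℂ) (s : ℝ) : ℂ := (ζ * Real.cosh s + u * Real.sinh s) / geoDen ζ u s

/-- The velocity of a geodesic. -/
def geoV (ζ u : ℂ) (s : ℝ) : ℂ := u * (1 - ‖ζ‖ ^ 2 : ℝ) / geoDen ζ u s ^ 2

/-- The second derivative of a geodesic. -/
def geoV₁ (ζ u : ℂ) (s : ℝ) : ℂ :=
  -2 * (u * (1 - ‖ζ‖ ^ 2 : ℝ)) * geoDen' ζ u s / geoDen ζ u s ^ 3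

/-- The third derivative of a geodesic. -/
def geoV₂ (ζ u : ℂ) (s : ℝ) : ℂ := (u * (1 - ‖ζ‖ ^ 2 : ℝ)) *
  (-2 / geoDen ζ u s ^ 2 + 6 * geoDen' ζ u s ^ 2 / geoDen ζ u s ^ 4)

section geodesics

variable {ζ u : ℂ}

lemma one_sub_norm_sq_pos (hζ : ζ ∈ disk) : 0 < 1 - ‖ζ‖ ^ 2 := by
  have : ‖ζ‖ < 1 := by simpa using hζ
  nlinarith [norm_nonneg ζ]

lemma geoDen_ne_zero (hζ : ζ ∈ disk) (hu : ‖u‖ = 1) (s : ℝ) : geoDen ζ u s ≠ 0 := by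
  have h1 : ‖ζ‖ < 1 := by simpa using hζ
  intro h
  have h2 : (Real.cosh s : ℂ) = -(starRingEnd ℂ ζ * u * Real.sinh s) := eq_neg_of_add_eq_zero_left h
  have h3 := congrArg norm h2
  rw [norm_neg, norm_mul, norm_mul, RCLike.norm_conj, hu, mul_one, Complex.norm_real,
    Complex.norm_real, Real.norm_of_nonneg (Real.cosh_pos s).le, Real.norm_eq_abs] at h3
  have h4 : |Real.sinh s| < Real.cosh s := by
    rw [abs_lt]
    constructor
    · linarith [Real.exp_pos s, Real.sinh_add_cosh s]
    · exact Real.sinh_lt_cosh s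
  nlinarith [abs_nonneg (Real.sinh s), norm_nonneg ζ]

lemma hasDerivAt_geoDen (s : ℝ) : HasDerivAt (geoDen ζ u) (geoDen' ζ u s) s :=
  ((Real.hasDerivAt_cosh s).ofReal_comp).add (((Real.hasDerivAt_sinh s).ofReal_comp).const_mul _)

lemma hasDerivAt_geoDen' (s : ℝ) : HasDerivAt (geoDen' ζ u) (geoDen ζ u s) s :=
  ((Real.hasDerivAt_sinh s).ofReal_comp).add (((Real.hasDerivAt_cosh s).ofReal_comp).const_mul _)

lemma cosh_sq_cast (s : ℝ) : ((Real.cosh s : ℝ) : ℂ) ^ 2 = ((Real.sinh s : ℝ) : ℂ) ^ 2 + 1 := by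
  have := Real.cosh_sq s
  exact_mod_cast this

lemma hasDerivAt_geo (hζ : ζ ∈ disk) (hu : ‖u‖ = 1) (s : ℝ) :
    HasDerivAt (geo ζ u) (geoV ζ u s) s := by
  have hD := geoDen_ne_zero hζ hu s
  have h1 : HasDerivAt (fun s : ℝ => ζ * Real.cosh s + u * Real.sinh s)
      (ζ * Real.sinh s + u * Real.cosh s) s :=
    (((Real.hasDerivAt_cosh s).ofReal_comp).const_mul _).add
      (((Real.hasDerivAt_sinh s).ofReal_comp).const_mul _)
  refine (show HasDerivAt (geo ζ u) _ s from h1.div (hasDerivAt_geoDen s) hD).congr_deriv ?_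
  symm
  rw [geoV]
  congr 1
  have hz : ((‖ζ‖ : ℂ)) ^ 2 = ζ * starRingEnd ℂ ζ := (Complex.mul_conj' ζ).symm
  push_cast [-Complex.ofReal_cosh, -Complex.ofReal_sinh]
  rw [hz, geoDen, geoDen']
  linear_combination (-u + u * ζ * starRingEnd ℂ ζ) * cosh_sq_cast s

lemma hasDerivAt_geoV (hζ : ζ ∈ disk) (hu : ‖u‖ = 1) (s : ℝ) :
    HasDerivAt (geoV ζ u) (geoV₁ ζ u s) s := by
  have hD := geoDen_ne_zero hζ hu s
  refine (show HasDerivAt (geoV ζ u) _ s from (hasDerivAt_const s (u * (1 - ‖ζ‖ ^ 2 : ℝ))).div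
    ((hasDerivAt_geoDen s).pow 2) (pow_ne_zero 2 hD)).congr_deriv ?_
  rw [geoV₁]
  field_simp
  ring

lemma hasDerivAt_geoV₁ (hζ : ζ ∈ disk) (hu : ‖u‖ = 1) (s : ℝ) :
    HasDerivAt (geoV₁ ζ u) (geoV₂ ζ u s) s := by
  have hD := geoDen_ne_zero hζ hu s
  refine (show HasDerivAt (geoV₁ ζ u) _ s from ((hasDerivAt_geoDen' s).const_mul
    (-2 * (u * (1 - ‖ζ‖ ^ 2 : ℝ)))).div ((hasDerivAt_geoDen s).pow 3)
    (pow_ne_zero 3 hD)).congr_deriv ?_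
  rw [geoV₂]
  field_simp
  ring

lemma geoV_ne_zero (hζ : ζ ∈ disk) (hu : ‖u‖ = 1) (s : ℝ) : geoV ζ u s ≠ 0 := by
  have hu0 : u ≠ 0 := by rw [← norm_ne_zero_iff, hu]; norm_num
  exact div_ne_zero (mul_ne_zero hu0 (by exact_mod_cast (one_sub_norm_sq_pos hζ).ne'))
    (pow_ne_zero 2 (geoDen_ne_zero hζ hu s))

/-- A geodesic is a Möbius image of `tanh`, so it has the Schwarzian of `tanh`. With unit hyperbolic
speed (`norm_geoV`) this constant exactly balances the bound `2 / (1 - ‖z‖ ^ 2) ^ 2`. -/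
lemma schwarzian_geo (hζ : ζ ∈ disk) (hu : ‖u‖ = 1) (s : ℝ) :
    geoV₂ ζ u s / geoV ζ u s - 3 / 2 * (geoV₁ ζ u s / geoV ζ u s) ^ 2 = -2 := by
  have hD := geoDen_ne_zero hζ hu s
  have hu0 : u ≠ 0 := by rw [← norm_ne_zero_iff, hu]; norm_num
  have h1 : ((1 - ‖ζ‖ ^ 2 : ℝ) : ℂ) ≠ 0 := by exact_mod_cast (one_sub_norm_sq_pos hζ).ne'
  rw [geoV, geoV₁, geoV₂]
  generalize ((1 - ‖ζ‖ ^ 2 : ℝ) : ℂ) = k at *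
  field_simp
  ring

lemma norm_geoV (hζ : ζ ∈ disk) (hu : ‖u‖ = 1) (s : ℝ) :
    ‖geoV ζ u s‖ = 1 - ‖geo ζ u s‖ ^ 2 := by
  have hD := geoDen_ne_zero hζ hu s
  have hn : 0 < ‖geoDen ζ u s‖ := norm_pos_iff.2 hD
  have h1 : ‖geoV ζ u s‖ = (1 - ‖ζ‖ ^ 2) / ‖geoDen ζ u s‖ ^ 2 := by
    rw [geoV, norm_div, norm_mul, hu, Complex.norm_real,
      Real.norm_of_nonneg (one_sub_norm_sq_pos hζ).le, norm_pow, one_mul]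
  rw [h1, geo, norm_div, div_pow]
  have h2 : ‖geoDen ζ u s‖ ^ 2 - ‖ζ * Real.cosh s + u * Real.sinh s‖ ^ 2 = 1 - ‖ζ‖ ^ 2 := by
    have hu2 : (u * starRingEnd ℂ u : ℂ) = 1 := by rw [Complex.mul_conj', hu]; norm_num
    have : ((‖geoDen ζ u s‖ ^ 2 - ‖ζ * Real.cosh s + u * Real.sinh s‖ ^ 2 : ℝ) : ℂ) =
        (1 - ‖ζ‖ ^ 2 : ℝ) := by
      push_cast [-Complex.ofReal_cosh, -Complex.ofReal_sinh]
      rw [← Complex.mul_conj', ← Complex.mul_conj', ← Complex.mul_conj', geoDen]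
      simp only [map_add, map_mul, Complex.conj_conj, Complex.conj_ofReal]
      linear_combination (1 - ζ * starRingEnd ℂ ζ) * cosh_sq_cast s +
        (((Real.sinh s : ℝ) : ℂ) ^ 2 * (ζ * starRingEnd ℂ ζ - 1)) * hu2
    exact_mod_cast this
  field_simp
  linarith

lemma geo_mem_disk (hζ : ζ ∈ disk) (hu : ‖u‖ = 1) (s : ℝ) : geo ζ u s ∈ disk := by
  have h := norm_geoV hζ hu s
  have h2 : 0 < ‖geoV ζ u s‖ := norm_pos_iff.2 (geoV_ne_zero hζ hu s)
  rw [h] at h2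
  rw [disk, Metric.mem_ball, dist_zero_right]
  nlinarith [norm_nonneg (geo ζ u s)]

lemma geo_zero : geo ζ u 0 = ζ := by simp [geo, geoDen]

lemma geo_eq_tanh (hζ : ζ ∈ disk) (hu : ‖u‖ = 1) (s : ℝ) :
    geo ζ u s = (ζ + u * Real.tanh s) / (1 + starRingEnd ℂ ζ * u * Real.tanh s) := by
  have hD := geoDen_ne_zero hζ hu s
  have hc : ((Real.cosh s : ℝ) : ℂ) ≠ 0 := by exact_mod_cast (Real.cosh_pos s).ne'
  have ht : ((Real.tanh s : ℝ) : ℂ) = Real.sinh s / Real.cosh s := by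
    rw [Real.tanh_eq_sinh_div_cosh]; push_cast; rfl
  have h1 : (1 + starRingEnd ℂ ζ * u * Real.tanh s) = geoDen ζ u s / Real.cosh s := by
    rw [ht, geoDen]; field_simp
  rw [h1, geo, ht]
  field_simp

end geodesics


/-! ### Conformal profiles along real curves -/

/-- The quadratic function `α |x|² - 2 ⟨β, x⟩ + δ`. -/
def quadVal (α : ℝ) (β : E3) (δ : ℝ) (x : E3) : ℝ := α * ‖x‖ ^ 2 - 2 * inner ℝ β x + δ

/-- The logarithmic derivative of `√(A / |U|)`, where `A` is a quadratic function with gradient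
`2 R` and `U` the velocity of a curve with acceleration `U₁`. -/
def logSlope (A : ℝ) (R U U₁ : E3) : ℝ := inner ℝ R U / A - inner ℝ U U₁ / (2 * ‖U‖ ^ 2)

/-- The second derivative of `√(A / |U|)` divided by the function. -/
def convexity (α A : ℝ) (R U U₁ U₂ : E3) : ℝ :=
  (α * ‖U‖ ^ 2 + inner ℝ R U₁) / A - 2 * (inner ℝ R U) ^ 2 / A ^ 2
    - (‖U₁‖ ^ 2 + inner ℝ U U₂) / (2 * ‖U‖ ^ 2) + (inner ℝ U U₁) ^ 2 / (‖U‖ ^ 2) ^ 2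
    + logSlope A R U U₁ ^ 2

/-- The normal curvature vector of a curve after inversion, up to normalization. -/
def bending (A : ℝ) (R U U₁ : E3) : E3 :=
  (1 / 2 : ℝ) • U₁ + (‖U‖ ^ 2 / A) • R - (inner ℝ U U₁ / (2 * ‖U‖ ^ 2) + inner ℝ R U / A) • U

section curves

variable {γ U U₁ U₂ : ℝ → E3} {α δ : ℝ} {β : E3} {s : ℝ}

/-- The defect `‖β‖ ^ 2 - α * δ` vanishes for a squared distance and is negative after adding a
positive constant to it. Its sign is what convexity depends on. -/
lemma norm_sq_gradient (α : ℝ) (β : E3) (δ : ℝ) (x : E3) :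
    ‖α • x - β‖ ^ 2 = α * quadVal α β δ x + (‖β‖ ^ 2 - α * δ) := by
  rw [norm_sub_sq_real, norm_smul, mul_pow, inner_smul_left, quadVal, Real.norm_eq_abs, sq_abs,
    real_inner_comm]
  simp only [conj_trivial]
  ring

lemma quadVal_one (p : E3) (ε : ℝ) (x : E3) : quadVal 1 p (‖p‖ ^ 2 + ε) x = ‖x - p‖ ^ 2 + ε := by
  rw [norm_sub_sq_real, quadVal, real_inner_comm]; ring

lemma quadVal_zero (x : E3) : quadVal 0 0 1 x = 1 := by simp [quadVal]

lemma hasDerivAt_norm_sq (h : HasDerivAt U (U₁ s) s) :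
    HasDerivAt (fun t => ‖U t‖ ^ 2) (2 * inner ℝ (U s) (U₁ s)) s := h.norm_sq

lemma hasDerivAt_quadVal (h : HasDerivAt γ (U s) s) :
    HasDerivAt (fun t => quadVal α β δ (γ t)) (2 * inner ℝ (α • γ s - β) (U s)) s := by
  have h1 := ((hasDerivAt_norm_sq h).const_mul α).sub
    (((hasDerivAt_const s β).inner ℝ h).const_mul 2)
  refine (h1.add_const δ).congr_deriv ?_
  rw [inner_zero_left, inner_sub_left, inner_smul_left]
  simp only [conj_trivial]
  ring

lemma sqrt_div_norm_eq_exp {A : ℝ} (hA : 0 < A) {v : E3} (hv : v ≠ 0) :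
    √(A / ‖v‖) = Real.exp (Real.log A / 2 - Real.log (‖v‖ ^ 2) / 4) := by
  have h1 : 0 < ‖v‖ := norm_pos_iff.2 hv
  rw [Real.sqrt_eq_rpow, Real.rpow_def_of_pos (by positivity), Real.log_div hA.ne' h1.ne',
    Real.log_pow]
  congr 1
  push_cast
  ring

lemma hasDerivAt_sqrt_quadVal (h : HasDerivAt γ (U s) s) (h1 : HasDerivAt U (U₁ s) s)
    (hA : 0 < quadVal α β δ (γ s)) (hU : U s ≠ 0) :
    HasDerivAt (fun t => √(quadVal α β δ (γ t) / ‖U t‖))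
      (logSlope (quadVal α β δ (γ s)) (α • γ s - β) (U s) (U₁ s) *
        √(quadVal α β δ (γ s) / ‖U s‖)) s := by
  have hQ := hasDerivAt_quadVal (α := α) (β := β) (δ := δ) h
  have hn : ‖U s‖ ^ 2 ≠ 0 := by positivity
  have hL := (((hQ.log hA.ne').div_const 2).sub
    (((hasDerivAt_norm_sq h1).log hn).div_const 4)).exp
  have he : (fun t => √(quadVal α β δ (γ t) / ‖U t‖)) =ᶠ[𝓝 s] fun t =>
      Real.exp (Real.log (quadVal α β δ (γ t)) / 2 - Real.log (‖U t‖ ^ 2) / 4) := by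
    filter_upwards [hQ.continuousAt.eventually (lt_mem_nhds hA),
      h1.continuousAt.eventually_ne hU] with t ht1 ht2
    exact sqrt_div_norm_eq_exp ht1 ht2
  refine (hL.congr_of_eventuallyEq he).congr_deriv ?_
  simp only [Pi.sub_apply]
  rw [sqrt_div_norm_eq_exp hA hU, mul_comm, logSlope]
  congr 1
  ring

lemma hasDerivAt_logSlope (h : HasDerivAt γ (U s) s) (h1 : HasDerivAt U (U₁ s) s)
    (h2 : HasDerivAt U₁ (U₂ s) s) (hA : 0 < quadVal α β δ (γ s)) (hU : U s ≠ 0) :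
    HasDerivAt (fun t => logSlope (quadVal α β δ (γ t)) (α • γ t - β) (U t) (U₁ t) *
        √(quadVal α β δ (γ t) / ‖U t‖))
      (convexity α (quadVal α β δ (γ s)) (α • γ s - β) (U s) (U₁ s) (U₂ s) *
        √(quadVal α β δ (γ s) / ‖U s‖)) s := by
  have hQ := hasDerivAt_quadVal (α := α) (β := β) (δ := δ) h
  have hn : ‖U s‖ ^ 2 ≠ 0 := by positivity
  have hR : HasDerivAt (fun t => α • γ t - β) (α • U s) s := (h.const_smul α).sub_const β
  have hS := ((hR.inner ℝ h1).div hQ hA.ne').sub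
    ((h1.inner ℝ h2).div ((hasDerivAt_norm_sq h1).const_mul 2) (mul_ne_zero two_ne_zero hn))
  refine (hS.mul (hasDerivAt_sqrt_quadVal h h1 hA hU)).congr_deriv ?_
  simp only [Pi.sub_apply, Pi.div_apply]
  generalize √(quadVal α β δ (γ s) / ‖U s‖) = G
  rw [convexity, logSlope, inner_smul_left, real_inner_self_eq_norm_sq, real_inner_self_eq_norm_sq]
  simp only [conj_trivial]
  field_simp
  ring

/-- For `κ = 0` this reflects the Möbius invariance of Ahlfors' Schwarzian: after inversion only
that Schwarzian and the square of a vector normal to `u` are left. All three terms are nonnegative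
when the Schwarzian and `κ` are nonpositive, and the last one detects equality. -/
lemma convexity_eq {α A : ℝ} {R u u₁ u₂ : E3} {κ : ℝ} (hA : A ≠ 0) (hU : u ≠ 0)
    (hR : ‖R‖ ^ 2 = α * A + κ) :
    convexity α A R u u₁ u₂ = -(inner ℝ u u₂ + 3 / 2 * ‖u₁‖ ^ 2 -
      3 * (inner ℝ u u₁) ^ 2 / ‖u‖ ^ 2) / (2 * ‖u‖ ^ 2) + ‖u‖ ^ 2 * (-κ) / A ^ 2 +
      ‖bending A R u u₁‖ ^ 2 / ‖u‖ ^ 2 := by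
  have hn : ‖u‖ ^ 2 ≠ 0 := by positivity
  have hZ : ‖bending A R u u₁‖ ^ 2 = ‖u₁‖ ^ 2 / 4 + (‖u‖ ^ 2 / A) ^ 2 * ‖R‖ ^ 2 +
      (inner ℝ u u₁ / (2 * ‖u‖ ^ 2) + inner ℝ R u / A) ^ 2 * ‖u‖ ^ 2 +
      (‖u‖ ^ 2 / A) * inner ℝ R u₁ -
      (inner ℝ u u₁ / (2 * ‖u‖ ^ 2) + inner ℝ R u / A) * (inner ℝ u u₁) -
      2 * (‖u‖ ^ 2 / A) * (inner ℝ u u₁ / (2 * ‖u‖ ^ 2) + inner ℝ R u / A) * inner ℝ R u := by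
    rw [bending]
    generalize ‖u‖ ^ 2 / A = p
    generalize inner ℝ u u₁ / (2 * ‖u‖ ^ 2) + inner ℝ R u / A = c
    rw [norm_sub_sq_real, norm_add_sq_real, inner_add_left]
    simp only [inner_smul_left, inner_smul_right, conj_trivial, norm_smul, mul_pow, Real.norm_eq_abs,
      sq_abs]
    rw [real_inner_comm R u₁, real_inner_comm u u₁]
    ring
  rw [hZ, hR, convexity, logSlope]
  field_simp
  ring

end curves

/-! ### Null curves satisfying Nehari's condition -/

/-- A holomorphic null curve on the disk whose real part satisfies the univalence criterion. -/
structure IsNehariCurve (Φ : ℂ → C3) : Prop where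
  diff : DifferentiableOn ℂ Φ disk
  null : ∀ z ∈ disk, bil (deriv Φ z) (deriv Φ z) = 0
  ne_zero : ∀ z ∈ disk, deriv Φ z ≠ 0
  bound : ∀ z ∈ disk, ‖schw (deriv Φ z) (deriv (deriv Φ) z) (deriv (deriv (deriv Φ)) z)‖ +
    curvDensity (deriv Φ z) (deriv (deriv Φ) z) ≤ 2 / (1 - ‖z‖ ^ 2) ^ 2

/-- The velocity of a curve along a geodesic. -/
def crv (Φ : ℂ → C3) (ζ u : ℂ) (s : ℝ) : C3 := geoV ζ u s • deriv Φ (geo ζ u s)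

/-- The acceleration of a curve along a geodesic. -/
def crv₁ (Φ : ℂ → C3) (ζ u : ℂ) (s : ℝ) : C3 :=
  geoV ζ u s ^ 2 • deriv (deriv Φ) (geo ζ u s) + geoV₁ ζ u s • deriv Φ (geo ζ u s)

/-- The third derivative of a curve along a geodesic. -/
def crv₂ (Φ : ℂ → C3) (ζ u : ℂ) (s : ℝ) : C3 :=
  geoV ζ u s ^ 3 • deriv (deriv (deriv Φ)) (geo ζ u s) +
    (3 * geoV ζ u s * geoV₁ ζ u s) • deriv (deriv Φ) (geo ζ u s) +
    geoV₂ ζ u s • deriv Φ (geo ζ u s)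

lemma hasDerivAt_bil {A B : ℂ → C3} {A' B' : C3} {z : ℂ} (hA : HasDerivAt A A' z)
    (hB : HasDerivAt B B' z) :
    HasDerivAt (fun z => bil (A z) (B z)) (bil A' (B z) + bil (A z) B') z := by
  have hc : ∀ {C : ℂ → C3} {C' : C3} (i : Fin 3), HasDerivAt C C' z →
      HasDerivAt (fun z => C z i) (C' i) z := fun i hC =>
    (EuclideanSpace.proj (𝕜 := ℂ) i).hasFDerivAt.comp_hasDerivAt z hC
  refine ((((hc 0 hA).mul (hc 0 hB)).add ((hc 1 hA).mul (hc 1 hB))).add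
    ((hc 2 hA).mul (hc 2 hB))).congr_deriv ?_
  simp only [bil]
  ring

lemma hasDerivAt_comp_reV {A : ℝ → C3} {A' : C3} {s : ℝ} (h : HasDerivAt A A' s) :
    HasDerivAt (fun t => reV (A t)) (reV A') s := reV.hasFDerivAt.comp_hasDerivAt s h

namespace IsNehariCurve

variable {Φ : ℂ → C3} (hΦ : IsNehariCurve Φ) {ζ u : ℂ}

include hΦ

lemma hasDerivAt {z : ℂ} (hz : z ∈ disk) : HasDerivAt Φ (deriv Φ z) z :=
  (hΦ.diff.differentiableAt (Metric.isOpen_ball.mem_nhds hz)).hasDerivAt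

lemma hasDerivAt₁ {z : ℂ} (hz : z ∈ disk) : HasDerivAt (deriv Φ) (deriv (deriv Φ) z) z :=
  ((hΦ.diff.deriv Metric.isOpen_ball).differentiableAt
    (Metric.isOpen_ball.mem_nhds hz)).hasDerivAt

lemma hasDerivAt₂ {z : ℂ} (hz : z ∈ disk) :
    HasDerivAt (deriv (deriv Φ)) (deriv (deriv (deriv Φ)) z) z :=
  (((hΦ.diff.deriv Metric.isOpen_ball).deriv Metric.isOpen_ball).differentiableAt
    (Metric.isOpen_ball.mem_nhds hz)).hasDerivAt

lemma null₁ {z : ℂ} (hz : z ∈ disk) : bil (deriv Φ z) (deriv (deriv Φ) z) = 0 := by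
  have h1 := hasDerivAt_bil (hΦ.hasDerivAt₁ hz) (hΦ.hasDerivAt₁ hz)
  have h2 : (fun z => bil (deriv Φ z) (deriv Φ z)) =ᶠ[𝓝 z] fun _ => 0 := by
    filter_upwards [Metric.isOpen_ball.mem_nhds hz] with w hw using hΦ.null w hw
  have h3 := h1.unique ((hasDerivAt_const z (0 : ℂ)).congr_of_eventuallyEq h2)
  rw [bil_comm (deriv (deriv Φ) z)] at h3
  linear_combination h3 / 2

lemma null₂ {z : ℂ} (hz : z ∈ disk) : bil (deriv (deriv Φ) z) (deriv (deriv Φ) z) +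
    bil (deriv Φ z) (deriv (deriv (deriv Φ)) z) = 0 := by
  have h1 := hasDerivAt_bil (hΦ.hasDerivAt₁ hz) (hΦ.hasDerivAt₂ hz)
  have h2 : (fun z => bil (deriv Φ z) (deriv (deriv Φ) z)) =ᶠ[𝓝 z] fun _ => 0 := by
    filter_upwards [Metric.isOpen_ball.mem_nhds hz] with w hw using hΦ.null₁ hw
  exact h1.unique ((hasDerivAt_const z (0 : ℂ)).congr_of_eventuallyEq h2)

lemma hasDerivAt_geo (hζ : ζ ∈ disk) (hu : ‖u‖ = 1) (s : ℝ) :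
    HasDerivAt (fun t => Φ (geo ζ u t)) (crv Φ ζ u s) s :=
  (hΦ.hasDerivAt (geo_mem_disk hζ hu s)).scomp s (HarmonicLift.hasDerivAt_geo hζ hu s)

lemma hasDerivAt_crv (hζ : ζ ∈ disk) (hu : ‖u‖ = 1) (s : ℝ) :
    HasDerivAt (crv Φ ζ u) (crv₁ Φ ζ u s) s := by
  refine ((hasDerivAt_geoV hζ hu s).smul ((hΦ.hasDerivAt₁ (geo_mem_disk hζ hu s)).scomp s
    (HarmonicLift.hasDerivAt_geo hζ hu s))).congr_deriv ?_
  rw [crv₁, smul_smul, pow_two]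
  rfl

lemma hasDerivAt_crv₁ (hζ : ζ ∈ disk) (hu : ‖u‖ = 1) (s : ℝ) :
    HasDerivAt (crv₁ Φ ζ u) (crv₂ Φ ζ u s) s := by
  have hV := hasDerivAt_geoV hζ hu s
  refine (((hV.pow 2).smul ((hΦ.hasDerivAt₂ (geo_mem_disk hζ hu s)).scomp s
    (HarmonicLift.hasDerivAt_geo hζ hu s))).add ((hasDerivAt_geoV₁ hζ hu s).smul
    ((hΦ.hasDerivAt₁ (geo_mem_disk hζ hu s)).scomp s
    (HarmonicLift.hasDerivAt_geo hζ hu s)))).congr_deriv ?_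
  simp only [crv₂, Function.comp_apply, smul_smul, Pi.pow_apply]
  module

lemma bil_crv (hζ : ζ ∈ disk) (hu : ‖u‖ = 1) (s : ℝ) :
    bil (crv Φ ζ u s) (crv Φ ζ u s) = 0 := by
  rw [crv, bil_smul_smul, hΦ.null _ (geo_mem_disk hζ hu s), mul_zero]

lemma bil_crv₁ (hζ : ζ ∈ disk) (hu : ‖u‖ = 1) (s : ℝ) :
    bil (crv Φ ζ u s) (crv₁ Φ ζ u s) = 0 := by
  have hz := geo_mem_disk hζ hu s
  rw [crv, crv₁, bil_add_right, bil_smul_smul, bil_smul_smul, hΦ.null _ hz, hΦ.null₁ hz]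
  ring

lemma bil_crv₂ (hζ : ζ ∈ disk) (hu : ‖u‖ = 1) (s : ℝ) :
    bil (crv₁ Φ ζ u s) (crv₁ Φ ζ u s) + bil (crv Φ ζ u s) (crv₂ Φ ζ u s) = 0 := by
  have hz := geo_mem_disk hζ hu s
  rw [crv, crv₁, crv₂]
  simp only [bil_add_right, bil_add_left, bil_smul_smul, hΦ.null _ hz, hΦ.null₁ hz,
    bil_comm (deriv (deriv Φ) (geo ζ u s)) (deriv Φ (geo ζ u s))]
  linear_combination (geoV ζ u s) ^ 4 * hΦ.null₂ hz

lemma crv_ne_zero (hζ : ζ ∈ disk) (hu : ‖u‖ = 1) (s : ℝ) : crv Φ ζ u s ≠ 0 :=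
  smul_ne_zero (geoV_ne_zero hζ hu s) (hΦ.ne_zero _ (geo_mem_disk hζ hu s))

lemma reV_crv_ne_zero (hζ : ζ ∈ disk) (hu : ‖u‖ = 1) (s : ℝ) : reV (crv Φ ζ u s) ≠ 0 :=
  reV_ne_zero (hΦ.bil_crv hζ hu s) (hΦ.crv_ne_zero hζ hu s)

lemma ahlfors_crv_nonpos (hζ : ζ ∈ disk) (hu : ‖u‖ = 1) (s : ℝ) :
    inner ℝ (reV (crv Φ ζ u s)) (reV (crv₂ Φ ζ u s)) + 3 / 2 * ‖reV (crv₁ Φ ζ u s)‖ ^ 2 -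
      3 * (inner ℝ (reV (crv Φ ζ u s)) (reV (crv₁ Φ ζ u s))) ^ 2 /
        ‖reV (crv Φ ζ u s)‖ ^ 2 ≤ 0 := by
  have hz := geo_mem_disk hζ hu s
  have hX := hΦ.ne_zero _ hz
  have hc := geoV_ne_zero hζ hu s
  refine ahlfors_nonpos (hΦ.crv_ne_zero hζ hu s) (hΦ.bil_crv hζ hu s) (hΦ.bil_crv₁ hζ hu s)
    (hΦ.bil_crv₂ hζ hu s) ?_
  rw [crv, crv₁, crv₂, schw_trans hX hc, curvDensity_trans hX hc, schwarzian_geo hζ hu]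
  have hb := hΦ.bound _ hz
  have hk := one_sub_norm_sq_pos hz
  rw [← norm_geoV hζ hu s] at hb hk
  set S := schw (deriv Φ (geo ζ u s)) (deriv (deriv Φ) (geo ζ u s))
    (deriv (deriv (deriv Φ)) (geo ζ u s))
  set E := curvDensity (deriv Φ (geo ζ u s)) (deriv (deriv Φ) (geo ζ u s))
  -- Multiplying the univalence bound by the squared speed `(1 - ‖z‖ ^ 2) ^ 2` leaves `2`, which
  -- cancels the Schwarzian of the geodesic.
  have h1 : (geoV ζ u s ^ 2 * S + -2).re ≤ ‖geoV ζ u s‖ ^ 2 * ‖S‖ - 2 := by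
    rw [Complex.add_re]
    have := Complex.re_le_norm (geoV ζ u s ^ 2 * S)
    rw [norm_mul, norm_pow] at this
    have h2 : (-2 : ℂ).re = -2 := by simp
    rw [h2]
    linarith
  rw [le_div_iff₀ (by positivity)] at hb
  linarith

end IsNehariCurve


/-! ### Profiles of null curves -/

/-- The square root of a quadratic function on the surface divided by the conformal density relative
to the hyperbolic metric. -/
def profile (α : ℝ) (β : E3) (δ : ℝ) (Φ : ℂ → C3) (z : ℂ) : ℝ :=
  √(quadVal α β δ (reV (Φ z)) / ((1 - ‖z‖ ^ 2) * ‖reV (deriv Φ z)‖))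

/-- The curvature parameter of the contact circle at a point of the surface. -/
def contactParam (Φ : ℂ → C3) (ζ : ℂ) : ℂ :=
  starRingEnd ℂ ζ / (1 - ‖ζ‖ ^ 2) - tangCoeff (deriv Φ ζ) (deriv (deriv Φ) ζ) / 2

/-- The logarithmic gradient of a profile. -/
def critForm (α : ℝ) (β : E3) (δ : ℝ) (Φ : ℂ → C3) (ζ : ℂ) : ℂ :=
  pair (α • reV (Φ ζ) - β) (deriv Φ ζ) / (quadVal α β δ (reV (Φ ζ)) : ℝ) + contactParam Φ ζ

namespace IsNehariCurve

variable {Φ : ℂ → C3} (hΦ : IsNehariCurve Φ) {ζ u : ℂ} {α δ : ℝ} {β : E3}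

include hΦ

lemma profile_geo (hζ : ζ ∈ disk) (hu : ‖u‖ = 1) (s : ℝ) :
    profile α β δ Φ (geo ζ u s) =
      √(quadVal α β δ (reV (Φ (geo ζ u s))) / ‖reV (crv Φ ζ u s)‖) := by
  rw [profile, crv, norm_reV_smul (hΦ.null _ (geo_mem_disk hζ hu s)), norm_geoV hζ hu]

lemma hasDerivAt_profile (hζ : ζ ∈ disk) (hu : ‖u‖ = 1) (s : ℝ)
    (hA : 0 < quadVal α β δ (reV (Φ (geo ζ u s)))) :
    HasDerivAt (fun t => profile α β δ Φ (geo ζ u t))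
      (logSlope (quadVal α β δ (reV (Φ (geo ζ u s)))) (α • reV (Φ (geo ζ u s)) - β)
        (reV (crv Φ ζ u s)) (reV (crv₁ Φ ζ u s)) * profile α β δ Φ (geo ζ u s)) s := by
  simp only [hΦ.profile_geo hζ hu]
  exact hasDerivAt_sqrt_quadVal (U₁ := fun t => reV (crv₁ Φ ζ u t))
    (hasDerivAt_comp_reV (hΦ.hasDerivAt_geo hζ hu s))
    (hasDerivAt_comp_reV (hΦ.hasDerivAt_crv hζ hu s)) hA (hΦ.reV_crv_ne_zero hζ hu s)

lemma hasDerivAt_profile₁ (hζ : ζ ∈ disk) (hu : ‖u‖ = 1) (s : ℝ)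
    (hA : 0 < quadVal α β δ (reV (Φ (geo ζ u s)))) :
    HasDerivAt (fun t => logSlope (quadVal α β δ (reV (Φ (geo ζ u t))))
        (α • reV (Φ (geo ζ u t)) - β)
        (reV (crv Φ ζ u t)) (reV (crv₁ Φ ζ u t)) * profile α β δ Φ (geo ζ u t))
      (convexity α (quadVal α β δ (reV (Φ (geo ζ u s)))) (α • reV (Φ (geo ζ u s)) - β)
        (reV (crv Φ ζ u s)) (reV (crv₁ Φ ζ u s)) (reV (crv₂ Φ ζ u s)) *
          profile α β δ Φ (geo ζ u s)) s := by
  simp only [hΦ.profile_geo hζ hu]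
  exact hasDerivAt_logSlope (U₂ := fun t => reV (crv₂ Φ ζ u t))
    (hasDerivAt_comp_reV (hΦ.hasDerivAt_geo hζ hu s))
    (hasDerivAt_comp_reV (hΦ.hasDerivAt_crv hζ hu s))
    (hasDerivAt_comp_reV (hΦ.hasDerivAt_crv₁ hζ hu s)) hA (hΦ.reV_crv_ne_zero hζ hu s)

lemma bending_le_convexity (hζ : ζ ∈ disk) (hu : ‖u‖ = 1) (hβ : ‖β‖ ^ 2 ≤ α * δ) (s : ℝ)
    (hA : 0 < quadVal α β δ (reV (Φ (geo ζ u s)))) :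
    ‖bending (quadVal α β δ (reV (Φ (geo ζ u s)))) (α • reV (Φ (geo ζ u s)) - β)
        (reV (crv Φ ζ u s)) (reV (crv₁ Φ ζ u s))‖ ^ 2 / ‖reV (crv Φ ζ u s)‖ ^ 2 ≤
      convexity α (quadVal α β δ (reV (Φ (geo ζ u s)))) (α • reV (Φ (geo ζ u s)) - β)
        (reV (crv Φ ζ u s)) (reV (crv₁ Φ ζ u s)) (reV (crv₂ Φ ζ u s)) := by
  have hU := hΦ.reV_crv_ne_zero hζ hu s
  have hpos : 0 < ‖reV (crv Φ ζ u s)‖ ^ 2 := by positivity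
  rw [convexity_eq hA.ne' hU (norm_sq_gradient α β δ _)]
  have h1 := hΦ.ahlfors_crv_nonpos hζ hu s
  have h2 : 0 ≤ ‖reV (crv Φ ζ u s)‖ ^ 2 * -(‖β‖ ^ 2 - α * δ) /
      quadVal α β δ (reV (Φ (geo ζ u s))) ^ 2 := by
    apply div_nonneg (mul_nonneg hpos.le (by linarith)) (sq_nonneg _)
  have h3 := div_nonneg (neg_nonneg.2 h1)
    (show 0 ≤ 2 * ‖reV (crv Φ ζ u s)‖ ^ 2 by positivity)
  linarith

lemma convexOn_profile (hζ : ζ ∈ disk) (hu : ‖u‖ = 1) (hβ : ‖β‖ ^ 2 ≤ α * δ)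
    (hA : ∀ s, 0 < quadVal α β δ (reV (Φ (geo ζ u s)))) :
    ConvexOn ℝ univ fun s => profile α β δ Φ (geo ζ u s) := by
  refine convexOn_of_hasDerivWithinAt2_nonneg convex_univ ?_
    (fun s _ => (hΦ.hasDerivAt_profile hζ hu s (hA s)).hasDerivWithinAt)
    (fun s _ => (hΦ.hasDerivAt_profile₁ hζ hu s (hA s)).hasDerivWithinAt) ?_
  · exact fun s _ => (hΦ.hasDerivAt_profile hζ hu s (hA s)).continuousAt.continuousWithinAt
  · intro s _
    refine mul_nonneg (le_trans ?_ (hΦ.bending_le_convexity hζ hu hβ s (hA s))) (Real.sqrt_nonneg _)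
    positivity

/-- The geodesic may pass through `p`, where the square root is not differentiable. Adding `ε > 0`
to the squared distance restores positivity with the right sign of the defect, and convexity
survives the pointwise limit `ε → 0`. -/
lemma convexOn_profile_dist (hζ : ζ ∈ disk) (hu : ‖u‖ = 1) (p : E3) :
    ConvexOn ℝ univ fun s => profile 1 p (‖p‖ ^ 2) Φ (geo ζ u s) := by
  have hlim : ∀ s, Tendsto (fun ε : ℝ => profile 1 p (‖p‖ ^ 2 + ε) Φ (geo ζ u s)) (𝓝[>] 0)
      (𝓝 (profile 1 p (‖p‖ ^ 2) Φ (geo ζ u s))) := by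
    intro s
    have hc : Continuous fun ε : ℝ => profile 1 p (‖p‖ ^ 2 + ε) Φ (geo ζ u s) := by
      simp only [profile, quadVal]
      fun_prop
    have := hc.tendsto 0
    rw [add_zero] at this
    exact this.mono_left nhdsWithin_le_nhds
  refine ⟨convex_univ, fun x _ y _ a b ha hb hab => ?_⟩
  refine le_of_tendsto_of_tendsto (hlim _) (((hlim x).const_smul a).add ((hlim y).const_smul b)) ?_
  filter_upwards [self_mem_nhdsWithin] with ε hε
  have hε : 0 < ε := hε
  refine (hΦ.convexOn_profile hζ hu (by linarith) fun s => ?_).2 (mem_univ x) (mem_univ y) ha hb hab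
  rw [quadVal_one]
  positivity

/-- The acceleration of the geodesic at `ζ` produces the term `conj ζ / (1 - ‖ζ‖ ^ 2)` of
`contactParam`. Thus the hyperbolic gradient of a profile carries the parameter of the transported
model circle. -/
lemma logSlope_zero (hζ : ζ ∈ disk) (hu : ‖u‖ = 1) :
    logSlope (quadVal α β δ (reV (Φ (geo ζ u 0)))) (α • reV (Φ (geo ζ u 0)) - β)
        (reV (crv Φ ζ u 0)) (reV (crv₁ Φ ζ u 0)) =
      (u * ((1 - ‖ζ‖ ^ 2 : ℝ) * critForm α β δ Φ ζ)).re := by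
  have hk := one_sub_norm_sq_pos hζ
  have hkc : ((1 - ‖ζ‖ ^ 2 : ℝ) : ℂ) ≠ 0 := by exact_mod_cast hk.ne'
  have hu0 : u ≠ 0 := by rw [← norm_ne_zero_iff, hu]; norm_num
  have hX := hΦ.ne_zero ζ hζ
  have hV : geoV ζ u 0 = u * (1 - ‖ζ‖ ^ 2 : ℝ) := by simp [geoV, geoDen]
  have hV₁ : geoV₁ ζ u 0 = -2 * (u * (1 - ‖ζ‖ ^ 2 : ℝ)) * (starRingEnd ℂ ζ * u) := by
    simp [geoV₁, geoDen, geoDen']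
  have hY := hΦ.crv_ne_zero hζ hu 0
  have hN : (0 : ℝ) < ‖crv Φ ζ u 0‖ ^ 2 := by positivity
  have h1 : inner ℝ (reV (crv Φ ζ u 0)) (reV (crv₁ Φ ζ u 0)) / (2 * ‖reV (crv Φ ζ u 0)‖ ^ 2) =
      (u * (1 - ‖ζ‖ ^ 2 : ℝ) * tangCoeff (deriv Φ ζ) (deriv (deriv Φ) ζ) / 2 -
        starRingEnd ℂ ζ * u).re := by
    rw [inner_reV_reV, hΦ.bil_crv₁ hζ hu, norm_sq_reV_of_null (hΦ.bil_crv hζ hu 0), add_zero]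
    have h2 : tangCoeff (crv Φ ζ u 0) (crv₁ Φ ζ u 0) / 2 =
        (u * (1 - ‖ζ‖ ^ 2 : ℝ) * tangCoeff (deriv Φ ζ) (deriv (deriv Φ) ζ) / 2 -
          starRingEnd ℂ ζ * u) := by
      rw [crv, crv₁, geo_zero, tangCoeff_trans hX (geoV_ne_zero hζ hu 0), hV, hV₁]
      field_simp
      ring
    rw [← h2, tangCoeff, ← Complex.ofReal_ofNat, Complex.div_ofReal_re, Complex.div_ofReal_re]
    field_simp
  rw [logSlope, h1, inner_reV, crv, pair_smul, hV, geo_zero, ← Complex.div_ofReal_re,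
    ← Complex.sub_re, critForm, contactParam]
  congr 1
  have : (1 - (‖ζ‖ : ℂ) ^ 2) = ((1 - ‖ζ‖ ^ 2 : ℝ) : ℂ) := by push_cast; rfl
  rw [this]
  field_simp
  ring

end IsNehariCurve

lemma eq_zero_of_forall_re_mul {a : ℂ} (h : ∀ u : ℂ, ‖u‖ = 1 → (u * a).re = 0) : a = 0 := by
  apply Complex.ext
  · simpa using h 1 (by simp)
  · simpa using h Complex.I (by simp)

/-! ### Profiles with respect to points of extended space -/

/-- The quadratic coefficient of the squared distance to a point. -/
def coefA (p : OnePoint E3) : ℝ := p.elim 0 fun _ => 1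

/-- The linear coefficient of the squared distance to a point. -/
def coefB (p : OnePoint E3) : E3 := p.elim 0 fun x => x

/-- The constant coefficient of the squared distance to a point. -/
def coefC (p : OnePoint E3) : ℝ := p.elim 1 fun x => ‖x‖ ^ 2

/-- The squared distance to a point; it is `1` for the point at infinity. -/
def sqDist (p : OnePoint E3) (x : E3) : ℝ := quadVal (coefA p) (coefB p) (coefC p) x

/-- The gradient of half the squared distance to a point. -/
def grad (p : OnePoint E3) (x : E3) : E3 := coefA p • x - coefB p

/-- The profile with respect to a point of extended space. -/
def prof (Φ : ℂ → C3) (p : OnePoint E3) : ℂ → ℝ := profile (coefA p) (coefB p) (coefC p) Φ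

lemma sqDist_infty (x : E3) : sqDist OnePoint.infty x = 1 := quadVal_zero x

lemma sqDist_coe (p x : E3) : sqDist (p : OnePoint E3) x = ‖x - p‖ ^ 2 := by
  have := quadVal_one p 0 x
  rwa [add_zero, add_zero] at this

lemma grad_coe (p x : E3) : grad (p : OnePoint E3) x = x - p := by
  change (1 : ℝ) • x - p = x - p
  rw [one_smul]

lemma grad_infty (x : E3) : grad OnePoint.infty x = 0 := by
  change (0 : ℝ) • x - 0 = 0
  simp

lemma sqDist_nonneg (p : OnePoint E3) (x : E3) : 0 ≤ sqDist p x := by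
  induction p using OnePoint.rec with
  | infty => rw [sqDist_infty]; norm_num
  | coe q => rw [sqDist_coe]; positivity

lemma sqDist_pos {p : OnePoint E3} {x : E3} (h : (x : OnePoint E3) ≠ p) : 0 < sqDist p x := by
  induction p using OnePoint.rec with
  | infty => rw [sqDist_infty]; norm_num
  | coe q =>
    rw [sqDist_coe]
    have : x - q ≠ 0 := sub_ne_zero.2 fun h' => h (by rw [h'])
    positivity

lemma coef_disc (p : OnePoint E3) : ‖coefB p‖ ^ 2 = coefA p * coefC p := by
  induction p using OnePoint.rec with
  | infty => simp [coefA, coefB, coefC]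
  | coe q => simp [coefA, coefB, coefC]

lemma norm_sq_grad (p : OnePoint E3) (x : E3) : ‖grad p x‖ ^ 2 = coefA p * sqDist p x := by
  rw [grad, norm_sq_gradient _ _ (coefC p), coef_disc, sub_self, add_zero, sqDist]

lemma coefA_eq_one_or (p : OnePoint E3) : coefA p = 1 ∨ ∀ x, grad p x = 0 := by
  induction p using OnePoint.rec with
  | infty => exact Or.inr grad_infty
  | coe q => exact Or.inl rfl

lemma prof_nonneg (Φ : ℂ → C3) (p : OnePoint E3) (z : ℂ) : 0 ≤ prof Φ p z := Real.sqrt_nonneg _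

/-- The critical equation is the circle equation divided by the squared distance to `p`. At `∞` the
gradient is zero and both reduce to the vanishing of the parameter. -/
lemma mem_contactCircle_iff {Φ : ℂ → C3} {ζ : ℂ} {p : OnePoint E3}
    (hp : (reV (Φ ζ) : OnePoint E3) ≠ p) :
    p ∈ contactCircle (reV (Φ ζ)) (deriv Φ ζ) (contactParam Φ ζ) ↔
      critForm (coefA p) (coefB p) (coefC p) Φ ζ = 0 := by
  have h1 : critForm (coefA p) (coefB p) (coefC p) Φ ζ =
      pair (grad p (reV (Φ ζ))) (deriv Φ ζ) / (sqDist p (reV (Φ ζ)) : ℝ) + contactParam Φ ζ := rfl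
  rw [h1]
  induction p using OnePoint.rec with
  | infty =>
    rw [infty_mem_contactCircle, grad_infty]
    simp [pair]
  | coe q =>
    have hne : ((sqDist (q : OnePoint E3) (reV (Φ ζ)) : ℝ) : ℂ) ≠ 0 := by
      exact_mod_cast (sqDist_pos hp).ne'
    rw [coe_mem_contactCircle, norm_sub_rev, ← sqDist_coe, grad_coe]
    have h2 : pair (q - reV (Φ ζ)) (deriv Φ ζ) = -pair (reV (Φ ζ) - q) (deriv Φ ζ) := by
      simp [pair]; ring
    rw [h2]
    constructor
    · intro h
      field_simp
      linear_combination -h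
    · intro h
      field_simp at h
      linear_combination -h

namespace IsNehariCurve

variable {Φ : ℂ → C3} (hΦ : IsNehariCurve Φ) {ζ u : ℂ} {p : OnePoint E3}

include hΦ

lemma convexOn_prof (hζ : ζ ∈ disk) (hu : ‖u‖ = 1) (p : OnePoint E3) :
    ConvexOn ℝ univ fun s => prof Φ p (geo ζ u s) := by
  induction p using OnePoint.rec with
  | infty =>
    exact hΦ.convexOn_profile hζ hu (coef_disc _).le fun s =>
      sqDist_pos (OnePoint.coe_ne_infty _)
  | coe q => exact hΦ.convexOn_profile_dist hζ hu q

lemma prof_pos {z : ℂ} (hz : z ∈ disk) (hp : (reV (Φ z) : OnePoint E3) ≠ p) : 0 < prof Φ p z := by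
  apply Real.sqrt_pos.2
  have h1 : 0 < ‖reV (deriv Φ z)‖ := norm_pos_iff.2 (reV_ne_zero (hΦ.null z hz) (hΦ.ne_zero z hz))
  exact div_pos (sqDist_pos hp) (mul_pos (one_sub_norm_sq_pos hz) h1)

lemma hasDerivAt_prof (hζ : ζ ∈ disk) (hu : ‖u‖ = 1) (s : ℝ)
    (hp : (reV (Φ (geo ζ u s)) : OnePoint E3) ≠ p) :
    HasDerivAt (fun t => prof Φ p (geo ζ u t))
      (logSlope (sqDist p (reV (Φ (geo ζ u s)))) (grad p (reV (Φ (geo ζ u s))))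
        (reV (crv Φ ζ u s)) (reV (crv₁ Φ ζ u s)) * prof Φ p (geo ζ u s)) s :=
  hΦ.hasDerivAt_profile hζ hu s (sqDist_pos hp)

/-- Points of the contact circle are those whose profile is critical. -/
lemma mem_contactCircle_iff_hasDerivAt (hζ : ζ ∈ disk) (hp : (reV (Φ ζ) : OnePoint E3) ≠ p) :
    p ∈ contactCircle (reV (Φ ζ)) (deriv Φ ζ) (contactParam Φ ζ) ↔
      ∀ u : ℂ, ‖u‖ = 1 → HasDerivAt (fun t => prof Φ p (geo ζ u t)) 0 0 := by
  have hk : ((1 - ‖ζ‖ ^ 2 : ℝ) : ℂ) ≠ 0 := by exact_mod_cast (one_sub_norm_sq_pos hζ).ne'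
  have hd : ∀ u : ℂ, ‖u‖ = 1 → HasDerivAt (fun t => prof Φ p (geo ζ u t))
      ((u * ((1 - ‖ζ‖ ^ 2 : ℝ) * critForm (coefA p) (coefB p) (coefC p) Φ ζ)).re * prof Φ p ζ)
      0 := by
    intro u hu
    have := hΦ.hasDerivAt_prof hζ hu 0 (by rwa [geo_zero])
    rw [← hΦ.logSlope_zero hζ hu]
    convert this using 1
    exact congrArg _ (congrArg (prof Φ p) geo_zero.symm)
  rw [mem_contactCircle_iff hp]
  constructor
  · intro h u hu
    have := hd u hu
    rw [h] at this
    simpa using this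
  · intro h
    have h1 : ((1 - ‖ζ‖ ^ 2 : ℝ) : ℂ) * critForm (coefA p) (coefB p) (coefC p) Φ ζ = 0 := by
      apply eq_zero_of_forall_re_mul
      intro u hu
      have h2 := (hd u hu).unique (h u hu)
      exact (mul_eq_zero.1 h2).resolve_right (hΦ.prof_pos hζ hp).ne'
    exact (mul_eq_zero.1 h1).resolve_left hk

end IsNehariCurve


/-! ### Geodesics through given points -/

section geodesics

variable {ζ ξ u : ℂ}

lemma one_add_conj_mul_ne_zero (hζ : ζ ∈ disk) {w : ℂ} (hw : ‖w‖ ≤ 1) :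
    1 + starRingEnd ℂ ζ * w ≠ 0 := by
  have h1 : ‖ζ‖ < 1 := by simpa using hζ
  intro h
  have h2 := congrArg norm (eq_neg_of_add_eq_zero_left h)
  rw [norm_one, norm_neg, norm_mul, RCLike.norm_conj] at h2
  nlinarith [norm_nonneg ζ, norm_nonneg w]

lemma one_sub_conj_mul_ne_zero (hζ : ζ ∈ disk) {w : ℂ} (hw : ‖w‖ ≤ 1) :
    1 - starRingEnd ℂ ζ * w ≠ 0 := by
  have := one_add_conj_mul_ne_zero hζ (w := -w) (by rwa [norm_neg])
  rwa [mul_neg, ← sub_eq_add_neg] at this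

lemma mobius_norm_sq (ζ w : ℂ) : ‖1 - starRingEnd ℂ ζ * w‖ ^ 2 - ‖w - ζ‖ ^ 2 =
    (1 - ‖ζ‖ ^ 2) * (1 - ‖w‖ ^ 2) := by
  have : ((‖1 - starRingEnd ℂ ζ * w‖ ^ 2 - ‖w - ζ‖ ^ 2 : ℝ) : ℂ) =
      ((1 - ‖ζ‖ ^ 2) * (1 - ‖w‖ ^ 2) : ℝ) := by
    push_cast
    simp only [← Complex.mul_conj', map_sub, map_mul, map_one, Complex.conj_conj]
    ring
  exact_mod_cast this

lemma mobius_add_mobius (hζ : ζ ∈ disk) {w : ℂ} (hw : ‖w‖ ≤ 1) :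
    (ζ + (w - ζ) / (1 - starRingEnd ℂ ζ * w)) /
      (1 + starRingEnd ℂ ζ * ((w - ζ) / (1 - starRingEnd ℂ ζ * w))) = w := by
  have h1 := one_sub_conj_mul_ne_zero hζ hw
  have h1' : 1 - w * starRingEnd ℂ ζ ≠ 0 := by rwa [mul_comm w]
  have h2 : (1 - ζ * starRingEnd ℂ ζ) ≠ 0 := by
    rw [Complex.mul_conj']
    exact_mod_cast (one_sub_norm_sq_pos hζ).ne'
  have h3 : 1 + starRingEnd ℂ ζ * ((w - ζ) / (1 - starRingEnd ℂ ζ * w)) =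
      (1 - ζ * starRingEnd ℂ ζ) / (1 - starRingEnd ℂ ζ * w) := by field_simp; ring
  have h4 : ζ + (w - ζ) / (1 - starRingEnd ℂ ζ * w) =
      w * (1 - ζ * starRingEnd ℂ ζ) / (1 - starRingEnd ℂ ζ * w) := by field_simp; ring
  rw [h3, h4]
  field_simp

lemma exists_geo_eq (hζ : ζ ∈ disk) (hξ : ξ ∈ disk) (hne : ζ ≠ ξ) :
    ∃ u : ℂ, ‖u‖ = 1 ∧ ∃ s : ℝ, 0 < s ∧ geo ζ u s = ξ := by
  have hx1 : ‖ξ‖ < 1 := by simpa using hξ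
  have hD := one_sub_conj_mul_ne_zero hζ hx1.le
  -- The disk automorphism taking `ζ` to `0` turns geodesics from `ζ` into radii. The direction is
  -- the argument of `w` and the time is `artanh ‖w‖`.
  set w := (ξ - ζ) / (1 - starRingEnd ℂ ζ * ξ) with hw
  have hw0 : w ≠ 0 := div_ne_zero (sub_ne_zero.2 hne.symm) hD
  have hn0 : 0 < ‖w‖ := norm_pos_iff.2 hw0
  have hn1 : ‖w‖ < 1 := by
    rw [hw, norm_div, div_lt_one (norm_pos_iff.2 hD)]
    have := mobius_norm_sq ζ ξ
    have h2 := mul_pos (one_sub_norm_sq_pos hζ) (one_sub_norm_sq_pos hξ)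
    exact lt_of_pow_lt_pow_left₀ 2 (norm_nonneg _) (by linarith)
  have hu : ‖w / (‖w‖ : ℂ)‖ = 1 := by
    rw [norm_div, Complex.norm_real, norm_norm, div_self hn0.ne']
  refine ⟨w / (‖w‖ : ℂ), hu, Real.artanh ‖w‖, Real.artanh_pos ⟨hn0, hn1⟩, ?_⟩
  have hnc : (‖w‖ : ℂ) ≠ 0 := by exact_mod_cast hn0.ne'
  rw [geo_eq_tanh hζ hu, Real.tanh_artanh ⟨by linarith, hn1⟩, mul_assoc, div_mul_cancel₀ _ hnc, hw,
    mobius_add_mobius hζ hx1.le]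

/-- The forward end point of a geodesic. -/
def geoEnd (ζ u : ℂ) : ℂ := (ζ + u) / (1 + starRingEnd ℂ ζ * u)

lemma exists_geoEnd_eq (hζ : ζ ∈ disk) (hξ : ‖ξ‖ = 1) : ∃ u : ℂ, ‖u‖ = 1 ∧ geoEnd ζ u = ξ := by
  have hD := one_sub_conj_mul_ne_zero hζ hξ.le
  refine ⟨(ξ - ζ) / (1 - starRingEnd ℂ ζ * ξ), ?_, mobius_add_mobius hζ hξ.le⟩
  rw [norm_div, div_eq_one_iff_eq (norm_ne_zero_iff.2 hD)]
  have := mobius_norm_sq ζ ξ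
  rw [hξ] at this
  exact (sq_eq_sq₀ (norm_nonneg _) (norm_nonneg _)).1 (by linarith)

lemma norm_geoEnd (hζ : ζ ∈ disk) (hu : ‖u‖ = 1) : ‖geoEnd ζ u‖ = 1 := by
  have hD := one_add_conj_mul_ne_zero hζ hu.le
  rw [geoEnd, norm_div, div_eq_one_iff_eq (norm_ne_zero_iff.2 hD)]
  have := mobius_norm_sq (-ζ) u
  rw [hu, map_neg, neg_mul, sub_neg_eq_add, sub_neg_eq_add, add_comm u] at this
  exact (sq_eq_sq₀ (norm_nonneg _) (norm_nonneg _)).1 (by linarith)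

lemma geoEnd_ne (hζ : ζ ∈ disk) (hu : ‖u‖ = 1) : geoEnd ζ (-u) ≠ geoEnd ζ u := by
  have h1 := one_add_conj_mul_ne_zero hζ hu.le
  have h2 := one_add_conj_mul_ne_zero hζ (w := -u) (by rw [norm_neg, hu])
  intro h
  rw [geoEnd, geoEnd, div_eq_div_iff h2 h1] at h
  have h3 : u * (1 - ζ * starRingEnd ℂ ζ) = 0 := by linear_combination -h / 2
  rcases mul_eq_zero.1 h3 with h4 | h4
  · rw [h4] at hu; simp at hu
  · rw [Complex.mul_conj'] at h4
    exact (one_sub_norm_sq_pos hζ).ne' (by exact_mod_cast h4)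

lemma tendsto_tanh_atTop : Tendsto Real.tanh atTop (𝓝 1) := by
  have h1 : ∀ s, Real.tanh s = 1 - 2 * Real.exp (-(2 * s)) / (1 + Real.exp (-(2 * s))) := by
    intro s
    have h2 : Real.exp (-(2 * s)) = Real.exp (-s) * Real.exp (-s) := by
      rw [← Real.exp_add]; congr 1; ring
    have h3 : Real.exp s * Real.exp (-s) = 1 := by rw [← Real.exp_add]; simp
    have h4 := Real.exp_pos s
    have h5 := Real.exp_pos (-s)
    rw [Real.tanh_eq_sinh_div_cosh, Real.sinh_eq, Real.cosh_eq, h2]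
    field_simp
    linear_combination (2 * Real.exp (-s)) * h3
  have h2 : Tendsto (fun s : ℝ => Real.exp (-(2 * s))) atTop (𝓝 0) :=
    Real.tendsto_exp_neg_atTop_nhds_zero.comp (tendsto_id.const_mul_atTop two_pos)
  have h3 := (h2.const_mul 2).div (h2.const_add 1) (by norm_num)
  have h4 := h3.const_sub 1
  simp only [mul_zero, zero_div, sub_zero] at h4
  exact h4.congr fun s => (h1 s).symm

lemma tendsto_geo_atTop (hζ : ζ ∈ disk) (hu : ‖u‖ = 1) :
    Tendsto (geo ζ u) atTop (𝓝[disk] (geoEnd ζ u)) := by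
  refine tendsto_nhdsWithin_iff.2 ⟨?_, Eventually.of_forall fun s => geo_mem_disk hζ hu s⟩
  have h1 : Tendsto (fun s => ((Real.tanh s : ℝ) : ℂ)) atTop (𝓝 ((1 : ℝ) : ℂ)) :=
    (Complex.continuous_ofReal.tendsto 1).comp tendsto_tanh_atTop
  have h2 := ((h1.const_mul u).const_add ζ).div
    ((h1.const_mul (starRingEnd ℂ ζ * u)).const_add 1)
    (by simpa using one_add_conj_mul_ne_zero hζ hu.le)
  simp only [Complex.ofReal_one, mul_one] at h2
  exact h2.congr fun s => (geo_eq_tanh hζ hu s).symm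

lemma geo_neg (ζ u : ℂ) (s : ℝ) : geo ζ u (-s) = geo ζ (-u) s := by
  simp only [geo, geoDen, Real.cosh_neg, Real.sinh_neg]
  push_cast
  ring_nf

lemma tendsto_geo_atBot (hζ : ζ ∈ disk) (hu : ‖u‖ = 1) :
    Tendsto (geo ζ u) atBot (𝓝[disk] (geoEnd ζ (-u))) := by
  have := (tendsto_geo_atTop hζ (u := -u) (by rwa [norm_neg])).comp tendsto_neg_atBot_atTop
  refine this.congr fun s => ?_
  rw [Function.comp_apply, ← geo_neg, neg_neg]

end geodesics

/-! ### Sending a point to infinity -/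

/-- Inversion around `p`, or the identity if `p` is infinite. -/
def sendAway (p : OnePoint E3) (x : E3) : E3 := p.elim x fun q => inv0 (x - q)

/-- The velocity of an inverted curve. -/
def sendAwayVel (A : ℝ) (R U : E3) : E3 := A⁻¹ • U - (2 * inner ℝ R U / A ^ 2) • R

lemma hasDerivAt_sendAway {p : OnePoint E3} {γ : ℝ → E3} {v : E3} {s : ℝ} (h : HasDerivAt γ v s)
    (hp : (γ s : OnePoint E3) ≠ p) :
    HasDerivAt (fun t => sendAway p (γ t))
      (sendAwayVel (sqDist p (γ s)) (grad p (γ s)) v) s := by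
  induction p using OnePoint.rec with
  | infty => simpa [sendAway, sendAwayVel, sqDist_infty, grad_infty] using h
  | coe q =>
    have hne := (sqDist_pos hp).ne'
    rw [sqDist_coe] at *
    have h1 := h.sub_const q
    refine ((((hasDerivAt_norm_sq (U₁ := fun _ => v) h1).inv hne)).smul h1).congr_deriv ?_
    rw [sendAwayVel, grad_coe]
    simp only [Pi.inv_apply, neg_div, neg_smul, sub_eq_add_neg]

/-- An inversion is conformal with factor `1 / sqDist`. Along a unit speed geodesic the square of
the profile is therefore the reciprocal of the speed of the inverted curve. -/
lemma norm_sendAwayVel {p : OnePoint E3} {x v : E3} (hp : (x : OnePoint E3) ≠ p) :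
    ‖sendAwayVel (sqDist p x) (grad p x) v‖ = ‖v‖ / sqDist p x := by
  have hA := sqDist_pos hp
  rw [← sq_eq_sq₀ (norm_nonneg _) (by positivity), sendAwayVel, norm_sub_sq_real, norm_smul,
    norm_smul, mul_pow, mul_pow, norm_sq_grad, inner_smul_left, inner_smul_right, Real.norm_eq_abs,
    Real.norm_eq_abs, sq_abs, sq_abs, real_inner_comm v, real_inner_comm]
  simp only [conj_trivial]
  rcases coefA_eq_one_or p with h | h
  · rw [h]; field_simp; ring
  · rw [h x, inner_zero_left]; field_simp; ring

/-- The two vanishing conditions are those of constant speed and of zero normal acceleration of the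
inverted curve. -/
lemma hasDerivAt_sendAwayVel {p : OnePoint E3} {γ U U₁ : ℝ → E3} {s : ℝ}
    (h : HasDerivAt γ (U s) s) (h1 : HasDerivAt U (U₁ s) s) (hp : (γ s : OnePoint E3) ≠ p)
    (hU : U s ≠ 0)
    (hs : logSlope (sqDist p (γ s)) (grad p (γ s)) (U s) (U₁ s) = 0)
    (hb : bending (sqDist p (γ s)) (grad p (γ s)) (U s) (U₁ s) = 0) :
    HasDerivAt (fun t => sendAwayVel (sqDist p (γ t)) (grad p (γ t)) (U t)) 0 s := by
  have hA := (sqDist_pos hp).ne'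
  have hn : ‖U s‖ ^ 2 ≠ 0 := by positivity
  have hQ : HasDerivAt (fun t => sqDist p (γ t)) (2 * inner ℝ (grad p (γ s)) (U s)) s :=
    hasDerivAt_quadVal h
  have hR : HasDerivAt (fun t => grad p (γ t)) (coefA p • U s) s :=
    (h.const_smul (coefA p)).sub_const _
  have hd := ((hQ.inv hA).smul h1).sub (((((hR.inner ℝ h1).const_mul 2).div (hQ.pow 2)
    (pow_ne_zero 2 hA))).smul hR)
  refine hd.congr_deriv ?_
  simp only [Pi.inv_apply, Pi.div_apply, Pi.pow_apply]
  have hG := norm_sq_grad p (γ s)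
  have hcase : coefA p = 1 ∨ grad p (γ s) = 0 := (coefA_eq_one_or p).imp id fun h => h _
  generalize sqDist p (γ s) = A at *
  generalize grad p (γ s) = R at *
  rw [logSlope, sub_eq_zero] at hs
  -- The slope condition makes the two coefficients of `U` in the bending equal, and the equation
  -- then determines the acceleration.
  have hU₁ : U₁ s = (4 * inner ℝ R (U s) / A) • U s - (2 * ‖U s‖ ^ 2 / A) • R := by
    rw [bending, ← hs] at hb
    have : U₁ s = (2 : ℝ) • ((1 / 2 : ℝ) • U₁ s + (‖U s‖ ^ 2 / A) • R -
        (inner ℝ R (U s) / A + inner ℝ R (U s) / A) • U s) +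
        ((4 * inner ℝ R (U s) / A) • U s - (2 * ‖U s‖ ^ 2 / A) • R) := by
      module
    rw [this, hb, smul_zero, zero_add]
  rw [hU₁, inner_smul_left, inner_sub_right, inner_smul_right, inner_smul_right,
    real_inner_self_eq_norm_sq, real_inner_self_eq_norm_sq, hG]
  simp only [conj_trivial]
  rcases hcase with hc | hc
  · rw [hc]
    match_scalars <;> field_simp <;> ring
  · rw [hc, inner_zero_left]
    simp

lemma tendsto_coe_iff_sendAway {ι : Type*} {l : Filter ι} {x : ι → E3} {p : OnePoint E3}
    (hp : ∀ᶠ i in l, (x i : OnePoint E3) ≠ p) :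
    Tendsto (fun i => (x i : OnePoint E3)) l (𝓝 p) ↔
      Tendsto (fun i => ‖sendAway p (x i)‖) l atTop := by
  induction p using OnePoint.rec with
  | infty =>
    have h1 : Tendsto (fun i => (x i : OnePoint E3)) l (𝓝 OnePoint.infty) ↔
        Tendsto x l (coclosedCompact E3) := by
      rw [← OnePoint.comap_coe_nhds_infty, tendsto_comap_iff]; rfl
    rw [h1, coclosedCompact_eq_cocompact, ← Metric.cobounded_eq_cocompact, ← tendsto_norm_atTop_iff_cobounded]
    rfl
  | coe q =>
    have h1 : Tendsto (fun i => (x i : OnePoint E3)) l (𝓝 (q : OnePoint E3)) ↔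
        Tendsto x l (𝓝 q) := (OnePoint.isOpenEmbedding_coe.tendsto_nhds_iff).symm
    have h2 : ∀ i, ‖sendAway (q : OnePoint E3) (x i)‖ = ‖x i - q‖⁻¹ := fun i => norm_inv0 _
    rw [h1, tendsto_iff_norm_sub_tendsto_zero]
    simp only [h2]
    constructor
    · intro h
      refine tendsto_inv_nhdsGT_zero.comp (tendsto_nhdsWithin_iff.2 ⟨h, ?_⟩)
      filter_upwards [hp] with i hi
      exact norm_pos_iff.2 (sub_ne_zero.2 fun h' => hi (by rw [h']))
    · intro h
      simpa [Function.comp_def] using tendsto_inv_atTop_zero.comp h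

/-- Curves with rapidly decreasing speed are bounded. -/
lemma norm_sub_le_of_speed_le {η η' : ℝ → E3} {a b s₀ s : ℝ} (ha : 0 < a) (hb : 0 < b)
    (hs₀ : 0 ≤ s₀) (hη : ∀ t, HasDerivAt η (η' t) t)
    (hspeed : ∀ t, s₀ ≤ t → ‖η' t‖ ≤ 1 / (b + a * t) ^ 2) (hs : s₀ ≤ s) :
    ‖η s - η s₀‖ ≤ 1 / (a * (b + a * s₀)) := by
  have hpos : ∀ t, s₀ ≤ t → 0 < b + a * t := fun t ht => by
    have := mul_nonneg ha.le (hs₀.trans ht); linarith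
  have hB : ∀ t, s₀ ≤ t → HasDerivAt
      (fun t => 1 / (a * (b + a * s₀)) - a⁻¹ * (b + a * t)⁻¹) (1 / (b + a * t) ^ 2) t := by
    intro t ht
    have h1 := (((((hasDerivAt_id t).const_mul a).const_add b).inv (hpos t ht).ne').const_mul
      a⁻¹).const_sub (1 / (a * (b + a * s₀)))
    refine h1.congr_deriv ?_
    have := (hpos t ht).ne'
    simp only [id, mul_one]
    field_simp
  have h0 := hpos s₀ le_rfl
  have key := image_norm_le_of_norm_deriv_right_le_deriv_boundary' (f := fun t => η t - η s₀)
    (f' := η') (a := s₀) (b := s)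
    (B := fun t => 1 / (a * (b + a * s₀)) - a⁻¹ * (b + a * t)⁻¹)
    (B' := fun t => 1 / (b + a * t) ^ 2)
    (fun t _ => ((hη t).sub_const _).continuousAt.continuousWithinAt)
    (fun t _ => ((hη t).sub_const _).hasDerivWithinAt)
    (by rw [sub_self, norm_zero]; apply le_of_eq; field_simp; ring)
    (fun t ht => (hB t ht.1).continuousAt.continuousWithinAt)
    (fun t ht => (hB t ht.1).hasDerivWithinAt)
    (fun t ht => hspeed t ht.1) (x := s) ⟨hs, le_rfl⟩
  have h1 : 0 < a⁻¹ * (b + a * s)⁻¹ := mul_pos (inv_pos.2 ha) (inv_pos.2 (hpos s hs))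
  exact key.trans (by linarith)


/-! ### Minima of profiles and the equality case -/

/-- The surface of a null curve, as a map into extended space. -/
def sphericalSurface (Φ : ℂ → C3) (z : ℂ) : OnePoint E3 := (reV (Φ z) : OnePoint E3)

lemma prof_sq {Φ : ℂ → C3} {p : OnePoint E3} {z : ℂ} (hz : z ∈ disk) :
    prof Φ p z ^ 2 = sqDist p (reV (Φ z)) / ((1 - ‖z‖ ^ 2) * ‖reV (deriv Φ z)‖) := by
  have := (one_sub_norm_sq_pos hz).le
  exact Real.sq_sqrt (div_nonneg (sqDist_nonneg _ _) (by positivity))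

lemma prof_eq_zero {Φ : ℂ → C3} {p : OnePoint E3} {z : ℂ} (h : sphericalSurface Φ z = p) :
    prof Φ p z = 0 := by
  have : quadVal (coefA p) (coefB p) (coefC p) (reV (Φ z)) = 0 := by
    change sqDist p (reV (Φ z)) = 0
    rw [← h, sphericalSurface, sqDist_coe]; simp
  rw [prof, profile, this, zero_div, Real.sqrt_zero]

lemma prof_coe {Φ : ℂ → C3} {q : E3} {z : ℂ} :
    prof Φ q z = ‖reV (Φ z) - q‖ * √(1 / ((1 - ‖z‖ ^ 2) * ‖reV (deriv Φ z)‖)) := by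
  have : prof Φ q z = √(sqDist (q : OnePoint E3) (reV (Φ z)) *
      (1 / ((1 - ‖z‖ ^ 2) * ‖reV (deriv Φ z)‖))) := by rw [mul_one_div]; rfl
  rw [this, sqDist_coe, Real.sqrt_mul (by positivity), Real.sqrt_sq (norm_nonneg _)]

lemma contDiff_geo {ζ u : ℂ} (hζ : ζ ∈ disk) (hu : ‖u‖ = 1) : ContDiff ℝ ω (geo ζ u) := by
  have hc : ContDiff ℝ ω fun s : ℝ => ((Real.cosh s : ℝ) : ℂ) :=
    Complex.ofRealCLM.contDiff.comp Real.contDiff_cosh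
  have hs : ContDiff ℝ ω fun s : ℝ => ((Real.sinh s : ℝ) : ℂ) :=
    Complex.ofRealCLM.contDiff.comp Real.contDiff_sinh
  have hD : ContDiff ℝ ω (geoDen ζ u) := hc.add (contDiff_const.mul hs)
  have := ((contDiff_const (c := ζ)).mul hc |>.add ((contDiff_const (c := u)).mul hs)).mul
    (hD.inv fun s => geoDen_ne_zero hζ hu s)
  have he : geo ζ u = fun s => (ζ * ((Real.cosh s : ℝ) : ℂ) + u * ((Real.sinh s : ℝ) : ℂ)) *
      (geoDen ζ u)⁻¹ s := funext fun s => by rw [geo, div_eq_mul_inv, Pi.inv_apply]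
  rw [he]
  exact this

lemma contDiff_comp_geo {ζ u : ℂ} {g : ℂ → C3} (hg : DifferentiableOn ℂ g disk) (hζ : ζ ∈ disk)
    (hu : ‖u‖ = 1) : ContDiff ℝ ω fun s => reV (g (geo ζ u s)) := by
  refine reV.contDiff.comp (contDiff_iff_contDiffAt.2 fun s => ?_)
  have h1 : AnalyticAt ℂ g (geo ζ u s) :=
    hg.analyticAt (Metric.isOpen_ball.mem_nhds (geo_mem_disk hζ hu s))
  have h2 : ContDiffAt ℝ ω g (geo ζ u s) := (h1.restrictScalars (𝕜 := ℝ)).contDiffAt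
  exact h2.comp s (contDiff_geo hζ hu).contDiffAt

namespace IsNehariCurve

variable {Φ : ℂ → C3} (hΦ : IsNehariCurve Φ) {ζ ζ₁ u : ℂ} {p : OnePoint E3}

include hΦ

/-- The profile with respect to a point of a contact circle is minimal at the base point. -/
lemma prof_le_of_mem (hζ : ζ ∈ disk) (hp : sphericalSurface Φ ζ ≠ p)
    (hmem : p ∈ contactCircle (reV (Φ ζ)) (deriv Φ ζ) (contactParam Φ ζ)) {z : ℂ} (hz : z ∈ disk) :
    prof Φ p ζ ≤ prof Φ p z := by
  rcases eq_or_ne ζ z with rfl | hne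
  · exact le_rfl
  · obtain ⟨u, hu, s, hs, rfl⟩ := exists_geo_eq hζ hz hne
    have hd := (hΦ.mem_contactCircle_iff_hasDerivAt hζ hp).1 hmem u hu
    have h1 := (hΦ.convexOn_prof hζ hu p).le_slope_of_hasDerivAt (mem_univ 0) (mem_univ s) hs hd
    rw [slope_def_field, geo_zero, sub_zero] at h1
    have h2 := mul_nonneg h1 hs.le
    rw [div_mul_cancel₀ _ hs.ne'] at h2
    linarith

lemma ne_of_mem (hζ : ζ ∈ disk) (hp : sphericalSurface Φ ζ ≠ p)
    (hmem : p ∈ contactCircle (reV (Φ ζ)) (deriv Φ ζ) (contactParam Φ ζ)) {z : ℂ} (hz : z ∈ disk) :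
    sphericalSurface Φ z ≠ p := by
  intro h
  have h1 := hΦ.prof_le_of_mem hζ hp hmem hz
  rw [prof_eq_zero h] at h1
  exact (hΦ.prof_pos hζ hp).not_ge h1

/-- The profile of a double point is nonnegative, convex, and zero at two points of a geodesic. It
vanishes between them, so the immersed surface would be constant on an arc. Boundary injectivity
plays no role here. -/
lemma sphericalSurface_injOn : InjOn (sphericalSurface Φ) disk := by
  intro ζ hζ ξ hξ h
  by_contra hne
  obtain ⟨u, hu, s, hs, rfl⟩ := exists_geo_eq hζ hξ hne
  have hzero : ∀ t ∈ Ioo 0 s, reV (Φ (geo ζ u t)) = reV (Φ ζ) := by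
    intro t ht
    have hc := (hΦ.convexOn_prof hζ hu (sphericalSurface Φ ζ)).2 (mem_univ 0) (mem_univ s)
      (show 0 ≤ 1 - t / s by rw [sub_nonneg, div_le_one hs]; exact ht.2.le)
      (show 0 ≤ t / s by have := ht.1; positivity) (by ring)
    simp only [smul_eq_mul, mul_zero, zero_add, div_mul_cancel₀ _ hs.ne', geo_zero,
      prof_eq_zero (p := sphericalSurface Φ ζ) rfl, prof_eq_zero h.symm, add_zero] at hc
    by_contra hne
    refine (hΦ.prof_pos (geo_mem_disk hζ hu t) ?_).not_ge hc
    intro h'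
    exact hne (OnePoint.coe_injective h')
  have hm : s / 2 ∈ Ioo 0 s := ⟨by linarith, by linarith⟩
  have hd := hasDerivAt_comp_reV (hΦ.hasDerivAt_geo hζ hu (s / 2))
  have he : (fun t => reV (Φ (geo ζ u t))) =ᶠ[𝓝 (s / 2)] fun _ => reV (Φ ζ) := by
    filter_upwards [Ioo_mem_nhds hm.1 hm.2] with t ht using hzero t ht
  exact hΦ.reV_crv_ne_zero hζ hu _
    (hd.unique ((hasDerivAt_const _ _).congr_of_eventuallyEq he))

/-- A profile which is constant on a segment of a geodesic is constant on the geodesic. -/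
lemma prof_eq_of_eqOn (hζ : ζ ∈ disk) (hu : ‖u‖ = 1) {c s₁ : ℝ} (hs₁ : 0 < s₁)
    (h : ∀ s ∈ Ioo 0 s₁, prof Φ p (geo ζ u s) = c) (s : ℝ) : prof Φ p (geo ζ u s) = c := by
  have hc0 : 0 ≤ c := by
    rw [← h (s₁ / 2) ⟨by linarith, by linarith⟩]; exact prof_nonneg _ _ _
  have hconf : ∀ s, 0 < (1 - ‖geo ζ u s‖ ^ 2) * ‖reV (deriv Φ (geo ζ u s))‖ := fun s =>
    mul_pos (one_sub_norm_sq_pos (geo_mem_disk hζ hu s)) (norm_pos_iff.2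
      (reV_ne_zero (hΦ.null _ (geo_mem_disk hζ hu s)) (hΦ.ne_zero _ (geo_mem_disk hζ hu s))))
  -- The fourth power of the equation "profile equals `c`", cleared of denominators: it contains
  -- only squared norms and is real analytic, so the identity theorem applies.
  let H : ℝ → ℝ := fun s => sqDist p (reV (Φ (geo ζ u s))) ^ 2 -
    c ^ 4 * ((1 - ‖geo ζ u s‖ ^ 2) ^ 2 * ‖reV (deriv Φ (geo ζ u s))‖ ^ 2)
  have hγ := contDiff_comp_geo hΦ.diff hζ hu
  have hX := contDiff_comp_geo (hΦ.diff.deriv Metric.isOpen_ball) hζ hu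
  have hg := contDiff_geo hζ hu
  have hH : ContDiff ℝ ω H := by
    have h1 : ContDiff ℝ ω fun s => sqDist p (reV (Φ (geo ζ u s))) :=
      ((contDiff_const.mul (hγ.norm_sq ℝ)).sub (contDiff_const.mul
        (contDiff_const.inner ℝ hγ))).add contDiff_const
    exact (h1.pow 2).sub (contDiff_const.mul (((contDiff_const.sub (hg.norm_sq ℝ)).pow 2).mul
      (hX.norm_sq ℝ)))
  have hHan : AnalyticOnNhd ℝ H univ := contDiff_omega_iff_analyticOnNhd.1 hH
  have hprof : ∀ s, prof Φ p (geo ζ u s) ^ 2 * ((1 - ‖geo ζ u s‖ ^ 2) *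
      ‖reV (deriv Φ (geo ζ u s))‖) = sqDist p (reV (Φ (geo ζ u s))) := fun s => by
    rw [prof_sq (geo_mem_disk hζ hu s), div_mul_cancel₀ _ (hconf s).ne']
  have hev : H =ᶠ[𝓝 (s₁ / 2)] fun _ => 0 := by
    filter_upwards [Ioo_mem_nhds (show 0 < s₁ / 2 by linarith) (show s₁ / 2 < s₁ by linarith)]
      with t ht
    simp only [H]
    rw [← hprof t, h t ht]
    ring
  have hall := hHan.eqOn_of_preconnected_of_eventuallyEq analyticOnNhd_const
    isPreconnected_univ (mem_univ _) hev (mem_univ s)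
  simp only [H] at hall
  rw [← hprof s] at hall
  have h4 : prof Φ p (geo ζ u s) ^ 4 = c ^ 4 := by
    have h5 : ((1 - ‖geo ζ u s‖ ^ 2) ^ 2 * ‖reV (deriv Φ (geo ζ u s))‖ ^ 2) ≠ 0 := by
      rw [← mul_pow]; exact pow_ne_zero 2 (hconf s).ne'
    apply mul_right_cancel₀ h5
    linear_combination hall
  exact (pow_left_inj₀ (prof_nonneg _ _ _) hc0 (by norm_num)).1 h4

/-- If a profile is constant on a geodesic, the surface tends to the reference point at both of its
ends. -/
lemma tendsto_of_prof_eq (hζ : ζ ∈ disk) (hu : ‖u‖ = 1)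
    (hp : ∀ s, sphericalSurface Φ (geo ζ u s) ≠ p) {c : ℝ}
    (h : ∀ s, prof Φ p (geo ζ u s) = c) :
    Tendsto (fun s => sphericalSurface Φ (geo ζ u s)) atTop (𝓝 p) ∧
      Tendsto (fun s => sphericalSurface Φ (geo ζ u s)) atBot (𝓝 p) := by
  have hpos : ∀ s, 0 < prof Φ p (geo ζ u s) := fun s => hΦ.prof_pos (geo_mem_disk hζ hu s) (hp s)
  have hfun : (fun t => prof Φ p (geo ζ u t)) = fun _ => c := funext h
  have hslope : ∀ s, logSlope (sqDist p (reV (Φ (geo ζ u s)))) (grad p (reV (Φ (geo ζ u s))))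
      (reV (crv Φ ζ u s)) (reV (crv₁ Φ ζ u s)) = 0 := by
    intro s
    have h1 := hΦ.hasDerivAt_prof hζ hu s (hp s)
    rw [hfun] at h1
    exact (mul_eq_zero.1 (h1.unique (hasDerivAt_const _ _))).resolve_right (hpos s).ne'
  -- A constant profile has zero second derivative, and this dominates the squared bending.
  have hbend : ∀ s, bending (sqDist p (reV (Φ (geo ζ u s)))) (grad p (reV (Φ (geo ζ u s))))
      (reV (crv Φ ζ u s)) (reV (crv₁ Φ ζ u s)) = 0 := by
    intro s
    have h1 := hΦ.hasDerivAt_profile₁ hζ hu s (sqDist_pos (hp s))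
    have h2 : (fun t => logSlope (quadVal (coefA p) (coefB p) (coefC p) (reV (Φ (geo ζ u t))))
        (coefA p • reV (Φ (geo ζ u t)) - coefB p) (reV (crv Φ ζ u t)) (reV (crv₁ Φ ζ u t)) *
          profile (coefA p) (coefB p) (coefC p) Φ (geo ζ u t)) = fun _ => (0 : ℝ) :=
      funext fun t => mul_eq_zero_of_left (hslope t) _
    rw [h2] at h1
    have h3 := (mul_eq_zero.1 (h1.unique (hasDerivAt_const _ _))).resolve_right (hpos s).ne'
    have h4 := hΦ.bending_le_convexity hζ hu (coef_disc p).le s (sqDist_pos (hp s))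
    rw [h3] at h4
    have hn : 0 < ‖reV (crv Φ ζ u s)‖ := norm_pos_iff.2 (hΦ.reV_crv_ne_zero hζ hu s)
    rw [div_le_iff₀ (by positivity), zero_mul] at h4
    have h5 := pow_eq_zero_iff (n := 2) two_ne_zero |>.1 (le_antisymm h4 (sq_nonneg _))
    exact norm_eq_zero.1 h5
  set V : ℝ → E3 := fun s => sendAwayVel (sqDist p (reV (Φ (geo ζ u s))))
    (grad p (reV (Φ (geo ζ u s)))) (reV (crv Φ ζ u s)) with hV
  have hVd : ∀ s, HasDerivAt V 0 s := fun s =>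
    hasDerivAt_sendAwayVel (γ := fun t => reV (Φ (geo ζ u t))) (U := fun t => reV (crv Φ ζ u t))
      (U₁ := fun t => reV (crv₁ Φ ζ u t))
      (hasDerivAt_comp_reV (hΦ.hasDerivAt_geo hζ hu s))
      (hasDerivAt_comp_reV (hΦ.hasDerivAt_crv hζ hu s)) (hp s) (hΦ.reV_crv_ne_zero hζ hu s)
      (hslope s) (hbend s)
  have hVc : ∀ s, V s = V 0 := fun s => is_const_of_deriv_eq_zero
    (fun t => (hVd t).differentiableAt) (fun t => (hVd t).deriv) s 0
  have hV0 : 0 < ‖V 0‖ := by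
    rw [hV]
    simp only
    rw [norm_sendAwayVel (hp 0)]
    exact div_pos (norm_pos_iff.2 (hΦ.reV_crv_ne_zero hζ hu 0)) (sqDist_pos (hp 0))
  set η : ℝ → E3 := fun s => sendAway p (reV (Φ (geo ζ u s))) with hη
  have hηd : ∀ s, HasDerivAt η (V 0) s := fun s => by
    have := hasDerivAt_sendAway (hasDerivAt_comp_reV (hΦ.hasDerivAt_geo hζ hu s)) (hp s)
    rw [← hVc s]
    exact this
  -- The inverted curve is a full line run through at constant nonzero speed; both its ends go to
  -- `∞`, the image of `p`.
  have hlin : ∀ s, η s = η 0 + s • V 0 := by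
    intro s
    have h1 : ∀ t, HasDerivAt (fun t => η t - t • V 0) 0 t := fun t => by
      have := (hηd t).sub ((hasDerivAt_id t).smul_const (V 0))
      refine this.congr_deriv ?_
      rw [one_smul, sub_self]
    have h2 := is_const_of_deriv_eq_zero (fun t => (h1 t).differentiableAt)
      (fun t => (h1 t).deriv) s 0
    simp only [zero_smul, sub_zero] at h2
    rw [← h2]; abel
  have hbound : ∀ s, |s| * ‖V 0‖ - ‖η 0‖ ≤ ‖η s‖ := by
    intro s
    have h1 : s • V 0 = η s - η 0 := by rw [hlin s]; abel
    have h2 := norm_sub_le (η s) (η 0)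
    rw [← h1, norm_smul, Real.norm_eq_abs] at h2
    linarith
  constructor
  · refine (tendsto_coe_iff_sendAway (Eventually.of_forall hp)).2
      (tendsto_atTop_mono hbound ?_)
    exact tendsto_atTop_add_const_right _ _ (tendsto_abs_atTop_atTop.atTop_mul_const hV0)
  · refine (tendsto_coe_iff_sendAway (Eventually.of_forall hp)).2
      (tendsto_atTop_mono hbound ?_)
    exact tendsto_atTop_add_const_right _ _ (tendsto_abs_atBot_atTop.atTop_mul_const hV0)

end IsNehariCurve


/-! ### Boundary values and uniqueness of the circle through a point -/

/-- The contact circle of a surface. -/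
def surfaceCircle (Φ : ℂ → C3) (ζ : ℂ) : Set (OnePoint E3) :=
  contactCircle (reV (Φ ζ)) (deriv Φ ζ) (contactParam Φ ζ)

lemma mem_surfaceCircle_self (Φ : ℂ → C3) (ζ : ℂ) : sphericalSurface Φ ζ ∈ surfaceCircle Φ ζ := by
  rw [sphericalSurface, surfaceCircle, coe_mem_contactCircle]
  simp [pair]

/-- No two boundary points of the disk have the same boundary value. -/
def BoundaryInjective (Φ : ℂ → C3) : Prop :=
  ∀ ξ₁ ξ₂ : ℂ, ‖ξ₁‖ = 1 → ‖ξ₂‖ = 1 → ∀ L, Tendsto (sphericalSurface Φ) (𝓝[disk] ξ₁) (𝓝 L) →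
    Tendsto (sphericalSurface Φ) (𝓝[disk] ξ₂) (𝓝 L) → ξ₁ = ξ₂

/-- The surface has boundary values in extended space. -/
def HasBoundaryValues (Φ : ℂ → C3) : Prop :=
  ∀ ξ : ℂ, ‖ξ‖ = 1 → ∃ L, Tendsto (sphericalSurface Φ) (𝓝[disk] ξ) (𝓝 L)

namespace IsNehariCurve

variable {Φ : ℂ → C3} (hΦ : IsNehariCurve Φ) {ζ ζ₁ ζ₂ ξ u : ℂ} {p : OnePoint E3}

include hΦ

/-- The two distinct end points of the geodesic would share the boundary value `p`. This is where
boundary injectivity enters. -/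
lemma not_prof_eqOn (hlim : HasBoundaryValues Φ) (hinj : BoundaryInjective Φ)
    (hζ : ζ ∈ disk) (hu : ‖u‖ = 1) (hp : ∀ s, sphericalSurface Φ (geo ζ u s) ≠ p)
    {c s₁ : ℝ} (hs₁ : 0 < s₁) (h : ∀ s ∈ Ioo 0 s₁, prof Φ p (geo ζ u s) = c) : False := by
  obtain ⟨h1, h2⟩ := hΦ.tendsto_of_prof_eq hζ hu hp (hΦ.prof_eq_of_eqOn hζ hu hs₁ h)
  have hu' : ‖-u‖ = 1 := by rwa [norm_neg]
  obtain ⟨L₁, hL₁⟩ := hlim (geoEnd ζ u) (norm_geoEnd hζ hu)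
  obtain ⟨L₂, hL₂⟩ := hlim (geoEnd ζ (-u)) (norm_geoEnd hζ hu')
  have e1 : L₁ = p := tendsto_nhds_unique (hL₁.comp (tendsto_geo_atTop hζ hu)) h1
  have e2 : L₂ = p := tendsto_nhds_unique (hL₂.comp (tendsto_geo_atBot hζ hu)) h2
  rw [e1] at hL₁
  rw [e2] at hL₂
  exact geoEnd_ne hζ hu (hinj _ _ (norm_geoEnd hζ hu') (norm_geoEnd hζ hu) p hL₂ hL₁)

/-- A point off the surface lies on at most one contact circle. -/
lemma eq_of_mem_of_mem (hlim : HasBoundaryValues Φ) (hinj : BoundaryInjective Φ)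
    (h₁ : ζ₁ ∈ disk) (h₂ : ζ₂ ∈ disk) (hp₁ : sphericalSurface Φ ζ₁ ≠ p)
    (hm₁ : p ∈ surfaceCircle Φ ζ₁) (hm₂ : p ∈ surfaceCircle Φ ζ₂) : ζ₁ = ζ₂ := by
  by_contra hne
  have hp₂ := hΦ.ne_of_mem h₁ hp₁ hm₁ h₂
  have heq : prof Φ p ζ₁ = prof Φ p ζ₂ :=
    le_antisymm (hΦ.prof_le_of_mem h₁ hp₁ hm₁ h₂) (hΦ.prof_le_of_mem h₂ hp₂ hm₂ h₁)
  obtain ⟨u, hu, s, hs, rfl⟩ := exists_geo_eq h₁ h₂ hne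
  -- Both base points minimize the profile, so by convexity it is constant on the segment between
  -- them.
  refine hΦ.not_prof_eqOn hlim hinj h₁ hu
    (fun t => hΦ.ne_of_mem h₁ hp₁ hm₁ (geo_mem_disk h₁ hu t)) hs (c := prof Φ p ζ₁) fun t ht => ?_
  refine le_antisymm ?_ (hΦ.prof_le_of_mem h₁ hp₁ hm₁ (geo_mem_disk h₁ hu t))
  have hc := (hΦ.convexOn_prof h₁ hu p).2 (mem_univ 0) (mem_univ s)
      (show 0 ≤ 1 - t / s by rw [sub_nonneg, div_le_one hs]; exact ht.2.le)
      (show 0 ≤ t / s by have := ht.1; positivity) (by ring)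
  simp only [smul_eq_mul, mul_zero, zero_add, div_mul_cancel₀ _ hs.ne', geo_zero, ← heq] at hc
  linarith

/-- Linear growth of a convex profile along a geodesic which starts in a critical point. -/
lemma prof_growth (hζ : ζ ∈ disk) (hu : ‖u‖ = 1) {s₁ s : ℝ} (hs₁ : 0 < s₁) (hs : s₁ ≤ s) :
    prof Φ p ζ + (prof Φ p (geo ζ u s₁) - prof Φ p ζ) / s₁ * s ≤ prof Φ p (geo ζ u s) := by
  have hs0 : 0 < s := hs₁.trans_le hs
  have hc := (hΦ.convexOn_prof hζ hu p).2 (mem_univ 0) (mem_univ s)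
      (show 0 ≤ 1 - s₁ / s by rw [sub_nonneg, div_le_one hs0]; exact hs)
      (show 0 ≤ s₁ / s by positivity) (by ring)
  simp only [smul_eq_mul, mul_zero, zero_add, div_mul_cancel₀ _ hs0.ne', geo_zero] at hc
  have h1 := mul_le_mul_of_nonneg_left hc (show 0 ≤ s / s₁ by positivity)
  have h2 : s / s₁ * ((1 - s₁ / s) * prof Φ p ζ + s₁ / s * prof Φ p (geo ζ u s)) =
      (s / s₁ - 1) * prof Φ p ζ + prof Φ p (geo ζ u s) := by
    field_simp
  rw [h2] at h1
  have h3 : (prof Φ p (geo ζ u s₁) - prof Φ p ζ) / s₁ * s =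
    s / s₁ * prof Φ p (geo ζ u s₁) - s / s₁ * prof Φ p ζ := by field_simp
  rw [h3]
  linarith

/-- Linear growth of the profile means quadratic decay of the speed of the inverted curve, so its
remaining length is finite. -/
lemma norm_sub_sendAway_le (hζ : ζ ∈ disk) (hu : ‖u‖ = 1)
    (hp : ∀ s, sphericalSurface Φ (geo ζ u s) ≠ p) {a b s₀ s : ℝ} (ha : 0 < a) (hb : 0 < b)
    (hs₀ : 0 ≤ s₀) (hgrow : ∀ t, s₀ ≤ t → b + a * t ≤ prof Φ p (geo ζ u t)) (hs : s₀ ≤ s) :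
    ‖sendAway p (reV (Φ (geo ζ u s))) - sendAway p (reV (Φ (geo ζ u s₀)))‖ ≤
      1 / (a * (b + a * s₀)) := by
  refine norm_sub_le_of_speed_le (η := fun t => sendAway p (reV (Φ (geo ζ u t)))) ha hb hs₀
    (fun t => hasDerivAt_sendAway (hasDerivAt_comp_reV (hΦ.hasDerivAt_geo hζ hu t)) (hp t))
    (fun t ht => ?_) hs
  have h0 : 0 < b + a * t := by have := mul_nonneg ha.le (hs₀.trans ht); linarith
  have h1 := hΦ.profile_geo (α := coefA p) (β := coefB p) (δ := coefC p) hζ hu t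
  have hU : 0 < ‖reV (crv Φ ζ u t)‖ := norm_pos_iff.2 (hΦ.reV_crv_ne_zero hζ hu t)
  have hA := sqDist_pos (hp t)
  have h2 : prof Φ p (geo ζ u t) ^ 2 =
      sqDist p (reV (Φ (geo ζ u t))) / ‖reV (crv Φ ζ u t)‖ := by
    rw [prof, h1]
    exact Real.sq_sqrt (div_pos hA hU).le
  rw [norm_sendAwayVel (hp t), ← one_div_div, ← h2]
  exact one_div_le_one_div_of_le (by positivity) (pow_le_pow_left₀ h0.le (hgrow t ht) 2)

/-- Boundary points of the surface do not lie on contact circles. -/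
lemma notMem_of_tendsto (hlim : HasBoundaryValues Φ) (hinj : BoundaryInjective Φ)
    (hζ : ζ ∈ disk) (hξ : ‖ξ‖ = 1) (hL : Tendsto (sphericalSurface Φ) (𝓝[disk] ξ) (𝓝 p))
    (hp : sphericalSurface Φ ζ ≠ p) : p ∉ surfaceCircle Φ ζ := by
  intro hmem
  obtain ⟨u, hu, rfl⟩ := exists_geoEnd_eq hζ hξ
  have hp' : ∀ s, sphericalSurface Φ (geo ζ u s) ≠ p := fun s =>
    hΦ.ne_of_mem hζ hp hmem (geo_mem_disk hζ hu s)
  have hmin : ∀ s, prof Φ p ζ ≤ prof Φ p (geo ζ u s) := fun s =>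
    hΦ.prof_le_of_mem hζ hp hmem (geo_mem_disk hζ hu s)
  by_cases hconst : ∀ s ∈ Ioo (0 : ℝ) 1, prof Φ p (geo ζ u s) = prof Φ p ζ
  · exact hΦ.not_prof_eqOn hlim hinj hζ hu hp' one_pos hconst
  push Not at hconst
  obtain ⟨s₁, hs₁, hne⟩ := hconst
  have hlt : prof Φ p ζ < prof Φ p (geo ζ u s₁) := lt_of_le_of_ne (hmin s₁) hne.symm
  have hb := hΦ.prof_pos hζ hp
  have ha : 0 < (prof Φ p (geo ζ u s₁) - prof Φ p ζ) / s₁ := div_pos (sub_pos.2 hlt) hs₁.1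
  have hbd := fun s (hs : s₁ ≤ s) => hΦ.norm_sub_sendAway_le hζ hu hp' ha hb hs₁.1.le
    (fun t ht => hΦ.prof_growth hζ hu hs₁.1 ht) hs
  -- Convergence to `p` would make the inverted curve unbounded, against its finite length.
  have h1 : Tendsto (fun s => sphericalSurface Φ (geo ζ u s)) atTop (𝓝 p) :=
    hL.comp (tendsto_geo_atTop hζ hu)
  have h2 := (tendsto_coe_iff_sendAway (Eventually.of_forall hp')).1 h1
  obtain ⟨s, hs1, hs2⟩ := ((h2.eventually_gt_atTop
    (1 / ((prof Φ p (geo ζ u s₁) - prof Φ p ζ) / s₁ * (prof Φ p ζ +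
      (prof Φ p (geo ζ u s₁) - prof Φ p ζ) / s₁ * s₁)) +
      ‖sendAway p (reV (Φ (geo ζ u s₁)))‖)).and (eventually_ge_atTop s₁)).exists
  have h3 := hbd s hs2
  have h4 := norm_sub_norm_le (sendAway p (reV (Φ (geo ζ u s))))
    (sendAway p (reV (Φ (geo ζ u s₁))))
  linarith

lemma continuousOn_surface : ContinuousOn (fun z => reV (Φ z)) disk :=
  reV.continuous.comp_continuousOn hΦ.diff.continuousOn

lemma continuousOn_prof (p : OnePoint E3) : ContinuousOn (prof Φ p) disk := by
  have h1 := hΦ.continuousOn_surface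
  have h2 : ContinuousOn (fun z => reV (deriv Φ z)) disk :=
    reV.continuous.comp_continuousOn (hΦ.diff.deriv Metric.isOpen_ball).continuousOn
  have h3 : ContinuousOn (fun z : ℂ => (1 - ‖z‖ ^ 2) * ‖reV (deriv Φ z)‖) disk :=
    (Continuous.continuousOn (by fun_prop)).mul h2.norm
  refine (ContinuousOn.div ?_ h3 fun z hz => ?_).sqrt
  · exact ((continuousOn_const.mul (h1.norm.pow 2)).sub
      (continuousOn_const.mul (continuousOn_const.inner h1))).add continuousOn_const
  · exact (mul_pos (one_sub_norm_sq_pos hz) (norm_pos_iff.2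
      (reV_ne_zero (hΦ.null z hz) (hΦ.ne_zero z hz)))).ne'

end IsNehariCurve

/-! ### A profile with linear growth -/

lemma norm_reV_le (Z : C3) : ‖reV Z‖ ≤ ‖Z‖ := by
  refine le_of_sq_le_sq ?_ (norm_nonneg _)
  rw [norm_sq_reV]
  linarith [Complex.re_le_norm (bil Z Z), norm_bil_self_le Z]

lemma zero_mem_disk : (0 : ℂ) ∈ disk := by simp [disk]

lemma geo_zero_left (u : ℂ) (s : ℝ) : geo 0 u s = u * Real.tanh s := by
  have hc : ((Real.cosh s : ℝ) : ℂ) ≠ 0 := by exact_mod_cast (Real.cosh_pos s).ne'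
  rw [geo, geoDen, Real.tanh_eq_sinh_div_cosh, map_zero, Complex.ofReal_div, zero_mul, zero_mul,
    zero_mul, zero_add, add_zero, mul_div_assoc]

namespace IsNehariCurve

variable {Φ : ℂ → C3} (hΦ : IsNehariCurve Φ) {ζ ζ₁ ζ₂ ξ u : ℂ} {p : OnePoint E3}

include hΦ

/-- Some profile which is critical at the origin is nondegenerate there. -/
lemma exists_bending_ne_zero : ∃ q : E3, sphericalSurface Φ 0 ≠ q ∧
    (q : OnePoint E3) ∈ surfaceCircle Φ 0 ∧ ∀ u : ℂ, ‖u‖ = 1 →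
      bending (sqDist q (reV (Φ (geo 0 u 0)))) (grad q (reV (Φ (geo 0 u 0))))
        (reV (crv Φ 0 u 0)) (reV (crv₁ Φ 0 u 0)) ≠ 0 := by
  have h0 := zero_mem_disk
  obtain ⟨R, hR⟩ := exists_frame (hΦ.null 0 h0) (hΦ.ne_zero 0 h0)
  have hl : 0 < ‖reV (deriv Φ 0)‖ := norm_pos_iff.2 (reV_ne_zero (hΦ.null 0 h0) (hΦ.ne_zero 0 h0))
  set l := ‖reV (deriv Φ 0)‖
  have hlc : (l : ℂ) ≠ 0 := by exact_mod_cast hl.ne'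
  -- The height is chosen so that `l ^ 2 * T` exceeds the normal component of the acceleration in
  -- every direction `u`.
  set T : ℝ := ‖deriv (deriv Φ) 0‖ / l ^ 2 + 1 with hT
  have hTpos : 0 < T := by positivity
  set Λ := contactParam Φ 0 with hΛ
  -- In the frame `R`, inversion about the base point turns the contact circle into the vertical
  -- line over `conj Λ / l`; `y` is its point at height `T`.
  set y : E3 := toSpace (starRingEnd ℂ Λ / l) + T • vert with hy
  have hhor : hor y = starRingEnd ℂ Λ / l := by
    rw [hy, hor_add, hor_toSpace, hor_smul]
    have : hor vert = 0 := by apply Complex.ext <;> simp [hor, vert]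
    rw [this, mul_zero, add_zero]
  have hy2 : y 2 = T := by simp [hy, toSpace, vert]
  have hy0 : y ≠ 0 := by
    intro h; rw [h] at hy2; simp at hy2; exact hTpos.ne hy2
  have hyn : ‖y‖ ^ 2 ≠ 0 := by positivity
  set F0 := reV (Φ 0) with hF0
  have hne : F0 + R (inv0 y) ≠ F0 := by
    simp [inv0_eq_zero, hy0]
  refine ⟨F0 + R (inv0 y), fun h => hne (OnePoint.coe_injective h.symm), ?_, fun u hu hb => ?_⟩
  · rw [surfaceCircle, coe_mem_contactCircle, ← hF0, ← hΛ, add_sub_cancel_left, pair_frame hR,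
      R.norm_map, norm_inv0, inv0, hor_smul, hhor]
    push_cast
    simp only [map_mul, map_inv₀, map_pow, map_div₀, Complex.conj_ofReal, Complex.conj_conj]
    field_simp
  · have hV : geoV 0 u 0 = u := by simp [geoV, geoDen]
    have hV₁ : geoV₁ 0 u 0 = 0 := by simp [geoV₁, geoDen, geoDen']
    rw [geo_zero, ← hF0, sqDist_coe, grad_coe, sub_add_cancel_left, norm_neg, R.norm_map,
      norm_inv0] at hb
    have hU : reV (crv Φ 0 u 0) = l • R (toSpace u) := by rw [crv, hV, geo_zero, hR]
    have hUn : ‖reV (crv Φ 0 u 0)‖ = l := by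
      rw [hU, norm_smul, R.norm_map, norm_toSpace, hu, mul_one, Real.norm_of_nonneg hl.le]
    have hperp : inner ℝ (reV (crv Φ 0 u 0)) (R vert) = 0 := by
      rw [hU, inner_smul_left, R.inner_map_map, inner_E3]; simp [toSpace, vert]
    have hU₁ : ‖reV (crv₁ Φ 0 u 0)‖ ≤ ‖deriv (deriv Φ) 0‖ := by
      rw [crv₁, hV, hV₁, geo_zero, zero_smul, add_zero]
      refine (norm_reV_le _).trans ?_
      rw [norm_smul, norm_pow, hu, one_pow, one_mul]
    have h1 : |inner ℝ (reV (crv₁ Φ 0 u 0)) (R vert)| ≤ ‖deriv (deriv Φ) 0‖ := by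
      refine (abs_real_inner_le_norm _ _).trans ?_
      rwa [R.norm_map, norm_vert, mul_one]
    have h2 := congrArg (fun v => inner ℝ v (R vert)) hb
    simp only [bending, inner_sub_left, inner_add_left, inner_smul_left, conj_trivial, inner_zero_left,
      hperp, mul_zero, sub_zero, hUn, inner_neg_left, R.inner_map_map] at h2
    have h3 : inner ℝ (inv0 y) vert = (‖y‖ ^ 2)⁻¹ * T := by
      rw [inv0, inner_smul_left, inner_E3, ← hy2]; simp [vert]
    rw [h3] at h2
    have h4 : l ^ 2 / ‖y‖⁻¹ ^ 2 * -((‖y‖ ^ 2)⁻¹ * T) = -(l ^ 2 * T) := by field_simp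
    rw [h4] at h2
    have h5 : l ^ 2 * T = ‖deriv (deriv Φ) 0‖ + l ^ 2 := by rw [hT]; field_simp
    have h6 := (abs_le.1 h1).2
    have h7 : 0 < l ^ 2 := by positivity
    linarith [norm_nonneg (deriv (deriv Φ) 0)]

/-- Some profile grows linearly in the hyperbolic distance from the origin. -/
lemma exists_growth : ∃ (q : E3) (a b : ℝ), 0 < a ∧ 0 < b ∧
    (∀ z ∈ disk, sphericalSurface Φ z ≠ q) ∧
    ∀ u : ℂ, ‖u‖ = 1 → ∀ s, 1 ≤ s → b + a * s ≤ prof Φ q (geo 0 u s) := by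
  have h0 := zero_mem_disk
  obtain ⟨q, hq, hmem, hbend⟩ := hΦ.exists_bending_ne_zero
  have hne : ∀ z ∈ disk, sphericalSurface Φ z ≠ q := fun z hz => hΦ.ne_of_mem h0 hq hmem hz
  have hmin : ∀ u : ℂ, ‖u‖ = 1 → ∀ s, prof Φ q 0 ≤ prof Φ q (geo 0 u s) := fun u hu s =>
    hΦ.prof_le_of_mem h0 hq hmem (geo_mem_disk h0 hu s)
  -- Equality would make the convex profile constant on a geodesic, so the bending at the origin
  -- would vanish.
  have hlt : ∀ u : ℂ, ‖u‖ = 1 → prof Φ q 0 < prof Φ q (geo 0 u 1) := by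
    intro u hu
    refine lt_of_le_of_ne (hmin u hu 1) fun heq => ?_
    have hp : ∀ s, (reV (Φ (geo 0 u s)) : OnePoint E3) ≠ q := fun s =>
      hne _ (geo_mem_disk h0 hu s)
    have hall := hΦ.prof_eq_of_eqOn (p := (q : OnePoint E3)) h0 hu (c := prof Φ q 0) one_pos
      fun s hs => by
        refine le_antisymm ?_ (hmin u hu s)
        have hc := (hΦ.convexOn_prof h0 hu q).2 (mem_univ 0) (mem_univ 1)
          (show 0 ≤ 1 - s by linarith [hs.2]) hs.1.le (by ring)
        simp only [smul_eq_mul, mul_zero, mul_one, zero_add, geo_zero, ← heq] at hc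
        linarith
    have hslope : ∀ s, logSlope (sqDist q (reV (Φ (geo 0 u s)))) (grad q (reV (Φ (geo 0 u s))))
        (reV (crv Φ 0 u s)) (reV (crv₁ Φ 0 u s)) * prof Φ q (geo 0 u s) = 0 := by
      intro s
      have h1 := hΦ.hasDerivAt_prof h0 hu s (hp s)
      rw [show (fun t => prof Φ q (geo 0 u t)) = fun _ => prof Φ q 0 from funext hall] at h1
      exact h1.unique (hasDerivAt_const _ _)
    have h1 := hΦ.hasDerivAt_profile₁ h0 hu 0 (sqDist_pos (hp 0))
    have h2 : (fun t => logSlope (quadVal (coefA q) (coefB q) (coefC q) (reV (Φ (geo 0 u t))))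
        (coefA q • reV (Φ (geo 0 u t)) - coefB q) (reV (crv Φ 0 u t)) (reV (crv₁ Φ 0 u t)) *
          profile (coefA q) (coefB q) (coefC q) Φ (geo 0 u t)) = fun _ => (0 : ℝ) := funext hslope
    rw [h2] at h1
    have h3 := (mul_eq_zero.1 (h1.unique (hasDerivAt_const _ _))).resolve_right
      (hΦ.prof_pos (geo_mem_disk h0 hu 0) (hp 0)).ne'
    have h4 := hΦ.bending_le_convexity h0 hu (coef_disc q).le 0 (sqDist_pos (hp 0))
    rw [h3] at h4
    have h5 : 0 < ‖reV (crv Φ 0 u 0)‖ := norm_pos_iff.2 (hΦ.reV_crv_ne_zero h0 hu 0)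
    rw [div_le_iff₀ (by positivity), zero_mul] at h4
    exact hbend u hu (norm_eq_zero.1
      (pow_eq_zero_iff (n := 2) two_ne_zero |>.1 (le_antisymm h4 (sq_nonneg _))))
  have hcont : ContinuousOn (fun u : ℂ => prof Φ q (geo 0 u 1)) (Metric.sphere 0 1) := by
    refine (hΦ.continuousOn_prof q).comp (Continuous.continuousOn ?_) fun u hu =>
      geo_mem_disk h0 (by simpa using hu) 1
    simp only [geo_zero_left]
    fun_prop
  -- Compactness of the directions gives a positive growth rate common to all of them.
  obtain ⟨u₀, hu₀, hmin₀⟩ := (isCompact_sphere (0 : ℂ) 1).exists_isMinOn ⟨1, by simp⟩ hcont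
  have hu₀' : ‖u₀‖ = 1 := by simpa using hu₀
  refine ⟨q, prof Φ q (geo 0 u₀ 1) - prof Φ q 0, prof Φ q 0, sub_pos.2 (hlt u₀ hu₀'),
    hΦ.prof_pos h0 hq, hne, fun u hu s hs => ?_⟩
  have h1 := hΦ.prof_growth (p := (q : OnePoint E3)) h0 hu one_pos hs
  rw [div_one] at h1
  refine le_trans ?_ h1
  have h2 : prof Φ q (geo 0 u₀ 1) ≤ prof Φ q (geo 0 u 1) := hmin₀ (by simpa using hu)
  have h3 := mul_le_mul_of_nonneg_right (sub_le_sub_right h2 (prof Φ q 0)) (zero_le_one.trans hs)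
  linarith

end IsNehariCurve


/-! ### Existence of boundary values and of circles -/

lemma inv0_continuousAt {y : E3} (hy : y ≠ 0) : ContinuousAt inv0 y := by
  have h : ‖y‖ ^ 2 ≠ 0 := by positivity
  exact ((continuousAt_id.norm.pow 2).inv₀ h).smul continuousAt_id

lemma exists_geo_zero_eq {z : ℂ} (hz : z ∈ disk) (h : z ≠ 0) :
    ‖z / (‖z‖ : ℂ)‖ = 1 ∧ geo 0 (z / (‖z‖ : ℂ)) (Real.artanh ‖z‖) = z := by
  have h1 : ‖z‖ < 1 := by simpa using hz
  have h0 : 0 < ‖z‖ := norm_pos_iff.2 h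
  have hc : (‖z‖ : ℂ) ≠ 0 := by exact_mod_cast h0.ne'
  refine ⟨by rw [norm_div, Complex.norm_real, norm_norm, div_self h0.ne'], ?_⟩
  rw [geo_zero_left, Real.tanh_artanh ⟨by linarith, h1⟩, div_mul_cancel₀ _ hc]

lemma tanh_mem_Ioo (s : ℝ) : Real.tanh s ∈ Ioo (-1 : ℝ) 1 := Real.tanh_bijOn.mapsTo (mem_univ s)

lemma le_artanh_of_tanh_le {s r : ℝ} (h : Real.tanh s ≤ r) (hr : r < 1) : s ≤ Real.artanh r := by
  rw [← Real.artanh_tanh s]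
  exact Real.artanh_le_artanh (tanh_mem_Ioo s).1 hr h

namespace IsNehariCurve

variable {Φ : ℂ → C3} (hΦ : IsNehariCurve Φ) {ζ : ℂ}

include hΦ

/-- The surface extends to the boundary by limits in extended space. -/
lemma hasBoundaryValues : HasBoundaryValues Φ := by
  intro ξ hξ
  have h0 := zero_mem_disk
  obtain ⟨q, a, b, ha, hb, hne, hgrow⟩ := hΦ.exists_growth
  have hξ0 : ξ ≠ 0 := by rintro rfl; simp at hξ
  set h : ℂ → E3 := fun z => sendAway q (reV (Φ z)) with hh
  have hcont : ContinuousOn h disk := by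
    intro z hz
    have h1 : reV (Φ z) - q ≠ 0 := sub_ne_zero.2 fun h' => hne z hz (by rw [sphericalSurface, h'])
    exact (inv0_continuousAt h1).comp_continuousWithinAt (f := fun z => reV (Φ z) - q)
      ((hΦ.continuousOn_surface z hz).sub continuousWithinAt_const)
  -- Beyond radius `tanh s₀` the inverted surface moves along every ray by at most a tail that is
  -- uniform in the direction.
  have hclose : ∀ s₀, 1 ≤ s₀ → ∀ z ∈ disk, z ≠ 0 → Real.tanh s₀ ≤ ‖z‖ →
      ‖h z - h (z / (‖z‖ : ℂ) * Real.tanh s₀)‖ ≤ 1 / (a * (b + a * s₀)) := by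
    intro s₀ hs₀ z hz hz0 hle
    obtain ⟨hu, hgeo⟩ := exists_geo_zero_eq hz hz0
    have h1 : ‖z‖ < 1 := by simpa using hz
    have := hΦ.norm_sub_sendAway_le (p := (q : OnePoint E3)) h0 hu
      (fun s => hne _ (geo_mem_disk h0 hu s)) ha hb (zero_le_one.trans hs₀)
      (fun t ht => hgrow _ hu t (hs₀.trans ht)) (le_artanh_of_tanh_le hle h1)
    rw [hgeo, geo_zero_left] at this
    exact this
  have hne_bot : (𝓝[disk] ξ).NeBot := by
    apply mem_closure_iff_nhdsWithin_neBot.1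
    rw [disk, closure_ball _ one_ne_zero]
    simp [hξ]
  -- Near `ξ`, the inverted surface is compared with its values on a fixed inner circle, where it is
  -- continuous.
  have hcauchy : Cauchy (map h (𝓝[disk] ξ)) := by
    rw [Metric.cauchy_iff]
    refine ⟨hne_bot.map h, fun ε hε => ?_⟩
    have hsmall : Tendsto (fun s : ℝ => 1 / (a * (b + a * s))) atTop (𝓝 0) :=
      tendsto_const_nhds.div_atTop ((tendsto_atTop_add_const_left _ b
        (tendsto_id.const_mul_atTop ha)).const_mul_atTop ha)
    obtain ⟨s₀, hs₁, hs₀⟩ := ((hsmall.eventually_lt_const (show 0 < ε / 4 by positivity)).and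
      (eventually_ge_atTop 1)).exists
    set r := Real.tanh s₀ with hr
    have hr1 := (tanh_mem_Ioo s₀).2
    have hrad : Tendsto (fun z : ℂ => h (z / (‖z‖ : ℂ) * r)) (𝓝[disk] ξ) (𝓝 (h (ξ * r))) := by
      have hmem : ξ * r ∈ disk := by
        have := geo_mem_disk h0 hξ s₀
        rwa [geo_zero_left] at this
      have h1 : ContinuousAt h (ξ * r) := hcont.continuousAt (Metric.isOpen_ball.mem_nhds hmem)
      have h2 : ContinuousAt (fun z : ℂ => z / (‖z‖ : ℂ) * r) ξ := by
        refine ContinuousAt.mul (ContinuousAt.div continuousAt_id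
          (Complex.continuous_ofReal.continuousAt.comp continuousAt_id.norm) ?_) continuousAt_const
        simp [hξ]
      have h3 : ξ / (‖ξ‖ : ℂ) * r = ξ * r := by rw [hξ]; simp
      have h4 : Tendsto (fun z : ℂ => z / (‖z‖ : ℂ) * r) (𝓝 ξ) (𝓝 (ξ * r)) := by
        have := h2.tendsto
        rwa [h3] at this
      exact (h1.tendsto.comp h4).mono_left nhdsWithin_le_nhds
    have hev : ∀ᶠ z in 𝓝[disk] ξ, dist (h z) (h (ξ * r)) < ε / 2 := by
      have e1 : ∀ᶠ z in 𝓝[disk] ξ, dist (h (z / (‖z‖ : ℂ) * r)) (h (ξ * r)) < ε / 4 :=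
        (tendsto_iff_dist_tendsto_zero.1 hrad).eventually_lt_const (by positivity)
      have e2 : ∀ᶠ z in 𝓝[disk] ξ, r < ‖z‖ := by
        refine nhdsWithin_le_nhds (continuous_norm.continuousAt.eventually (lt_mem_nhds ?_))
        change r < ‖ξ‖
        rwa [hξ]
      have e3 : ∀ᶠ z in 𝓝[disk] ξ, z ≠ 0 :=
        nhdsWithin_le_nhds (continuousAt_id.eventually_ne hξ0)
      filter_upwards [e1, e2, e3, self_mem_nhdsWithin] with z hz1 hz2 hz3 hz4
      have h1 := hclose s₀ hs₀ z hz4 hz3 hz2.le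
      have h2 := dist_triangle (h z) (h (z / (‖z‖ : ℂ) * r)) (h (ξ * r))
      rw [dist_eq_norm (h z) (h (z / (‖z‖ : ℂ) * r))] at h2
      linarith
    refine ⟨h '' {z | dist (h z) (h (ξ * r)) < ε / 2}, image_mem_map hev, ?_⟩
    rintro _ ⟨z, hz, rfl⟩ _ ⟨z', hz', rfl⟩
    have hz : dist (h z) (h (ξ * r)) < ε / 2 := hz
    have hz' : dist (h z') (h (ξ * r)) < ε / 2 := hz'
    have := dist_triangle_right (h z) (h z') (h (ξ * r))
    linarith
  obtain ⟨w, hw⟩ := CompleteSpace.complete hcauchy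
  have hw : Tendsto h (𝓝[disk] ξ) (𝓝 w) := hw
  have hinv : ∀ z, reV (Φ z) = q + inv0 (h z) := fun z => by
    change _ = q + inv0 (inv0 (reV (Φ z) - q))
    rw [inv0_inv0, add_sub_cancel]
  -- The limit `0` of the inverted surface corresponds to the boundary value `∞`.
  by_cases hw0 : w = 0
  · subst hw0
    refine ⟨OnePoint.infty, ?_⟩
    refine (tendsto_coe_iff_sendAway (Eventually.of_forall fun z => OnePoint.coe_ne_infty _)).2 ?_
    have h1 : Tendsto (fun z => ‖h z‖⁻¹) (𝓝[disk] ξ) atTop := by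
      refine tendsto_inv_nhdsGT_zero.comp (tendsto_nhdsWithin_iff.2 ⟨?_, ?_⟩)
      · simpa using hw.norm
      · filter_upwards [self_mem_nhdsWithin] with z hz
        refine norm_pos_iff.2 ?_
        change inv0 _ ≠ 0
        rw [Ne, inv0_eq_zero, sub_eq_zero]
        exact fun h' => hne z hz (by rw [sphericalSurface, h'])
    refine tendsto_atTop_mono (fun z => ?_) (tendsto_atTop_add_const_right _ (-‖q‖) h1)
    have h2 : sendAway OnePoint.infty (reV (Φ z)) = reV (Φ z) := rfl
    rw [h2, ← norm_inv0]
    have h3 := norm_sub_le (reV (Φ z)) q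
    have h4 : reV (Φ z) - q = inv0 (h z) := by rw [hinv z, add_sub_cancel_left]
    rw [h4] at h3
    linarith
  · refine ⟨((q + inv0 w : E3) : OnePoint E3), ?_⟩
    have h1 : Tendsto (fun z => reV (Φ z)) (𝓝[disk] ξ) (𝓝 (q + inv0 w)) :=
      (((inv0_continuousAt hw0).tendsto.comp hw).const_add q).congr fun z => (hinv z).symm
    exact (OnePoint.continuous_coe.tendsto _).comp h1

/-- A point at positive distance from the surface lies on a contact circle. -/
lemma exists_mem_surfaceCircle {q : E3} (hq : q ∉ closure ((fun z => reV (Φ z)) '' disk)) :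
    ∃ ζ ∈ disk, (q : OnePoint E3) ∈ surfaceCircle Φ ζ := by
  have h0 := zero_mem_disk
  obtain ⟨q₀, a, b, ha, hb, hne, hgrow⟩ := hΦ.exists_growth
  rw [Metric.mem_closure_iff] at hq
  push Not at hq
  obtain ⟨d, hd, hdist⟩ := hq
  have hd' : ∀ z ∈ disk, d ≤ ‖reV (Φ z) - q‖ := fun z hz => by
    rw [← dist_eq_norm, dist_comm]; exact hdist _ (mem_image_of_mem _ hz)
  have hneq : ∀ z ∈ disk, sphericalSurface Φ z ≠ q := fun z hz h => by
    have := hd' z hz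
    rw [OnePoint.coe_injective h, sub_self, norm_zero] at this
    linarith
  -- For distance at least `d` from `q`, the triangle inequality bounds the ratio of the distances
  -- to `q` and `q₀` below by `k`, so the profile of `q` inherits linear growth.
  set k := d / (d + ‖q - q₀‖) with hk
  have hkpos : 0 < k := by positivity
  have hcomp : ∀ z ∈ disk, k * prof Φ q₀ z ≤ prof Φ q z := by
    intro z hz
    rw [prof_coe, prof_coe, ← mul_assoc]
    refine mul_le_mul_of_nonneg_right ?_ (Real.sqrt_nonneg _)
    have h1 := norm_sub_le_norm_sub_add_norm_sub (reV (Φ z)) q q₀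
    have h2 := hd' z hz
    rw [hk, div_mul_eq_mul_div, div_le_iff₀ (by positivity)]
    nlinarith [norm_nonneg (q - q₀)]
  have hlarge : Tendsto (fun s : ℝ => k * (b + a * s)) atTop atTop :=
    (tendsto_atTop_add_const_left _ b (tendsto_id.const_mul_atTop ha)).const_mul_atTop hkpos
  obtain ⟨s₀, hs₁, hs₀⟩ := ((hlarge.eventually_gt_atTop (prof Φ q 0)).and
    (eventually_ge_atTop 1)).exists
  set r := Real.tanh s₀ with hr
  have hr1 := (tanh_mem_Ioo s₀).2
  have hr0 : 0 ≤ r := by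
    rw [hr, Real.tanh_eq_sinh_div_cosh]
    exact div_nonneg (Real.sinh_nonneg_iff.2 (zero_le_one.trans hs₀)) (Real.cosh_pos _).le
  have hsub : Metric.closedBall (0 : ℂ) r ⊆ disk := Metric.closedBall_subset_ball hr1
  obtain ⟨ζ, hζ, hmin⟩ := (isCompact_closedBall (0 : ℂ) r).exists_isMinOn ⟨0, by simpa using hr0⟩
    ((hΦ.continuousOn_prof q).mono hsub)
  -- Outside the closed disk of radius `r` the profile exceeds its value at the origin, so the
  -- minimum over that disk is global.
  have hglob : ∀ z ∈ disk, prof Φ q ζ ≤ prof Φ q z := by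
    intro z hz
    by_cases hzr : ‖z‖ ≤ r
    · exact hmin (by simpa using hzr)
    · push Not at hzr
      have hz0 : z ≠ 0 := by
        rintro rfl
        rw [norm_zero] at hzr
        linarith
      obtain ⟨hu, hgeo⟩ := exists_geo_zero_eq hz hz0
      have hs := le_artanh_of_tanh_le hzr.le (by simpa using hz)
      have h1 := hgrow _ hu _ (hs₀.trans hs)
      rw [hgeo] at h1
      have h2 : prof Φ q ζ ≤ prof Φ q 0 := hmin (by simpa using hr0)
      have h3 := hcomp z hz
      have h4 : k * (b + a * s₀) ≤ k * prof Φ q₀ z :=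
        mul_le_mul_of_nonneg_left
          (le_trans (by have := mul_le_mul_of_nonneg_left hs ha.le; linarith) h1) hkpos.le
      linarith
  have hζd := hsub hζ
  refine ⟨ζ, hζd, (hΦ.mem_contactCircle_iff_hasDerivAt hζd (hneq ζ hζd)).2 fun u hu => ?_⟩
  have hd1 := hΦ.hasDerivAt_prof (p := (q : OnePoint E3)) hζd hu 0
    (hneq _ (geo_mem_disk hζd hu 0))
  have hloc : IsLocalMin (fun t => prof Φ q (geo ζ u t)) 0 := by
    refine Eventually.of_forall fun t => ?_
    simp only [geo_zero]
    exact hglob _ (geo_mem_disk hζd hu t)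
  have := hloc.hasDerivAt_eq_zero hd1
  rwa [this] at hd1

end IsNehariCurve


/-! ### Wirtinger derivatives of the conformal factor -/

section conformal

variable {X : ℂ → C3} {X₁ X₂ : C3} {z : ℂ}

/-- The real linear map `δ ↦ c δ + d conj δ`. -/
def wirtingerMap (c d : ℂ) : ℂ →L[ℝ] ℂ :=
  c • (ContinuousLinearMap.id ℝ ℂ) + d • (Complex.conjCLE : ℂ →L[ℝ] ℂ)

lemma wirtingerMap_apply (c d δ : ℂ) : wirtingerMap c d δ = c * δ + d * starRingEnd ℂ δ := rfl

lemma hasFDerivAt_real {g : ℂ → C3} {g' : C3} (h : HasDerivAt g g' z) :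
    HasFDerivAt g ((ContinuousLinearMap.toSpanSingleton ℂ g').restrictScalars ℝ) z :=
  h.hasFDerivAt.restrictScalars ℝ

/-- The Hermitian product is linear in its second argument and conjugate linear in its first; for
holomorphic arguments these give the `δ` part and the `conj δ` part. -/
lemma hasFDerivAt_inner {g k : ℂ → C3} {g' k' : C3} (hg : HasDerivAt g g' z)
    (hk : HasDerivAt k k' z) :
    HasFDerivAt (fun w => inner ℂ (g w) (k w))
      (wirtingerMap (inner ℂ (g z) k') (inner ℂ g' (k z))) z := by
  refine ((hasFDerivAt_real hg).inner ℂ (hasFDerivAt_real hk)).congr_fderiv ?_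
  apply ContinuousLinearMap.ext
  intro δ
  simp [wirtingerMap_apply, fderivInnerCLM_apply, inner_smul_left, inner_smul_right]
  ring

lemma hasFDerivAt_norm_sq (h : HasDerivAt X X₁ z) :
    HasFDerivAt (fun w => ‖X w‖ ^ 2)
      (2 • Complex.reCLM.comp (wirtingerMap (inner ℂ (X z) X₁) 0)) z := by
  have h1 := Complex.reCLM.hasFDerivAt.comp z (hasFDerivAt_inner h h)
  have h2 : (fun w => ‖X w‖ ^ 2) = Complex.reCLM ∘ fun w => inner ℂ (X w) (X w) := by
    funext w
    rw [Function.comp_apply, inner_self_C3, Complex.reCLM_apply, Complex.ofReal_re]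
  rw [h2]
  refine h1.congr_fderiv ?_
  have hsymm : inner ℂ X₁ (X z) = starRingEnd ℂ (inner ℂ (X z) X₁) := (inner_conj_symm _ _).symm
  apply ContinuousLinearMap.ext
  intro δ
  simp only [ContinuousLinearMap.comp_apply, wirtingerMap_apply, Complex.reCLM_apply,
    smul_apply, hsymm]
  generalize (inner ℂ (X z) X₁ : ℂ) = c
  simp
  ring

lemma hasFDerivAt_log_norm_sq (h : HasDerivAt X X₁ z) (h0 : X z ≠ 0) :
    HasFDerivAt (fun w => Real.log (‖X w‖ ^ 2 / 2) / 2)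
      (Complex.reCLM.comp (wirtingerMap (tangCoeff (X z) X₁) 0)) z := by
  have hN : ‖X z‖ ^ 2 ≠ 0 := by positivity
  have h1 := (((hasFDerivAt_norm_sq h).mul_const (1 / 2)).log (by positivity)).mul_const (1 / 2)
  have h2 : (fun w => Real.log (‖X w‖ ^ 2 / 2) / 2) =
      fun w => Real.log (‖X w‖ ^ 2 * (1 / 2)) * (1 / 2) := by
    funext w; rw [div_eq_mul_one_div, div_eq_mul_one_div (‖X w‖ ^ 2)]
  rw [h2]
  refine h1.congr_fderiv ?_
  apply ContinuousLinearMap.ext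
  intro δ
  have hdiv : (inner ℂ (X z) X₁ / ((‖X z‖ ^ 2 : ℝ) : ℂ) * δ).re =
      (inner ℂ (X z) X₁ * δ).re / ‖X z‖ ^ 2 := by
    rw [div_mul_eq_mul_div, Complex.div_ofReal_re]
  simp only [ContinuousLinearMap.comp_apply, wirtingerMap_apply, Complex.reCLM_apply,
    smul_apply, tangCoeff, zero_mul, add_zero, smul_eq_mul, nsmul_eq_mul, hdiv]
  push_cast
  field_simp

/-- For `X = Φ'` and `Y = Φ''`, `tangCoeff` is `2 ∂_z σ`. The first coefficient is then `2 ∂_zz σ`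
and the second is `Δσ / 2`, which is half of `curvDensity`. -/
lemma hasFDerivAt_tangCoeff {Y : ℂ → C3} (h : HasDerivAt X (Y z) z) (h1 : HasDerivAt Y X₂ z)
    (h0 : X z ≠ 0) :
    HasFDerivAt (fun w => tangCoeff (X w) (Y w)) (wirtingerMap
      (inner ℂ (X z) X₂ / (‖X z‖ ^ 2 : ℝ) - tangCoeff (X z) (Y z) ^ 2)
      ((‖Y z‖ ^ 2 / ‖X z‖ ^ 2 - ‖tangCoeff (X z) (Y z)‖ ^ 2 : ℝ) : ℂ)) z := by
  have hN : (inner ℂ (X z) (X z) : ℂ) ≠ 0 := inner_self_ne_zero.2 h0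
  have h2 := (hasFDerivAt_inner h h1).mul ((hasDerivAt_inv hN).comp_hasFDerivAt z (hasFDerivAt_inner h h))
  have h3 : (fun w => tangCoeff (X w) (Y w)) =
      fun w => inner ℂ (X w) (Y w) * (inner ℂ (X w) (X w))⁻¹ := by
    funext w; rw [tangCoeff, inner_self_C3, div_eq_mul_inv]
  rw [h3]
  refine h2.congr_fderiv ?_
  have hn : ((‖X z‖ ^ 2 : ℝ) : ℂ) ≠ 0 := by rwa [← inner_self_C3]
  apply ContinuousLinearMap.ext
  intro δ
  have hc : ((‖tangCoeff (X z) (Y z)‖ ^ 2 : ℝ) : ℂ) =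
      tangCoeff (X z) (Y z) * starRingEnd ℂ (tangCoeff (X z) (Y z)) := by
    rw [Complex.mul_conj']; push_cast; rfl
  rw [wirtingerMap_apply, Complex.ofReal_sub, Complex.ofReal_div, hc, tangCoeff, map_div₀,
    Complex.conj_ofReal]
  simp only [add_apply, smul_apply, wirtingerMap_apply,
    smul_eq_mul, Function.comp_apply, inner_self_C3, inner_conj_symm]
  field_simp
  ring

end conformal

lemma dz_of_hasFDerivAt {v : ℂ → ℂ} {c d : ℂ} {z : ℂ} (h : HasFDerivAt v (wirtingerMap c d) z) :
    dz v z = c := by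
  rw [dz, h.fderiv, wirtingerMap_apply, wirtingerMap_apply]
  simp only [map_one, Complex.conj_I]
  linear_combination (-c / 2 + d / 2) * Complex.I_mul_I

/-! ### The null curve of a lift -/

/-- The first direction of the null curve. -/
def dirH : C3 := !₂[1, -Complex.I, 0]

/-- The second direction of the null curve. -/
def dirG : C3 := !₂[1, Complex.I, 0]

/-- The third direction of the null curve. -/
def dirP : C3 := !₂[0, 0, -2 * Complex.I]

/-- The null curve whose real part is the lift. -/
def nullCurve (h g P : ℂ → ℂ) (z : ℂ) : C3 := h z • dirH + g z • dirG + P z • dirP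

lemma reV_comb (a b c : ℂ) : reV (a • dirH + b • dirG + c • dirP) =
    !₂[(a + starRingEnd ℂ b).re, (a + starRingEnd ℂ b).im, 2 * c.im] := by
  ext i; fin_cases i <;> simp [reV_apply, dirH, dirG, dirP]
  ring

lemma bil_comb (a b c : ℂ) : bil (a • dirH + b • dirG + c • dirP) (a • dirH + b • dirG + c • dirP) =
    4 * (a * b - c ^ 2) := by
  simp [bil, dirH, dirG, dirP]
  linear_combination (a ^ 2 + b ^ 2 - 2 * a * b + 4 * c ^ 2) * Complex.I_sq

lemma norm_sq_comb (a b c : ℂ) : ‖a • dirH + b • dirG + c • dirP‖ ^ 2 =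
    2 * ‖a‖ ^ 2 + 2 * ‖b‖ ^ 2 + 4 * ‖c‖ ^ 2 := by
  rw [norm_sq_C3]
  simp [dirH, dirG, dirP, Complex.normSq_apply, ← Complex.normSq_eq_norm_sq]
  ring

/-- The third coordinate completes the square, which is why the conformal factor is `|h'| + |g'|`.
-/
lemma norm_sq_comb_of_sq_eq {a b c : ℂ} (h : c ^ 2 = a * b) :
    ‖a • dirH + b • dirG + c • dirP‖ ^ 2 = 2 * (‖a‖ + ‖b‖) ^ 2 := by
  have h1 := congrArg norm h
  rw [norm_pow, norm_mul] at h1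
  rw [norm_sq_comb, h1]
  ring

section lift

variable {h g P : ℂ → ℂ}

lemma hasDerivAt_nullCurve {h' g' P' z : ℂ} (h₁ : HasDerivAt h h' z) (h₂ : HasDerivAt g g' z)
    (h₃ : HasDerivAt P P' z) :
    HasDerivAt (nullCurve h g P) (h' • dirH + g' • dirG + P' • dirP) z :=
  ((h₁.smul_const _).add (h₂.smul_const _)).add (h₃.smul_const _)

lemma isNehariCurve_nullCurve {ρ : ℝ} (hρ : ρ ≤ 1) (hh : DifferentiableOn ℂ h disk)
    (hg : DifferentiableOn ℂ g disk) (hne : ∀ z ∈ disk, ‖deriv h z‖ + ‖deriv g z‖ ≠ 0)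
    (hP : DifferentiableOn ℂ P disk) (hsq : ∀ z ∈ disk, deriv P z ^ 2 = deriv h z * deriv g z)
    (hAW : AhlforsWeillCondition ρ h g) : IsNehariCurve (nullCurve h g P) := by
  have hd : ∀ {k : ℂ → ℂ}, DifferentiableOn ℂ k disk → ∀ z ∈ disk, HasDerivAt k (deriv k z) z :=
    fun hk z hz => (hk.differentiableAt (Metric.isOpen_ball.mem_nhds hz)).hasDerivAt
  set Φ := nullCurve h g P with hΦ
  have hX : ∀ z ∈ disk, deriv Φ z = deriv h z • dirH + deriv g z • dirG + deriv P z • dirP :=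
    fun z hz => (hasDerivAt_nullCurve (hd hh z hz) (hd hg z hz) (hd hP z hz)).deriv
  have hdiff : DifferentiableOn ℂ Φ disk := fun z hz =>
    (hasDerivAt_nullCurve (hd hh z hz) (hd hg z hz)
      (hd hP z hz)).differentiableAt.differentiableWithinAt
  have hnorm : ∀ z ∈ disk, ‖deriv Φ z‖ ^ 2 = 2 * (‖deriv h z‖ + ‖deriv g z‖) ^ 2 := fun z hz => by
    rw [hX z hz, norm_sq_comb_of_sq_eq (hsq z hz)]
  have hX0 : ∀ z ∈ disk, deriv Φ z ≠ 0 := fun z hz h0 => by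
    have := hnorm z hz
    rw [h0, norm_zero] at this
    have h1 : (‖deriv h z‖ + ‖deriv g z‖) ^ 2 = 0 := by linarith
    exact hne z hz (pow_eq_zero_iff two_ne_zero |>.1 h1)
  refine ⟨hdiff, fun z hz => ?_, hX0, fun z hz => ?_⟩
  · rw [hX z hz, bil_comb, hsq z hz]; ring
  have hdX : ∀ w ∈ disk, HasDerivAt (deriv Φ) (deriv (deriv Φ) w) w := fun w hw =>
    ((hdiff.deriv Metric.isOpen_ball).differentiableAt (Metric.isOpen_ball.mem_nhds hw)).hasDerivAt
  have hdX₁ : HasDerivAt (deriv (deriv Φ)) (deriv (deriv (deriv Φ)) z) z :=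
    (((hdiff.deriv Metric.isOpen_ball).deriv Metric.isOpen_ball).differentiableAt
      (Metric.isOpen_ball.mem_nhds hz)).hasDerivAt
  set a : ℂ → ℂ := fun w => tangCoeff (deriv Φ w) (deriv (deriv Φ) w) with ha
  have hsigma : ∀ w ∈ disk, sigma h g w = Real.log (‖deriv Φ w‖ ^ 2 / 2) / 2 := fun w hw => by
    rw [hnorm w hw, mul_div_cancel_left₀ _ two_ne_zero, Real.log_pow, sigma]
    push_cast; ring
  have hD : ∀ w ∈ disk, HasFDerivAt (sigma h g) (Complex.reCLM.comp (wirtingerMap (a w) 0)) w := by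
    intro w hw
    refine (hasFDerivAt_log_norm_sq (hdX w hw) (hX0 w hw)).congr_of_eventuallyEq ?_
    filter_upwards [Metric.isOpen_ball.mem_nhds hw] with v hv using hsigma v hv
  have hdz : ∀ w ∈ disk, dz (fun w => (sigma h g w : ℂ)) w = a w / 2 := by
    intro w hw
    apply dz_of_hasFDerivAt (d := starRingEnd ℂ (a w) / 2)
    refine (Complex.ofRealCLM.hasFDerivAt.comp w (hD w hw)).congr_fderiv ?_
    apply ContinuousLinearMap.ext
    intro δ
    simp only [ContinuousLinearMap.comp_apply, wirtingerMap_apply, Complex.reCLM_apply,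
      Complex.ofRealCLM_apply, zero_mul, add_zero, Complex.re_eq_add_conj, map_mul]
    ring
  set c : ℂ := inner ℂ (deriv Φ z) (deriv (deriv (deriv Φ)) z) / (‖deriv Φ z‖ ^ 2 : ℝ) - a z ^ 2
    with hc
  set d : ℝ := ‖deriv (deriv Φ) z‖ ^ 2 / ‖deriv Φ z‖ ^ 2 - ‖a z‖ ^ 2 with hdd
  have hDa : HasFDerivAt a (wirtingerMap c d) z :=
    hasFDerivAt_tangCoeff (hdX z hz) hdX₁ (hX0 z hz)
  have hS : schwarzian h g z =
      schw (deriv Φ z) (deriv (deriv Φ) z) (deriv (deriv (deriv Φ)) z) := by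
    have h1 : dz (dz fun w => (sigma h g w : ℂ)) z = c / 2 := by
      apply dz_of_hasFDerivAt (d := d / 2)
      have h2 : HasFDerivAt (fun w => a w / 2) (wirtingerMap (c / 2) (d / 2)) z := by
        have h3 := hDa.mul_const (1 / 2)
        rw [show (fun w => a w / 2) = fun w => a w * (1 / 2) from
          funext fun w => div_eq_mul_one_div _ _]
        refine h3.congr_fderiv ?_
        apply ContinuousLinearMap.ext
        intro δ
        simp only [smul_apply, wirtingerMap_apply, smul_eq_mul]
        ring
      refine h2.congr_of_eventuallyEq ?_
      filter_upwards [Metric.isOpen_ball.mem_nhds hz] with v hv using hdz v hv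
    rw [schwarzian, h1, hdz z hz, schw, hc]
    ring
  have hLap : Laplacian.laplacian (sigma h g) z =
      curvDensity (deriv Φ z) (deriv (deriv Φ) z) := by
    rw [InnerProductSpace.laplacian_eq_iteratedFDeriv_complexPlane]
    simp only [iteratedFDeriv_two_apply]
    -- `L` sends `c` to `δ ↦ Re (c δ)`, so the differential of `σ` is `L ∘ a`; its derivative is
    -- read off from that of `a`.
    let L : ℂ →L[ℝ] (ℂ →L[ℝ] ℝ) :=
      (ContinuousLinearMap.compL ℝ ℂ ℂ ℝ Complex.reCLM).comp (ContinuousLinearMap.mul ℝ ℂ)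
    have h1 : HasFDerivAt (fderiv ℝ (sigma h g)) (L.comp (wirtingerMap c d)) z := by
      refine (L.hasFDerivAt.comp z hDa).congr_of_eventuallyEq ?_
      filter_upwards [Metric.isOpen_ball.mem_nhds hz] with v hv
      rw [(hD v hv).fderiv]
      apply ContinuousLinearMap.ext
      intro δ
      simp [L, wirtingerMap_apply]
    rw [h1.fderiv]
    simp [L, wirtingerMap_apply]
    rw [curvDensity, hdd]
    ring
  have hb := hAW z hz
  have hk := one_sub_norm_sq_pos hz
  rw [hS, curvature, abs_neg, abs_mul, abs_of_pos (Real.exp_pos _), ← mul_assoc, ← Real.exp_add,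
    hLap] at hb
  have he : Real.exp (2 * sigma h g z + -2 * sigma h g z) = 1 := by
    rw [← Real.exp_zero]; congr 1; ring
  rw [he, one_mul] at hb
  have h2 : 2 * ρ / (1 - ‖z‖ ^ 2) ^ 2 ≤ 2 / (1 - ‖z‖ ^ 2) ^ 2 := by
    gcongr
    linarith
  linarith [le_abs_self (curvDensity (deriv Φ z) (deriv (deriv Φ) z))]

end lift


/-! ### Second order expansions -/

lemma isLittleO_taylor_two {Φ : ℂ → C3} (hΦ : DifferentiableOn ℂ Φ disk) {ζ : ℂ} (hζ : ζ ∈ disk) :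
    (fun z => Φ z - Φ ζ - ((z - ζ) • deriv Φ ζ + ((z - ζ) ^ 2 / 2) • deriv (deriv Φ) ζ))
      =o[𝓝 ζ] fun z => ‖z - ζ‖ ^ 2 := by
  have ho : IsOpen disk := Metric.isOpen_ball
  set Q : ℂ → C3 := fun z => Φ z - ((z - ζ) • deriv Φ ζ + ((z - ζ) ^ 2 / 2) • deriv (deriv Φ) ζ)
    with hQ
  have hdQ : ∀ z ∈ disk, HasDerivAt Q (deriv Φ z - deriv Φ ζ - (z - ζ) • deriv (deriv Φ) ζ) z := by
    intro z hz
    have h1 : HasDerivAt (fun z : ℂ => z - ζ) 1 z := (hasDerivAt_id z).sub_const ζ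
    refine ((hΦ.differentiableAt (ho.mem_nhds hz)).hasDerivAt.sub ((h1.smul_const _).add
      (((h1.pow 2).div_const 2).smul_const _))).congr_deriv ?_
    rw [one_smul, sub_sub]
    congr 3
    simp
  have hd1 : HasDerivAt (deriv Φ) (deriv (deriv Φ) ζ) ζ :=
    ((hΦ.deriv ho).differentiableAt (ho.mem_nhds hζ)).hasDerivAt
  have key := (convex_ball (0 : ℂ) 1).isLittleO_pow_succ (n := 1) hζ
    (fun z hz => ((hdQ z hz).hasFDerivAt.restrictScalars ℝ).hasFDerivWithinAt) ?_
  · rw [ho.nhdsWithin_eq hζ] at key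
    refine key.congr_left fun z => ?_
    simp only [hQ]
    simp
    abel
  · rw [ho.nhdsWithin_eq hζ]
    have := hasDerivAt_iff_isLittleO.1 hd1
    rw [← Asymptotics.isLittleO_norm_norm] at this ⊢
    simpa [ContinuousLinearMap.norm_toSpanSingleton] using this

/-- Uniqueness of second order expansions; applied along lines in the disk it reads off both orders
of contact. -/
lemma eq_zero_of_isLittleO {u v : E3}
    (h : (fun t : ℝ => t • u + t ^ 2 • v) =o[𝓝 0] fun t : ℝ => t ^ 2) : u = 0 ∧ v = 0 := by
  have hv0 : ∀ v : E3, ((fun t : ℝ => t ^ 2 • v) =o[𝓝 0] fun t : ℝ => t ^ 2) → v = 0 := by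
    intro v h
    by_contra hv
    have h1 := (Asymptotics.isLittleO_iff.1 h (half_pos (norm_pos_iff.2 hv))).filter_mono
      (nhdsWithin_le_nhds (s := {0}ᶜ))
    obtain ⟨t, h2, h3⟩ := (h1.and self_mem_nhdsWithin).exists
    rw [norm_smul] at h2
    have h4 : 0 < ‖t ^ 2‖ := norm_pos_iff.2 (pow_ne_zero 2 h3)
    have h5 : 0 < ‖v‖ := norm_pos_iff.2 hv
    nlinarith
  have hu : u = 0 := by
    by_contra hu
    have h1 : (fun t : ℝ => t • u) =O[𝓝 0] fun t : ℝ => t ^ 2 := by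
      have h2 : (fun t : ℝ => t ^ 2 • v) =O[𝓝 0] fun t : ℝ => t ^ 2 :=
        Asymptotics.IsBigO.of_bound ‖v‖ (Eventually.of_forall fun t => by
          rw [norm_smul, mul_comm])
      refine (h.isBigO.sub h2).congr_left fun t => ?_
      abel
    obtain ⟨c, hc, h2⟩ := h1.exists_pos
    have h3 := (h2.bound.and (Metric.ball_mem_nhds (0 : ℝ) (div_pos (norm_pos_iff.2 hu) hc)))
    have h4 := h3.filter_mono (nhdsWithin_le_nhds (s := {0}ᶜ))
    obtain ⟨t, ⟨h5, h6⟩, h7⟩ := (h4.and self_mem_nhdsWithin).exists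
    have h8 : 0 < ‖t‖ := norm_pos_iff.2 h7
    have h6 : |t| < ‖u‖ / c := by simpa using h6
    rw [lt_div_iff₀ hc] at h6
    rw [norm_smul, norm_pow, Real.norm_eq_abs] at h5
    rw [Real.norm_eq_abs] at h8
    nlinarith
  subst hu
  exact ⟨rfl, hv0 v (by simpa using h)⟩

/-! ### The tangent plane and the projection to it -/

section tangent

variable {Φ : ℂ → C3} {F : ℂ → E3} {ζ : ℂ}

lemma mem_tangentPlane (hΦ : IsNehariCurve Φ) (hF : ∀ z ∈ disk, F z = reV (Φ z)) (hζ : ζ ∈ disk)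
    (v : E3) : v ∈ tangentPlane F ζ ↔ ∃ δ : ℂ, v = reV (δ • deriv Φ ζ) := by
  have h1 := reV.hasFDerivAt.comp ζ ((hΦ.hasDerivAt hζ).hasFDerivAt.restrictScalars ℝ)
  have h2 : F =ᶠ[𝓝 ζ] reV ∘ Φ := by
    filter_upwards [Metric.isOpen_ball.mem_nhds hζ] with z hz using hF z hz
  rw [tangentPlane, (h1.congr_of_eventuallyEq h2).fderiv, LinearMap.mem_range]
  exact exists_congr fun δ => ⟨fun h => h.symm, fun h => h.symm⟩

/-- The remainder `X₁ - tangCoeff X X₁ • X` is orthogonal to `X` for both the Hermitian and the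
bilinear form, so real parts of its complex multiples are normal to the plane. -/
lemma starProjection_reV {V : Submodule ℝ E3} {X X₁ : C3} (hX : bil X X = 0)
    (h₁ : bil X X₁ = 0) (h0 : X ≠ 0) (hV : ∀ v, v ∈ V ↔ ∃ δ : ℂ, v = reV (δ • X)) (c : ℂ) :
    V.starProjection (reV (c • X₁)) = reV ((c * tangCoeff X X₁) • X) := by
  refine Submodule.eq_starProjection_of_mem_of_inner_eq_zero ((hV _).2 ⟨_, rfl⟩) fun v hv => ?_
  obtain ⟨δ, rfl⟩ := (hV v).1 hv
  have hn : ((‖X‖ ^ 2 : ℝ) : ℂ) ≠ 0 := by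
    have : ‖X‖ ^ 2 ≠ 0 := by positivity
    exact_mod_cast this
  have hz : inner ℂ X (c • X₁ - (c * tangCoeff X X₁) • X) = 0 := by
    rw [inner_sub_right, inner_smul_right, inner_smul_right, inner_self_C3, tangCoeff]
    field_simp
    ring
  rw [← map_sub, real_inner_comm, inner_reV_reV, inner_smul_left, hz, bil_smul_left,
    sub_eq_add_neg, bil_add_right, bil_smul_right, ← neg_smul, bil_smul_right, h₁, hX]
  simp

/-- The second order expansion of the tangential component of the surface. -/
lemma isLittleO_projection (hΦ : IsNehariCurve Φ) (hF : ∀ z ∈ disk, F z = reV (Φ z))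
    (hζ : ζ ∈ disk) :
    (fun z => (tangentPlane F ζ).starProjection (F z - F ζ) -
      reV (((z - ζ) + tangCoeff (deriv Φ ζ) (deriv (deriv Φ) ζ) / 2 * (z - ζ) ^ 2) • deriv Φ ζ))
      =o[𝓝 ζ] fun z => ‖z - ζ‖ ^ 2 := by
  have hV := mem_tangentPlane hΦ hF hζ
  set V := tangentPlane F ζ
  have h1 := ((V.starProjection.comp reV).isBigO_comp _ _).trans_isLittleO
    (isLittleO_taylor_two hΦ.diff hζ)
  refine h1.congr' ?_ EventuallyEq.rfl
  filter_upwards [Metric.isOpen_ball.mem_nhds hζ] with z hz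
  have hp : ∀ c : ℂ, V.starProjection (reV (c • deriv Φ ζ)) = reV (c • deriv Φ ζ) := fun c =>
    Submodule.starProjection_eq_self_iff.2 ((hV _).2 ⟨c, rfl⟩)
  rw [ContinuousLinearMap.comp_apply, map_sub reV, map_sub reV, map_add reV, map_sub, map_add, hp,
    starProjection_reV (hΦ.null ζ hζ) (hΦ.null₁ hζ) (hΦ.ne_zero ζ hζ) hV, hF z hz, hF ζ hζ, add_smul,
    map_add reV]
  congr 4
  ring

lemma tendsto_along {ψ : ℝ → ℂ} (hψ : DifferentiableAt ℝ ψ 0) :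
    (fun t => ‖ψ t - ψ 0‖ ^ 2) =O[𝓝 0] fun t : ℝ => t ^ 2 := by
  have := hψ.isBigO_sub.norm_left.pow 2
  simpa using this

lemma contact_of_isLittleO (hΦ : IsNehariCurve Φ) (hF : ∀ z ∈ disk, F z = reV (Φ z))
    (hζ : ζ ∈ disk) {m : ℂ → E3}
    (hm : (fun z => m z - (F ζ + reV (((z - ζ) + tangCoeff (deriv Φ ζ) (deriv (deriv Φ) ζ) / 2 *
      (z - ζ) ^ 2) • deriv Φ ζ))) =o[𝓝 ζ] fun z => ‖z - ζ‖ ^ 2)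
    {ψ : ℝ → ℂ} (hψ : DifferentiableAt ℝ ψ 0) (h0 : ψ 0 = ζ) :
    (fun t => (F ζ + (tangentPlane F ζ).starProjection (F (ψ t) - F ζ)) - m (ψ t))
      =o[𝓝 0] fun t : ℝ => t ^ 2 := by
  have ht : Tendsto ψ (𝓝 0) (𝓝 ζ) := h0 ▸ hψ.continuousAt
  have h1 := ((isLittleO_projection hΦ hF hζ).sub hm).comp_tendsto ht
  have h2 := tendsto_along hψ
  rw [h0] at h2
  refine (h1.trans_isBigO h2).congr_left fun t => ?_
  simp only [Function.comp_apply]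
  abel

/-- The first and second order terms of an approximation with contact along lines. -/
lemma eq_of_contact (hΦ : IsNehariCurve Φ) (hF : ∀ z ∈ disk, F z = reV (Φ z))
    (hζ : ζ ∈ disk) {m : ℂ → E3} {u v : ℂ → E3}
    (hm : (fun z => m z - (F ζ + u (z - ζ) + v (z - ζ))) =o[𝓝 ζ] fun z => ‖z - ζ‖ ^ 2)
    (hu : ∀ (t : ℝ) (δ : ℂ), u (t * δ) = t • u δ)
    (hv : ∀ (t : ℝ) (δ : ℂ), v (t * δ) = t ^ 2 • v δ)
    (hc : ∀ ψ : ℝ → ℂ, ContDiff ℝ (⊤ : ℕ∞) ψ → ψ 0 = ζ →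
      (fun t => (F ζ + (tangentPlane F ζ).starProjection (F (ψ t) - F ζ)) - m (ψ t))
        =o[𝓝 0] fun t : ℝ => t ^ 2) (δ : ℂ) :
    u δ = reV (δ • deriv Φ ζ) ∧
      v δ = reV ((tangCoeff (deriv Φ ζ) (deriv (deriv Φ) ζ) / 2 * δ ^ 2) • deriv Φ ζ) := by
  -- Straight lines suffice to determine both terms.
  set ψ : ℝ → ℂ := fun t => ζ + t * δ with hψ
  have hs : ContDiff ℝ (⊤ : ℕ∞) ψ :=
    contDiff_const.add (Complex.ofRealCLM.contDiff.mul contDiff_const)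
  have h0 : ψ 0 = ζ := by simp [hψ]
  have ht : Tendsto ψ (𝓝 0) (𝓝 ζ) := by
    have := hs.continuous.tendsto 0
    rwa [h0] at this
  have h1 := ((isLittleO_projection hΦ hF hζ).sub hm).comp_tendsto ht
  have h2 := tendsto_along (hs.differentiable (by simp)).differentiableAt
  rw [h0] at h2
  have h3 := (hc ψ hs h0).sub (h1.trans_isBigO h2)
  have h4 := eq_zero_of_isLittleO (u := reV (δ • deriv Φ ζ) - u δ)
    (v := reV ((tangCoeff (deriv Φ ζ) (deriv (deriv Φ) ζ) / 2 * δ ^ 2) • deriv Φ ζ) - v δ)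
    (h3.congr_left fun t => ?_)
  · exact ⟨(sub_eq_zero.1 h4.1).symm, (sub_eq_zero.1 h4.2).symm⟩
  · have e1 : ψ t - ζ = t * δ := by simp [hψ]
    have e2 : reV ((t * δ) • deriv Φ ζ) = t • reV (δ • deriv Φ ζ) := by
      rw [mul_smul, ← reV.map_smul, Complex.coe_smul]
    have e3 : ∀ a : ℂ, reV ((a / 2 * (t * δ) ^ 2) • deriv Φ ζ) =
        t ^ 2 • reV ((a / 2 * δ ^ 2) • deriv Φ ζ) := fun a => by
      rw [← reV.map_smul, ← Complex.coe_smul, smul_smul]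
      congr 2
      push_cast
      ring
    simp only [Function.comp_apply, e1, hu, hv, add_smul, map_add, e2, e3]
    module

end tangent

/-! ### Möbius transformations of the horizontal plane -/

lemma inv0_toSpace (z : ℂ) : inv0 (toSpace z) = toSpace (starRingEnd ℂ z⁻¹) := by
  rw [inv0, norm_toSpace, ← toSpace_smul]
  congr 1
  rw [Complex.inv_def, map_mul, Complex.conj_conj, Complex.conj_ofReal, Complex.normSq_eq_norm_sq,
    mul_comm]

lemma toSpace_conj_smul (t : ℝ) (z : ℂ) :
    toSpace (starRingEnd ℂ (t * z)) = t • toSpace (starRingEnd ℂ z) := by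
  rw [map_mul, Complex.conj_ofReal, toSpace_smul]

lemma isLittleO_inv {ζ d : ℂ} (hd : d ≠ 0) :
    (fun z => (z - (ζ - d))⁻¹ - (d⁻¹ + -((z - ζ) / d ^ 2) + (z - ζ) ^ 2 / d ^ 3))
      =o[𝓝 ζ] fun z => ‖z - ζ‖ ^ 2 := by
  have h1 : Tendsto (fun z : ℂ => -(z - ζ) / (d ^ 3 * (z - (ζ - d)))) (𝓝 ζ) (𝓝 0) := by
    have : ContinuousAt (fun z : ℂ => -(z - ζ) / (d ^ 3 * (z - (ζ - d)))) ζ := by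
      refine ContinuousAt.div (by fun_prop) (by fun_prop) ?_
      simp [hd]
    have h2 := this.tendsto
    simpa using h2
  have h2 : (fun z : ℂ => -(z - ζ) / (d ^ 3 * (z - (ζ - d))) * (z - ζ) ^ 2)
      =o[𝓝 ζ] fun z => ‖z - ζ‖ ^ 2 := by
    have := ((Asymptotics.isLittleO_one_iff ℝ).2 h1).mul_isBigO
      (Asymptotics.isBigO_refl (fun z : ℂ => (z - ζ) ^ 2) (𝓝 ζ)).norm_right
    simpa using this
  refine h2.congr' ?_ EventuallyEq.rfl
  have h3 : ∀ᶠ z in 𝓝 ζ, z - (ζ - d) ≠ 0 :=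
    (by fun_prop : ContinuousAt (fun z : ℂ => z - (ζ - d)) ζ).eventually_ne (by simpa using hd)
  filter_upwards [h3] with z hz
  field_simp
  ring

lemma isLittleO_invSimil {b w : E3} {l : ℝ} {R : E3 ≃ₗᵢ[ℝ] E3} {ζ d : ℂ} (hd : d ≠ 0)
    (hw : w = b + l • R (inv0 (toSpace d))) :
    (fun z => b + l • R (inv0 (toSpace z - toSpace (ζ - d))) -
      (w + l • R (toSpace (starRingEnd ℂ (-((z - ζ) / d ^ 2)))) +
        l • R (toSpace (starRingEnd ℂ ((z - ζ) ^ 2 / d ^ 3))))) =o[𝓝 ζ] fun z => ‖z - ζ‖ ^ 2 := by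
  let L : ℂ →L[ℝ] E3 := l • (R : E3 →L[ℝ] E3).comp (toSpaceL.comp (Complex.conjCLE : ℂ →L[ℝ] ℂ))
  have hL : ∀ z, L z = l • R (toSpace (starRingEnd ℂ z)) := fun z => rfl
  refine ((L.isBigO_comp _ _).trans_isLittleO (isLittleO_inv (ζ := ζ) hd)).congr_left fun z => ?_
  rw [← toSpace_sub, inv0_toSpace, hw, inv0_toSpace, ← hL, ← hL, ← hL, ← hL, map_sub, map_add,
    map_add]
  abel


/-! ### Best Möbius approximations of null curves -/

section best

variable {Φ : ℂ → C3} {F : ℂ → E3} {ζ : ℂ}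

/-- A best Möbius approximation maps the model circle to the circle of the surface. -/
lemma IsBestMobius.image_modelCircle {M : OnePoint E3 → OnePoint E3} (hM : IsBestMobius F ζ M)
    (hΦ : IsNehariCurve Φ) (hF : ∀ z ∈ disk, F z = reV (Φ z)) (hζ : ζ ∈ disk) :
    M '' modelCircle ζ = surfaceCircle Φ ζ := by
  obtain ⟨hMob, himg, hpt, m, hm, hc⟩ := hM
  have hX0 := hΦ.ne_zero ζ hζ
  have hinj : ∀ c : ℂ, reV (c • deriv Φ ζ) = 0 → c = 0 := by
    intro c h
    have := norm_reV_smul (hΦ.null ζ hζ) c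
    rw [h, norm_zero, zero_eq_mul, norm_eq_zero, norm_eq_zero] at this
    exact this.resolve_right (reV_ne_zero (hΦ.null ζ hζ) hX0)
  have hfin : (∀ p, M p ∈ surfaceCircle Φ ζ ↔ p ∈ modelCircle ζ) →
      M '' modelCircle ζ = surfaceCircle Φ ζ := by
    intro h
    ext q
    constructor
    · rintro ⟨p, hp, rfl⟩
      exact (h p).2 hp
    · intro hq
      obtain ⟨p, rfl⟩ := hMob.surjective q
      exact ⟨p, (h p).1 hq, rfl⟩
  apply hfin
  intro p
  rw [modelCircle_eq hζ, surfaceCircle, contactParam, ← hF ζ hζ]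
  rcases hMob.eq_simil_or_invSimil with ⟨b, l, R, hl, rfl⟩ | ⟨b, c, l, R, hl, rfl⟩
  · have hw : F ζ = b + l • R (toSpace ζ) := (OnePoint.coe_injective hpt).symm
    have hmE : (fun z => m z - (F ζ + l • R (toSpace (z - ζ)) + (0 : ℂ → E3) (z - ζ)))
        =o[𝓝 ζ] fun z => ‖z - ζ‖ ^ 2 := by
      refine (Asymptotics.isLittleO_zero _ _).congr' ?_ EventuallyEq.rfl
      filter_upwards [hm] with z hz
      have hz : b + l • R (toSpace z) = m z := OnePoint.coe_injective hz
      rw [← hz, hw, toSpace_sub, map_sub, smul_sub]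
      simp
    have key := eq_of_contact hΦ hF hζ (u := fun δ => l • R (toSpace δ)) (v := 0) hmE
      (fun t δ => by simp only [toSpace_smul, map_smul]; rw [smul_comm]) (fun t δ => by simp) hc
    -- A similarity has no second order term, so contact forces the tangential acceleration to
    -- vanish.
    have ha : tangCoeff (deriv Φ ζ) (deriv (deriv Φ) ζ) / 2 = 0 := by
      have := hinj _ (key 1).2.symm
      simpa using this
    rw [ha, sub_zero]
    exact simil_mem_contactCircle hl (fun δ => ((key δ).1).symm) hw p
  -- The pole lies in the horizontal plane, because the extended tangent plane contains `∞` and `∞`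
  -- itself is sent to the finite point `b`.
  · obtain ⟨κ, rfl⟩ : ∃ κ, c = toSpace κ := by
      have h1 : OnePoint.infty ∈ invSimil b c l R ''
          insert OnePoint.infty (range fun z : ℂ => (toSpace z : OnePoint E3)) := by
        rw [himg]; exact mem_insert _ _
      obtain ⟨q, hq | ⟨z, rfl⟩, h2⟩ := h1
      · rw [hq] at h2
        exact absurd h2 (OnePoint.coe_ne_infty b)
      · by_cases h3 : toSpace z = c
        · exact ⟨z, h3.symm⟩
        · simp [invSimil, h3] at h2
    have hinjS : ∀ {z : ℂ}, toSpace z = toSpace κ → z = κ := fun h => by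
      rw [← hor_toSpace κ, ← h, hor_toSpace]
    have hne : ζ ≠ κ := by
      rintro rfl
      simp [invSimil] at hpt
    obtain ⟨d, rfl⟩ : ∃ d, κ = ζ - d := ⟨ζ - κ, by ring⟩
    have hd : d ≠ 0 := by rintro rfl; simp at hne
    have hw : F ζ = b + l • R (inv0 (toSpace d)) := by
      simp only [invSimil, OnePoint.elim_some] at hpt
      rw [if_neg fun h => hne (hinjS h), ← toSpace_sub, sub_sub_cancel] at hpt
      exact (OnePoint.coe_injective hpt).symm
    have hmE := (isLittleO_invSimil (ζ := ζ) hd hw).congr' (f₂ := fun z => m z -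
      (F ζ + l • R (toSpace (starRingEnd ℂ (-((z - ζ) / d ^ 2)))) +
        l • R (toSpace (starRingEnd ℂ ((z - ζ) ^ 2 / d ^ 3))))) ?_ EventuallyEq.rfl
    · have key := eq_of_contact hΦ hF hζ
        (u := fun δ => l • R (toSpace (starRingEnd ℂ (-(δ / d ^ 2)))))
        (v := fun δ => l • R (toSpace (starRingEnd ℂ (δ ^ 2 / d ^ 3)))) hmE
        (fun t δ => by
          rw [mul_div_assoc, ← mul_neg, toSpace_conj_smul, map_smul, smul_comm])
        (fun t δ => by
          rw [mul_pow, mul_div_assoc, ← Complex.ofReal_pow, toSpace_conj_smul, map_smul, smul_comm])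
        hc
      have hX : ∀ δ : ℂ, reV (δ • deriv Φ ζ) = l • R (toSpace (-starRingEnd ℂ (δ / d ^ 2))) :=
        fun δ => by rw [← map_neg]; exact ((key δ).1).symm
      have h2 := (key 1).2
      -- At `δ = 1`, the quadratic term of the inversion equals its linear term at `-1 / d`.
      -- Comparison with the surface gives `tangCoeff / 2 = -(1 / d)`, the shift in
      -- `invSimil_mem_contactCircle`.
      have h3 := hX (-1 / d)
      rw [← map_neg] at h3
      have e : (1 : ℂ) ^ 2 / d ^ 3 = -(-1 / d / d ^ 2) := by field_simp
      simp only [e] at h2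
      rw [← h3, ← sub_eq_zero, ← map_sub, ← sub_smul] at h2
      have h4 := hinj _ h2
      have ha : tangCoeff (deriv Φ ζ) (deriv (deriv Φ) ζ) / 2 = -(1 / d) := by
        linear_combination -h4
      rw [ha, sub_neg_eq_add]
      exact invSimil_mem_contactCircle hl hd hX hw p
    · filter_upwards [hm, isOpen_ne.mem_nhds hne] with z hz hzne
      simp only [invSimil, OnePoint.elim_some] at hz
      rw [if_neg fun h => hzne (hinjS h)] at hz
      rw [OnePoint.coe_injective hz]

/-- The componentwise complex conjugate. -/
def conjV (X : C3) : C3 := !₂[starRingEnd ℂ (X 0), starRingEnd ℂ (X 1), starRingEnd ℂ (X 2)]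

lemma bil_conjV (X : C3) : bil (conjV X) (conjV X) = starRingEnd ℂ (bil X X) := by
  simp [bil, conjV]

lemma reV_smul_conjV (c : ℂ) (X : C3) : reV (c • conjV X) = reV (starRingEnd ℂ c • X) := by
  ext i; fin_cases i <;> simp [reV_apply, conjV]

lemma exists_inv_frame {X : C3} (h : bil X X = 0) (h0 : X ≠ 0) {d : ℂ} (hd : d ≠ 0) :
    ∃ (l : ℝ) (R : E3 ≃ₗᵢ[ℝ] E3), 0 < l ∧
      ∀ δ : ℂ, reV (δ • X) = l • R (toSpace (-starRingEnd ℂ (δ / d ^ 2))) := by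
  -- An inversion reverses the orientation of the plane, so its frame comes from the conjugate null
  -- vector; `-d ^ 2` undoes its derivative.
  have hb : bil (conjV (-d ^ 2 • X)) (conjV (-d ^ 2 • X)) = 0 := by
    rw [bil_conjV, bil_smul_smul, h, mul_zero, map_zero]
  have hne : conjV (-d ^ 2 • X) ≠ 0 := by
    intro h1
    apply reV_ne_zero h h0
    have h2 := reV_smul_conjV (starRingEnd ℂ (-1 / d ^ 2)) (-d ^ 2 • X)
    rw [h1, smul_zero, map_zero, Complex.conj_conj, smul_smul,
      show -1 / d ^ 2 * -d ^ 2 = 1 by field_simp, one_smul] at h2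
    exact h2.symm
  obtain ⟨R, hR⟩ := exists_frame hb hne
  refine ⟨_, R, norm_pos_iff.2 (reV_ne_zero hb hne), fun δ => ?_⟩
  rw [← hR, reV_smul_conjV, map_neg, Complex.conj_conj, smul_smul]
  congr 2
  field_simp

lemma exists_isBestMobius (hΦ : IsNehariCurve Φ) (hF : ∀ z ∈ disk, F z = reV (Φ z))
    (hζ : ζ ∈ disk) : ∃ M, IsBestMobius F ζ M := by
  have hX0 := hΦ.ne_zero ζ hζ
  have hnull := hΦ.null ζ hζ
  have hV := mem_tangentPlane hΦ hF hζ
  set a := tangCoeff (deriv Φ ζ) (deriv (deriv Φ) ζ) with ha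
  by_cases h0 : a = 0
  · obtain ⟨R, hR⟩ := exists_frame hnull hX0
    set l := ‖reV (deriv Φ ζ)‖
    have hl : 0 < l := norm_pos_iff.2 (reV_ne_zero hnull hX0)
    have hval : ∀ z, F ζ - l • R (toSpace ζ) + l • R (toSpace z) =
        F ζ + reV ((z - ζ) • deriv Φ ζ) := fun z => by
      rw [hR, toSpace_sub, map_sub, smul_sub]; abel
    refine ⟨simil (F ζ - l • R (toSpace ζ)) l R, isMobius_simil _ hl R, ?_, ?_,
      fun z => F ζ - l • R (toSpace ζ) + l • R (toSpace z), Eventually.of_forall fun z => rfl,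
      fun ψ hψ hψ0 => contact_of_isLittleO hΦ hF hζ
        (m := fun z => F ζ - l • R (toSpace ζ) + l • R (toSpace z)) ?_
        (hψ.differentiable (by simp)).differentiableAt hψ0⟩
    · rw [image_insert_eq]
      congr 1
      ext q
      constructor
      · rintro ⟨_, ⟨z, rfl⟩, rfl⟩
        exact ⟨_, (hV _).2 ⟨z - ζ, rfl⟩, congrArg _ (hval z).symm⟩
      · rintro ⟨v, hv, rfl⟩
        obtain ⟨δ, rfl⟩ := (hV v).1 hv
        refine ⟨_, ⟨ζ + δ, rfl⟩, congrArg _ ((hval _).trans ?_)⟩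
        rw [add_sub_cancel_left]
    · exact congrArg _ (sub_add_cancel _ _)
    · refine (Asymptotics.isLittleO_zero _ _).congr_left fun z => ?_
      rw [hval, ← ha, h0]
      simp
  -- In tangent coordinates the map is `δ ↦ d - d² / (δ + d) = δ - δ² / d + ⋯`; matching the
  -- tangential expansion `δ + (a / 2) δ²` dictates `d = -2 / a`.
  · obtain ⟨d, hd, had⟩ : ∃ d : ℂ, d ≠ 0 ∧ a / 2 = -(1 / d) :=
      ⟨-2 / a, div_ne_zero (by simp) h0, by field_simp⟩
    obtain ⟨l, R, hl, hR⟩ := exists_inv_frame hnull hX0 hd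
    set b := F ζ - l • R (inv0 (toSpace d)) with hb
    have hw : F ζ = b + l • R (inv0 (toSpace d)) := (sub_add_cancel _ _).symm
    have hinjS : ∀ {z κ : ℂ}, toSpace z = toSpace κ → z = κ := fun {z κ} h => by
      rw [← hor_toSpace κ, ← h, hor_toSpace]
    have hval : ∀ z, b + l • R (inv0 (toSpace z - toSpace (ζ - d))) =
        F ζ + reV ((d - d ^ 2 * (z - (ζ - d))⁻¹) • deriv Φ ζ) := fun z => by
      rw [hR, hb, ← toSpace_sub, inv0_toSpace, inv0_toSpace, ← map_neg, sub_add_eq_add_sub,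
        add_sub_assoc, ← smul_sub, ← map_sub, ← toSpace_sub, ← map_sub]
      congr 5
      field_simp
      ring
    have hfar : ∀ z, z ≠ ζ - d → invSimil b (toSpace (ζ - d)) l R (toSpace z) =
        ((b + l • R (inv0 (toSpace z - toSpace (ζ - d))) : E3) : OnePoint E3) := fun z hz => by
      simp only [invSimil, OnePoint.elim_some]
      rw [if_neg fun h => hz (hinjS h)]
    have hne : ζ ≠ ζ - d := fun h => hd (by linear_combination h)
    have hpole : invSimil b (toSpace (ζ - d)) l R (toSpace (ζ - d)) = OnePoint.infty := by
      simp [invSimil]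
    have hbval : b = F ζ + reV (d • deriv Φ ζ) := by
      have := hval (ζ - d)
      simpa [inv0_zero] using this
    refine ⟨invSimil b (toSpace (ζ - d)) l R, isMobius_invSimil _ _ hl R, ?_, ?_,
      fun z => b + l • R (inv0 (toSpace z - toSpace (ζ - d))), ?_,
      fun ψ hψ hψ0 => contact_of_isLittleO hΦ hF hζ
        (m := fun z => b + l • R (inv0 (toSpace z - toSpace (ζ - d)))) ?_
        (hψ.differentiable (by simp)).differentiableAt hψ0⟩
    · apply Subset.antisymm
      · rintro _ ⟨_, rfl | ⟨z, rfl⟩, rfl⟩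
        · exact Or.inr ⟨_, (hV _).2 ⟨d, rfl⟩, congrArg _ hbval.symm⟩
        · by_cases hz : z = ζ - d
          · subst hz
            exact Or.inl hpole
          · exact Or.inr ⟨_, (hV _).2 ⟨_, rfl⟩, ((hfar z hz).trans (congrArg _ (hval z))).symm⟩
      · rintro _ (rfl | ⟨v, hv, rfl⟩)
        · exact ⟨_, Or.inr ⟨_, rfl⟩, hpole⟩
        · obtain ⟨δ, rfl⟩ := (hV v).1 hv
          by_cases hδ : δ = d
          · subst hδ
            exact ⟨_, Or.inl rfl, congrArg _ hbval⟩
          · have hδ' : d - δ ≠ 0 := fun h => hδ (by linear_combination -h)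
            refine ⟨_, Or.inr ⟨ζ - d + d ^ 2 / (d - δ), rfl⟩, (hfar _ ?_).trans
              (congrArg _ ((hval _).trans ?_))⟩
            · intro h
              have : d ^ 2 / (d - δ) ≠ 0 := div_ne_zero (pow_ne_zero 2 hd) hδ'
              exact this (by linear_combination h)
            · congr 3
              rw [add_sub_cancel_left]
              field_simp
              ring
    · refine (hfar ζ hne).trans (congrArg _ ((hval ζ).trans ?_))
      rw [sub_sub_cancel, show d - d ^ 2 * d⁻¹ = 0 by field_simp; ring, zero_smul, map_zero, add_zero]
    · filter_upwards [isOpen_ne.mem_nhds hne] with z hz using hfar z hz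
    · refine (isLittleO_invSimil hd hw).congr_left fun z => ?_
      rw [add_smul, map_add, ← ha, had, ← add_assoc]
      congr 2
      · rw [hR, ← map_neg]
      · rw [hR, ← map_neg]
        congr 4
        field_simp

end best


/-! ### The circle bundle -/

section bundle

variable {Φ : ℂ → C3} {F : ℂ → E3} {ζ : ℂ}

lemma image_surface (hF : ∀ z ∈ disk, F z = reV (Φ z)) :
    (fun p : E3 => (p : OnePoint E3)) '' surface F = sphericalSurface Φ '' disk := by
  rw [surface, image_image]
  exact image_congr fun z hz => by rw [hF z hz, sphericalSurface]

/-- Points of the closure of the surface are points of the surface or boundary values. -/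
lemma IsNehariCurve.mem_closure_cases (hΦ : IsNehariCurve Φ) (hlim : HasBoundaryValues Φ)
    {p : OnePoint E3} (hp : p ∈ closure (sphericalSurface Φ '' disk)) :
    (∃ z ∈ disk, sphericalSurface Φ z = p) ∨
      ∃ ξ : ℂ, ‖ξ‖ = 1 ∧ Tendsto (sphericalSurface Φ) (𝓝[disk] ξ) (𝓝 p) := by
  rw [mem_closure_iff_clusterPt, ← map_principal] at hp
  -- An ultrafilter on the disk realizes `p` and converges in the compact closed disk, to an
  -- interior point or to a boundary point.
  obtain ⟨U, hU, hUp⟩ := mapClusterPt_iff_ultrafilter.1 hp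
  obtain ⟨ξ, hξ, hUξ⟩ := isCompact_iff_ultrafilter_le_nhds.1 (isCompact_closedBall (0 : ℂ) 1) U
    (hU.trans (principal_mono.2 Metric.ball_subset_closedBall))
  have hUd : (U : Filter ℂ) ≤ 𝓝[disk] ξ := le_inf hUξ hU
  by_cases h : ξ ∈ disk
  · refine Or.inl ⟨ξ, h, ?_⟩
    have hc : Tendsto (sphericalSurface Φ) (𝓝[disk] ξ) (𝓝 (sphericalSurface Φ ξ)) :=
      (OnePoint.continuous_coe.comp_continuousOn hΦ.continuousOn_surface) ξ h
    exact tendsto_nhds_unique (hc.mono_left hUd) hUp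
  · have h1 : ‖ξ‖ = 1 := by
      rw [mem_closedBall_zero_iff] at hξ
      rw [mem_ball_zero_iff, not_lt] at h
      exact le_antisymm hξ h
    obtain ⟨L, hL⟩ := hlim ξ h1
    exact Or.inr ⟨ξ, h1, tendsto_nhds_unique (hL.mono_left hUd) hUp ▸ hL⟩

lemma IsNehariCurve.surfaceCircle_inter_closure (hΦ : IsNehariCurve Φ) (hinj : BoundaryInjective Φ)
    (hζ : ζ ∈ disk) : surfaceCircle Φ ζ ∩ closure (sphericalSurface Φ '' disk) =
      {sphericalSurface Φ ζ} := by
  have hlim := hΦ.hasBoundaryValues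
  apply Subset.antisymm
  · rintro p ⟨hm, hp⟩
    by_contra hne
    have hne : sphericalSurface Φ ζ ≠ p := fun h => hne h.symm
    rcases hΦ.mem_closure_cases hlim hp with ⟨z, hz, h⟩ | ⟨ξ, hξ, hL⟩
    · exact hΦ.ne_of_mem hζ hne hm hz h
    · exact hΦ.notMem_of_tendsto hlim hinj hζ hξ hL hne hm
  · rintro _ rfl
    exact ⟨mem_surfaceCircle_self Φ ζ, subset_closure (mem_image_of_mem _ hζ)⟩

/-- When `p` is a base point, injectivity in the disk or the positive minimum of a profile decides;
otherwise two minima would coexist. -/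
lemma IsNehariCurve.eq_of_mem_surfaceCircle (hΦ : IsNehariCurve Φ) (hinj : BoundaryInjective Φ)
    {ζ₁ ζ₂ : ℂ} (h₁ : ζ₁ ∈ disk) (h₂ : ζ₂ ∈ disk) {p : OnePoint E3}
    (hm₁ : p ∈ surfaceCircle Φ ζ₁) (hm₂ : p ∈ surfaceCircle Φ ζ₂) : ζ₁ = ζ₂ := by
  by_cases hp₁ : sphericalSurface Φ ζ₁ = p
  · by_cases hp₂ : sphericalSurface Φ ζ₂ = p
    · exact hΦ.sphericalSurface_injOn h₁ h₂ (hp₁.trans hp₂.symm)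
    · exact absurd hp₁ (hΦ.ne_of_mem h₂ hp₂ hm₂ h₁)
  · exact hΦ.eq_of_mem_of_mem hΦ.hasBoundaryValues hinj h₁ h₂ hp₁ hm₁ hm₂

lemma IsNehariCurve.isCircleBundle (hΦ : IsNehariCurve Φ) (hF : ∀ z ∈ disk, F z = reV (Φ z))
    (hinj : BoundaryInjective Φ) {C : ℂ → Set (OnePoint E3)}
    (hC : ∀ ζ ∈ disk, C ζ = surfaceCircle Φ ζ) : IsCircleBundle F C where
  line_unique ζ₁ h₁ ζ₂ h₂ hm₁ hm₂ := by
    rw [hC _ h₁] at hm₁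
    rw [hC _ h₂] at hm₂
    exact hΦ.eq_of_mem_surfaceCircle hinj h₁ h₂ hm₁ hm₂
  orthogonal ζ hζ := by
    rw [hC ζ hζ, hF ζ hζ]
    exact isOrthogonalCircleAt_contactCircle _ (hΦ.null ζ hζ) (hΦ.ne_zero ζ hζ)
      (mem_tangentPlane hΦ hF hζ)
  inter_closure ζ hζ := by
    rw [hC ζ hζ, image_surface hF, hΦ.surfaceCircle_inter_closure hinj hζ, hF ζ hζ,
      sphericalSurface]
  disjoint ζ₁ h₁ ζ₂ h₂ hne := by
    rw [hC _ h₁, hC _ h₂]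
    exact disjoint_left.2 fun p hm₁ hm₂ => hne (hΦ.eq_of_mem_surfaceCircle hinj h₁ h₂ hm₁ hm₂)
  cover := by
    have hS : surface F = (fun z => reV (Φ z)) '' disk := image_congr hF
    ext q
    simp only [mem_preimage, mem_iUnion, exists_prop, mem_compl_iff, Set.mem_sdiff, not_and, not_not]
    constructor
    · rintro ⟨ζ, hζ, hm⟩ hq
      rw [hC ζ hζ] at hm
      have hq' : (q : OnePoint E3) ∈ closure (sphericalSurface Φ '' disk) := by
        rw [← image_surface hF]
        exact image_closure_subset_closure_image OnePoint.continuous_coe (mem_image_of_mem _ hq)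
      have := (hΦ.surfaceCircle_inter_closure hinj hζ).subset ⟨hm, hq'⟩
      rw [hS]
      exact ⟨ζ, hζ, (OnePoint.coe_injective this).symm⟩
    · intro h
      -- A point of the surface lies on its own circle; a point off the closure is reached by
      -- minimizing its profile.
      by_cases hq : q ∈ closure (surface F)
      · have hqS := h hq
        rw [hS] at hqS
        obtain ⟨ζ, hζ, rfl⟩ := hqS
        exact ⟨ζ, hζ, (hC ζ hζ).symm ▸ mem_surfaceCircle_self Φ ζ⟩
      · rw [hS] at hq
        obtain ⟨ζ, hζ, hm⟩ := hΦ.exists_mem_surfaceCircle hq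
        exact ⟨ζ, hζ, (hC ζ hζ).symm ▸ hm⟩

lemma boundaryInjective_of_injOn (hF : ∀ z ∈ disk, F z = reV (Φ z))
    (hinj : InjOn (sphericalExtension F) (Metric.sphere (0 : ℂ) 1)) : BoundaryInjective Φ := by
  have hext : ∀ ξ : ℂ, ‖ξ‖ = 1 → ∀ L, Tendsto (sphericalSurface Φ) (𝓝[disk] ξ) (𝓝 L) →
      sphericalExtension F ξ = L := by
    intro ξ hξ L hL
    refine extendFrom_eq ?_ (hL.congr' ?_)
    · rw [closure_ball (0 : ℂ) one_ne_zero, mem_closedBall_zero_iff, hξ]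
    · filter_upwards [self_mem_nhdsWithin] with z hz
      rw [hF z hz, sphericalSurface]
  intro ξ₁ ξ₂ h₁ h₂ L hL₁ hL₂
  exact hinj (mem_sphere_zero_iff_norm.2 h₁) (mem_sphere_zero_iff_norm.2 h₂)
    ((hext ξ₁ h₁ L hL₁).trans (hext ξ₂ h₂ L hL₂).symm)

end bundle

end HarmonicLift
end

theorem theorem4 (h g : ℂ → ℂ) (F : ℂ → HarmonicLift.E3) (ρ : ℝ)
    (hρ0 : 0 ≤ ρ) (hρ1 : ρ ≤ 1)
    (hF : HarmonicLift.IsLift h g F)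
    (hAW : HarmonicLift.AhlforsWeillCondition ρ h g)
    (hinj : Set.InjOn (HarmonicLift.sphericalExtension F) (Metric.sphere (0 : ℂ) 1)) :
    (∀ ζ ∈ HarmonicLift.disk, ∃ M : OnePoint HarmonicLift.E3 → OnePoint HarmonicLift.E3, HarmonicLift.IsBestMobius F ζ M) ∧
    ∀ M : ℂ → OnePoint HarmonicLift.E3 → OnePoint HarmonicLift.E3,
      (∀ ζ ∈ HarmonicLift.disk, HarmonicLift.IsBestMobius F ζ (M ζ)) →
      HarmonicLift.IsCircleBundle F (fun ζ => M ζ '' HarmonicLift.modelCircle ζ) := by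
  obtain ⟨P, hP, hsq, hF3⟩ := hF.exists_third
  have hΦ := HarmonicLift.isNehariCurve_nullCurve hρ1 hF.analytic_h hF.analytic_g hF.ne_zero hP hsq
    hAW
  have hFΦ : ∀ z ∈ HarmonicLift.disk, F z = HarmonicLift.reV (HarmonicLift.nullCurve h g P z) :=
    fun z hz => (hF3 z hz).trans (HarmonicLift.reV_comb _ _ _).symm
  exact ⟨fun ζ hζ => HarmonicLift.exists_isBestMobius hΦ hFΦ hζ, fun M hM =>
    hΦ.isCircleBundle hFΦ (HarmonicLift.boundaryInjective_of_injOn hFΦ hinj)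
      fun ζ hζ => (hM ζ hζ).image_modelCircle hΦ hFΦ hζ⟩
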